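/- Let $\Bbbk$ be a commutative ring. All groupoids are finite (finitely many objects and morphisms). **Bisets and spans.** For finite groupoids $G,H$, a *right-free $G,H$-biset* is a functor $U\colon H^{\mathrm{op}}\times G\to\mathrm{FinSet}$ on which $H$ acts freely ($s\cdot h=s$ with $s\in U(y,x)$, $h\in H(y,y)$ implies $h=\mathrm{id}_y$); equivariant maps are natural transformations. Let $\widehat{\mathrm{biset}}{}^{\mathrm{rf}}$ be the bicategory whose objects are the finite groupoids, whose 1-cells $H\to G$ are the right-free $G,H$-bisets, composed by $T\circ S=T\times_H S$ (the coend, with elements $[t,s]$, $[t\cdot h,s]=[t,h\cdot s]$) and with identities $\mathrm{Id}_G=G(-,-)$, and whose 2-cells $U\Rightarrow V$ are the isomorphism classes of spans $[U\overset{\beta}{\Leftarrow}W\overset{\alpha}{\Rightarrow}V]$ of equivariant maps of right-free $G,H$-bisets, composed vertically by pullback and horizontally by $\times_H$. The 2-cells $U\Rightarrow V$ form a commutative monoid under disjoint union of spans. Let $\Bbbk\widehat{\mathrm{biset}}{}^{\mathrm{rf}}$ be the $\Bbbk$-linear bicategory with the same objects and 1-cells, obtained by group-completing these monoids, tensoring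 them with $\Bbbk$ over $\mathbb Z$, and extending all compositions bilinearly. **Bimodules.** Let $\mathrm{perm}^{\mathrm{rf}}_{\Bbbk}$ be the $\Bbbk$-linear bicategory whose objects are the finite groupoids, whose 1-cells $H\to G$ are the right-free permutation $G,H$-bimodules, that is, functors $M\colon H^{\mathrm{op}}\times G\to\mathrm{Mod}(\Bbbk)$ for which there are finite bases $S(y,x)\subset M(y,x)$ that are stable under the two-sided action and on which $H$ acts freely, whose 2-cells are the natural transformations, whose horizontal composition is the tensor product $M\otimes_H N$, and whose identities are the bimodules $\Bbbk[\mathrm{Id}_G]$. **The pseudo-functor.** Let $\mathcal P\colon \Bbbk\widehat{\mathrm{biset}}{}^{\mathrm{rf}}\to\mathrm{perm}^{\mathrm{rf}}_{\Bbbk}$ be the pseudo-functor that sends a groupoid to itself, a 1-cell $U$ to $\Bbbk[U]$ (with $\Bbbk[U](y,x)=\Bbbk[U(y,x)]$), with the structure isomorphisms $\Bbbk[T\times_H S]\cong\Bbbk[T]\otimes_H\Bbbk[S]$, $[t,s]\mapsto t\otimes s$, and that is on 2-cells the unique $\Bbbk$-linear extension of sums over fibers $$[U\overset{\beta}{\Leftarrow}W\overset{\alpha}{\Rightarrow}V]\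 \longmapsto\ \Big(u\mapsto\sum_{w\in\beta^{-1}(u)}\alpha(w)\Big)\colon\ \Bbbk[U]\Rightarrow\Bbbk[V].$$ **Theorem.** On 2-cells, $\mathcal P$ is $\Bbbk$-linear and is the only $\Bbbk$-linear extension of its restriction to spans. Moreover: 1. $\mathcal P$ is the identity on objects. 2. $\mathcal P$ is essentially surjective on 1-cells: every 1-cell $M\colon H\to G$ of $\mathrm{perm}^{\mathrm{rf}}_{\Bbbk}$ is isomorphic to $\mathcal P(U)$ for some right-free $G,H$-biset $U$. 3. $\mathcal P$ is full on 2-cells: for all right-free $G,H$-bisets $U,V$, every 2-cell $\Bbbk[U]\Rightarrow\Bbbk[V]$ is the image of a 2-cell $U\Rightarrow V$ of $\Bbbk\widehat{\mathrm{biset}}{}^{\mathrm{rf}}$. 4. The kernel of $\mathcal P$ on 2-cells, i.e. the class of 2-cells $\varphi$ with $\mathcal P(\varphi)=0$, is the ideal generated by the *cohomological 2-cells* $$\big[\,G\overset{\mu}{\Leftarrow}G\times_H G\overset{\mu}{\Rightarrow}G\,\big]-[G:H]\cdot\mathrm{id}_{\mathrm{Id}_G}\colon\ \mathrm{Id}_G\Rightarrow\mathrm{Id}_G$$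 for all finite groups $G$ (seen as groupoids with one object, so that $\mathrm{Id}_G$ is the biset $G$) and all subgroups $H\le G$, where $\mu[g,g']=gg'$. Here the ideal generated by a class of 2-cells is the smallest class of 2-cells that contains it, is closed under $\Bbbk$-linear combinations of 2-cells with the same source and target, is closed under vertical composition on either side with arbitrary 2-cells, and is closed under horizontal composition on either side with arbitrary 2-cells. -/

import Mathlib

open CategoryTheory Opposite Bicategory

universe u

namespace Yoshida

/-- A finite groupoid: finitely many objects and finitely many morphisms. -/
structure FinGpd : Type 1 where
  carrier : Type
  [groupoid : Groupoid.{0} carrier]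
  [finite_obj : Finite carrier]
  [finite_hom : ∀ x y : carrier, Finite (x ⟶ y)]

instance : CoeSort FinGpd Type := ⟨FinGpd.carrier⟩

attribute [instance] FinGpd.groupoid FinGpd.finite_obj FinGpd.finite_hom

/-- A right-free finite `G,H`-biset: a functor `Hᵒᵖ × G ⥤ Type` with finite values, on which
`H` acts freely. -/
structure RFBiset (H G : FinGpd) : Type 1 where
  functor : Hᵒᵖ × G ⥤ Type
  finite : ∀ p, Finite (functor.obj p)
  free : ∀ {y : H} {x : G} (s : functor.obj (op y, x)) (h : y ⟶ y),
    functor.map (X := (op y, x)) (Y := (op y, x)) (h.op, 𝟙 x) s = s → h = 𝟙 y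

namespace RFBiset

variable {H G K L : FinGpd}

/-- The set `S(y,x)`. -/
def E (S : RFBiset H G) (y : H) (x : G) : Type := S.functor.obj (op y, x)

instance (S : RFBiset H G) (y : H) (x : G) : Finite (S.E y x) := S.finite _

/-- The two-sided action `s ↦ g · s · h`. -/
def act (S : RFBiset H G) {y y' : H} {x x' : G} (h : y' ⟶ y) (g : x ⟶ x') (s : S.E y x) :
    S.E y' x' :=
  S.functor.map (X := (op y, x)) (Y := (op y', x')) (h.op, g) s

@[simp] lemma act_id (S : RFBiset H G) {y : H} {x : G} (s : S.E y x) :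
    S.act (𝟙 y) (𝟙 x) s = s :=
  ConcreteCategory.congr_hom (S.functor.map_id (op y, x)) s

@[simp] lemma act_act (S : RFBiset H G) {y y' y'' : H} {x x' x'' : G} (h : y' ⟶ y) (g : x ⟶ x')
    (h' : y'' ⟶ y') (g' : x' ⟶ x'') (s : S.E y x) :
    S.act h' g' (S.act h g s) = S.act (h' ≫ h) (g ≫ g') s :=
  (ConcreteCategory.congr_hom (S.functor.map_comp (X := (op y, x)) (Y := (op y', x'))
    (Z := (op y'', x'')) (h.op, g) (h'.op, g')) s).symm

lemma eq_id (S : RFBiset H G) {y : H} {x : G} {s : S.E y x} {h : y ⟶ y}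
    (e : S.act h (𝟙 x) s = s) : h = 𝟙 y := S.free s h e

lemma eq_of_act (S : RFBiset H G) {y y' : H} {x : G} {s : S.E y x} {h h' : y' ⟶ y}
    (e : S.act h (𝟙 x) s = S.act h' (𝟙 x) s) : h = h' := by
  have := S.eq_id (s := s) (h := Groupoid.inv h' ≫ h)
    (by simpa using congrArg (S.act (Groupoid.inv h') (𝟙 x)) e)
  simpa using congrArg (h' ≫ ·) this

/-- Build a right-free biset from sets with a two-sided action. -/
def ofAct (E : H → G → Type) [fin : ∀ y x, Finite (E y x)]
    (act : ∀ {y y' : H} {x x' : G}, (y' ⟶ y) → (x ⟶ x') → E y x → E y' x')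
    (act_id : ∀ {y : H} {x : G} (s : E y x), act (𝟙 y) (𝟙 x) s = s)
    (act_act : ∀ {y y' y'' : H} {x x' x'' : G} (h : y' ⟶ y) (g : x ⟶ x') (h' : y'' ⟶ y')
      (g' : x' ⟶ x'') (s : E y x), act h' g' (act h g s) = act (h' ≫ h) (g ≫ g') s)
    (free : ∀ {y : H} {x : G} (s : E y x) (h : y ⟶ y), act h (𝟙 x) s = s → h = 𝟙 y) :
    RFBiset H G where
  functor :=
    { obj := fun p => E p.1.unop p.2
      map := fun f => TypeCat.ofHom (act f.1.unop f.2)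
      map_id := fun p => by ext s; exact act_id s
      map_comp := fun f g => by ext s; exact (act_act f.1.unop f.2 g.1.unop g.2 s).symm }
  finite := fun p => fin p.1.unop p.2
  free := fun s h e => free s h e

/-- Equivariant maps, that is, natural transformations. -/
instance : Category (RFBiset H G) where
  Hom S T := S.functor ⟶ T.functor
  id S := 𝟙 S.functor
  comp φ ψ := NatTrans.vcomp φ ψ

/-- The component of an equivariant map. -/
def ap {S T : RFBiset H G} (φ : S ⟶ T) {y : H} {x : G} (s : S.E y x) : T.E y x :=
  NatTrans.app (F := S.functor) (G := T.functor) φ (op y, x) s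

@[simp] lemma ap_id {S : RFBiset H G} {y : H} {x : G} (s : S.E y x) : ap (𝟙 S) s = s := rfl

@[simp] lemma ap_comp {S T U : RFBiset H G} (φ : S ⟶ T) (ψ : T ⟶ U) {y : H} {x : G}
    (s : S.E y x) : ap (φ ≫ ψ) s = ap ψ (ap φ s) := rfl

@[simp] lemma ap_act {S T : RFBiset H G} (φ : S ⟶ T) {y y' : H} {x x' : G} (h : y' ⟶ y)
    (g : x ⟶ x') (s : S.E y x) : ap φ (S.act h g s) = T.act h g (ap φ s) :=
  ConcreteCategory.congr_hom (NatTrans.naturality (F := S.functor) (G := T.functor) φ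
    (X := (op y, x)) (Y := (op y', x')) (h.op, g)) s

@[ext] lemma hom_ext {S T : RFBiset H G} {φ ψ : S ⟶ T}
    (e : ∀ (y : H) (x : G) (s : S.E y x), ap φ s = ap ψ s) : φ = ψ := by
  refine NatTrans.ext (funext fun p => ?_)
  ext s
  exact e p.1.unop p.2 s

/-- Build an equivariant map from its components. -/
def homMk {S T : RFBiset H G} (f : ∀ (y : H) (x : G), S.E y x → T.E y x)
    (nat : ∀ {y y' : H} {x x' : G} (h : y' ⟶ y) (g : x ⟶ x') (s : S.E y x),
      f y' x' (S.act h g s) = T.act h g (f y x s)) : S ⟶ T :=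
  show S.functor ⟶ T.functor from
  { app := fun p => TypeCat.ofHom (f p.1.unop p.2)
    naturality := fun p q u => by ext s; exact nat u.1.unop u.2 s }

@[simp] lemma ap_homMk {S T : RFBiset H G} (f : ∀ (y : H) (x : G), S.E y x → T.E y x)
    (nat) {y : H} {x : G} (s : S.E y x) : ap (homMk (S := S) (T := T) f nat) s = f y x s := rfl

/-- A pointwise bijective equivariant map is an isomorphism. -/
noncomputable def isoOfBijective {S T : RFBiset H G} (φ : S ⟶ T)
    (hφ : ∀ y x, Function.Bijective (fun s : S.E y x => ap φ s)) : S ≅ T where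
  hom := φ
  inv := homMk (fun y x t => (Equiv.ofBijective _ (hφ y x)).symm t) (by
    intro y y' x x' h g s
    apply (hφ y' x').1
    have e1 := (Equiv.ofBijective _ (hφ y' x')).apply_symm_apply (T.act h g s)
    have e2 := (Equiv.ofBijective _ (hφ y x)).apply_symm_apply s
    simp only [Equiv.ofBijective_apply] at e1 e2
    simp only [ap_act, e1, e2])
  hom_inv_id := by
    ext y x s
    exact (Equiv.ofBijective _ (hφ y x)).symm_apply_apply s
  inv_hom_id := by
    ext y x s
    exact (Equiv.ofBijective _ (hφ y x)).apply_symm_apply s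

lemma ap_bijective {S T : RFBiset H G} (e : S ≅ T) (y : H) (x : G) :
    Function.Bijective (fun s : S.E y x => ap e.hom s) := by
  refine Function.bijective_iff_has_inverse.2 ⟨fun t => ap e.inv t, fun s => ?_, fun t => ?_⟩
  · simp only [← ap_comp, e.hom_inv_id, ap_id]
  · simp only [← ap_comp, e.inv_hom_id, ap_id]

/-! ### Tensor product of bisets -/

/-- `(t, s)` at `y` and `(t', s')` at `y'` are identified iff `(t, g · s) = (t' · g, s')` for
some `g : y ⟶ y'`. -/
def TensRel (T : RFBiset H G) (S : RFBiset K H) (z : K) (x : G)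
    (a b : Σ y : H, T.E y x × S.E z y) : Prop :=
  ∃ g : a.1 ⟶ b.1, a.2.1 = T.act g (𝟙 x) b.2.1 ∧ S.act (𝟙 z) g a.2.2 = b.2.2

lemma tensRel_equivalence (T : RFBiset H G) (S : RFBiset K H) (z : K) (x : G) :
    Equivalence (TensRel T S z x) where
  refl a := ⟨𝟙 _, by simp⟩
  symm := by
    rintro ⟨y, t, s⟩ ⟨y', t', s'⟩ ⟨g, h1, h2⟩
    dsimp only at g h1 h2
    subst h1 h2
    exact ⟨Groupoid.inv g, by simp⟩
  trans := by
    rintro ⟨y, t, s⟩ ⟨y', t', s'⟩ ⟨y'', t'', s''⟩ ⟨g, h1, h2⟩ ⟨g', h3, h4⟩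
    dsimp only at g h1 h2 g' h3 h4
    subst h3 h4
    subst h1 h2
    exact ⟨g ≫ g', by simp⟩

def tensSetoid (T : RFBiset H G) (S : RFBiset K H) (z : K) (x : G) :
    Setoid (Σ y : H, T.E y x × S.E z y) := ⟨TensRel T S z x, tensRel_equivalence T S z x⟩

/-- The composite biset `T ×_H S`; its elements are the classes `[t, s]`, and
`g · [t, s] · k = [g · t, s · k]`. -/
def tens (T : RFBiset H G) (S : RFBiset K H) : RFBiset K G :=
  ofAct (fun z x => Quotient (tensSetoid T S z x))
    (fun {z z' x x'} k g => Quotient.map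
      (fun a => ⟨a.1, T.act (𝟙 a.1) g a.2.1, S.act k (𝟙 a.1) a.2.2⟩) (by
      rintro ⟨y, t, s⟩ ⟨y', t', s'⟩ ⟨g, h1, h2⟩
      dsimp only at g h1 h2
      subst h1 h2
      exact ⟨g, by simp⟩))
    (by
      rintro z x ⟨y, t, s⟩
      exact congrArg (Quotient.mk _) (by simp))
    (by
      rintro z z' z'' x x' x'' h g h' g' ⟨y, t, s⟩
      exact congrArg (Quotient.mk _) (by simp))
    (by
      rintro z x ⟨y, t, s⟩ h e
      obtain ⟨g, e1, e2⟩ := Quotient.exact e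
      dsimp only at g e1 e2
      have hg : g = 𝟙 y := T.eq_id (s := t) (by simpa using e1.symm)
      subst hg
      exact S.eq_id (s := s) (by simpa using e2))

/-- The class `[t, s]` at `y`. -/
def tmk {T : RFBiset H G} {S : RFBiset K H} {z : K} {x : G} {y : H} (t : T.E y x) (s : S.E z y) :
    (tens T S).E z x := Quotient.mk (tensSetoid T S z x) ⟨y, t, s⟩

lemma tmk_eq_iff {T : RFBiset H G} {S : RFBiset K H} {z : K} {x : G} {y y' : H} {t : T.E y x}
    {s : S.E z y} {t' : T.E y' x} {s' : S.E z y'} :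
    tmk t s = tmk t' s' ↔ ∃ g : y ⟶ y', t = T.act g (𝟙 x) t' ∧ S.act (𝟙 z) g s = s' :=
  Quotient.eq (r := tensSetoid T S z x)

lemma tmk_balance {T : RFBiset H G} {S : RFBiset K H} {z : K} {x : G} {y y' : H} (t : T.E y x)
    (g : y' ⟶ y) (s : S.E z y') : tmk (T.act g (𝟙 x) t) s = tmk t (S.act (𝟙 z) g s) :=
  tmk_eq_iff.2 ⟨g, rfl, rfl⟩

@[elab_as_elim] lemma tens_ind {T : RFBiset H G} {S : RFBiset K H} {z : K} {x : G}
    {P : (tens T S).E z x → Prop}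
    (h : ∀ (y : H) (t : T.E y x) (s : S.E z y), P (tmk t s)) (q) : P q :=
  Quotient.ind (s := tensSetoid T S z x) (fun ⟨y, t, s⟩ => h y t s) q

/-- Functions out of `T ×_H S` are balanced functions of pairs. -/
def tlift {T : RFBiset H G} {S : RFBiset K H} {z : K} {x : G} {α : Type*}
    (f : ∀ (y : H), T.E y x → S.E z y → α)
    (hf : ∀ (y y' : H) (t : T.E y x) (g : y' ⟶ y) (s : S.E z y'),
      f y' (T.act g (𝟙 x) t) s = f y t (S.act (𝟙 z) g s)) :
    (tens T S).E z x → α :=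
  Quotient.lift (s := tensSetoid T S z x) (fun a => f a.1 a.2.1 a.2.2) (by
    rintro ⟨y, t, s⟩ ⟨y', t', s'⟩ ⟨g, h1, h2⟩
    dsimp only at g h1 h2
    subst h1 h2
    exact hf _ _ _ _ _)

@[simp] lemma tlift_tmk {T : RFBiset H G} {S : RFBiset K H} {z : K} {x : G} {α : Type*}
    (f : ∀ (y : H), T.E y x → S.E z y → α) (hf) {y : H} (t : T.E y x) (s : S.E z y) :
    tlift f hf (tmk t s : (tens T S).E z x) = f y t s := rfl

@[simp] lemma tens_act (T : RFBiset H G) (S : RFBiset K H) {z z' : K} {x x' : G} {y : H}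
    (k : z' ⟶ z) (g : x ⟶ x') (t : T.E y x) (s : S.E z y) :
    (tens T S).act k g (tmk t s) = tmk (T.act (𝟙 _) g t) (S.act k (𝟙 _) s) := rfl

/-- Build a map out of a tensor product of bisets. -/
def tensHom {T : RFBiset H G} {S : RFBiset K H} {U : RFBiset K G}
    (f : ∀ {z : K} {x : G} {y : H}, T.E y x → S.E z y → U.E z x)
    (hf : ∀ {z : K} {x : G} {y y' : H} (t : T.E y x) (g : y' ⟶ y) (s : S.E z y'),
      f (T.act g (𝟙 x) t) s = f t (S.act (𝟙 z) g s))
    (nat : ∀ {z z' : K} {x x' : G} {y : H} (k : z' ⟶ z) (g : x ⟶ x') (t : T.E y x) (s : S.E z y),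
      f (T.act (𝟙 y) g t) (S.act k (𝟙 y) s) = U.act k g (f t s)) : tens T S ⟶ U :=
  homMk (fun _ _ => tlift (fun _ t s => f t s) (fun _ _ t g s => hf t g s)) (by
    intro z z' x x' h g q
    induction q using tens_ind with
    | h y t s => exact nat h g t s)

@[simp] lemma ap_tensHom {T : RFBiset H G} {S : RFBiset K H} {U : RFBiset K G}
    (f : ∀ {z : K} {x : G} {y : H}, T.E y x → S.E z y → U.E z x) (hf) (nat)
    {z : K} {x : G} {y : H} (t : T.E y x) (s : S.E z y) :
    ap (tensHom (U := U) f hf nat) (tmk t s) = f t s := rfl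

lemma tensHom_ext {T : RFBiset H G} {S : RFBiset K H} {U : RFBiset K G} {φ ψ : tens T S ⟶ U}
    (e : ∀ (z : K) (x : G) (y : H) (t : T.E y x) (s : S.E z y),
      ap φ (tmk t s) = ap ψ (tmk t s)) : φ = ψ := by
  ext z x q
  induction q using tens_ind with
  | h y t s => exact e z x y t s

/-- The map of tensor products induced by two equivariant maps. -/
def tensMap {T T' : RFBiset H G} {S S' : RFBiset K H} (φ : T ⟶ T') (ψ : S ⟶ S') :
    tens T S ⟶ tens T' S' :=
  tensHom (fun t s => tmk (ap φ t) (ap ψ s)) (by intros; simp [tmk_balance]) (by intros; simp)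

@[simp] lemma ap_tensMap {T T' : RFBiset H G} {S S' : RFBiset K H} (φ : T ⟶ T') (ψ : S ⟶ S')
    {z : K} {x : G} {y : H} (t : T.E y x) (s : S.E z y) :
    ap (tensMap φ ψ) (tmk t s) = tmk (ap φ t) (ap ψ s) := rfl

/-- The identity biset `G(-,-)`. -/
def idB (G : FinGpd) : RFBiset G G :=
  ofAct (fun y x => (y ⟶ x)) (fun h g s => h ≫ s ≫ g) (by simp) (by simp)
    (fun s h e => by
      have := congrArg (· ≫ Groupoid.inv s) e
      simpa using this)

/-- A morphism of `G` as an element of the identity biset. -/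
def idB.of {y x : G} (g : y ⟶ x) : (idB G).E y x := g

def idB.hom {y x : G} (g : (idB G).E y x) : y ⟶ x := g

@[simp] lemma idB.hom_of {y x : G} (g : y ⟶ x) : idB.hom (idB.of g) = g := rfl

@[simp] lemma idB.hom_act {y y' x x' : G} (h : y' ⟶ y) (k : x ⟶ x') (g : (idB G).E y x) :
    idB.hom ((idB G).act h k g) = h ≫ idB.hom g ≫ k := rfl

@[simp] lemma idB.act_of {y y' x x' : G} (h : y' ⟶ y) (k : x ⟶ x') (g : y ⟶ x) :
    (idB G).act h k (idB.of g) = idB.of (h ≫ g ≫ k) := rfl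

lemma idB.of_hom {y x : G} (g : (idB G).E y x) : idB.of (idB.hom g) = g := rfl

/-- The associativity isomorphism `[u, [t, s]] ↦ [[u, t], s]`. -/
def assocB (U : RFBiset G L) (T : RFBiset H G) (S : RFBiset K H) :
    tens U (tens T S) ≅ tens (tens U T) S where
  hom := tensHom (fun {z x y} u => tlift (fun _ t s => tmk (tmk u t) s) (by
        intro y y' t g s
        rw [← tmk_balance]; simp))
      (by
        intro z x y y' u g p
        induction p using tens_ind with
        | h w t s => simp [tmk_balance])
      (by
        intro z z' x x' y k g u p
        induction p using tens_ind with
        | h w t s => simp)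
  inv := tensHom (fun {z x y} p s => tlift (fun _ u t => tmk u (tmk t s)) (by
        intro y y' t g s
        rw [tmk_balance]; simp) p)
      (by
        intro z x y y' p g s
        induction p using tens_ind with
        | h w u t => simp [tmk_balance])
      (by
        intro z z' x x' y k g p s
        induction p using tens_ind with
        | h w u t => simp)
  hom_inv_id := by
    refine tensHom_ext fun z x y u p => ?_
    induction p using tens_ind with
    | h w t s => rfl
  inv_hom_id := by
    refine tensHom_ext fun z x y p s => ?_
    induction p using tens_ind with
    | h w u t => rfl

/-- The unit isomorphism `[t, h] ↦ t · h`. -/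
def unitR (T : RFBiset H G) : tens T (idB H) ≅ T where
  hom := tensHom (fun t s => T.act (idB.hom s) (𝟙 _) t) (by intros; simp) (by intros; simp)
  inv := homMk (fun y x t => tmk t (idB.of (𝟙 y))) (by
    intro y y' x x' h g t
    simpa using tmk_balance (T.act (𝟙 y) g t) h (idB.of (𝟙 y')))
  hom_inv_id := by
    refine tensHom_ext fun z x y t s => ?_
    simp [idB.of_hom]
  inv_hom_id := by ext; simp

/-- The unit isomorphism `[g, t] ↦ g · t`. -/
def unitL (T : RFBiset H G) : tens (idB G) T ≅ T where
  hom := tensHom (fun g t => T.act (𝟙 _) (idB.hom g) t) (by intros; simp) (by intros; simp)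
  inv := homMk (fun y x t => tmk (idB.of (𝟙 x)) t) (by
    intro y y' x x' h g t
    simpa using (tmk_balance (idB.of (𝟙 x')) g (T.act h (𝟙 x) t)).symm)
  hom_inv_id := by
    refine tensHom_ext fun z x y t s => ?_
    simp [idB.of_hom]
  inv_hom_id := by ext; simp

lemma unitR_nat {T T' : RFBiset H G} (φ : T ⟶ T') :
    (unitR T).hom ≫ φ = tensMap φ (𝟙 (idB H)) ≫ (unitR T').hom :=
  tensHom_ext fun _ _ _ _ _ => by simp [unitR]

lemma unitL_nat {T T' : RFBiset H G} (φ : T ⟶ T') :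
    (unitL T).hom ≫ φ = tensMap (𝟙 (idB G)) φ ≫ (unitL T').hom :=
  tensHom_ext fun _ _ _ _ _ => by simp [unitL]

end RFBiset

open RFBiset

/-- The objects of the bicategory of right-free bisets: finite groupoids. -/
structure BisetRF : Type 1 where
  gpd : FinGpd

/-- The bicategory of finite groupoids, right-free finite bisets and equivariant maps; a
`G,H`-biset is a 1-cell `H ⟶ G`. -/
instance : Bicategory.{0, 1} BisetRF where
  Hom H G := RFBiset H.gpd G.gpd
  id G := idB G.gpd
  comp S T := tens T S
  homCategory H G := inferInstanceAs (Category.{0} (RFBiset H.gpd G.gpd))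
  whiskerLeft S _ _ φ := tensMap φ (𝟙 S)
  whiskerRight φ T := tensMap (𝟙 T) φ
  associator S T U := assocB U T S
  leftUnitor T := unitR T
  rightUnitor T := unitL T
  whiskerLeft_id _ _ := tensHom_ext fun _ _ _ _ _ => rfl
  whiskerLeft_comp _ _ _ _ _ _ := tensHom_ext fun _ _ _ _ _ => rfl
  id_whiskerLeft φ := by
    rw [← Category.assoc]
    exact (Iso.eq_comp_inv _).2 (unitR_nat φ).symm
  comp_whiskerLeft _ _ _ _ _ := by
    refine tensHom_ext fun _ _ _ t p => ?_
    induction p using tens_ind with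
    | h w u t => rfl
  id_whiskerRight _ _ := tensHom_ext fun _ _ _ _ _ => rfl
  comp_whiskerRight _ _ _ := tensHom_ext fun _ _ _ _ _ => rfl
  whiskerRight_id φ := by
    rw [← Category.assoc]
    exact (Iso.eq_comp_inv _).2 (unitL_nat φ).symm
  whiskerRight_comp _ _ _ := by
    refine tensHom_ext fun _ _ _ p t => ?_
    induction p using tens_ind with
    | h w u t => rfl
  whisker_assoc _ _ _ _ _ := by
    refine tensHom_ext fun _ _ _ t p => ?_
    induction p using tens_ind with
    | h w u t => rfl
  whisker_exchange _ _ := tensHom_ext fun _ _ _ _ _ => rfl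
  pentagon _ _ _ _ := by
    refine tensHom_ext fun _ _ _ u p => ?_
    induction p using tens_ind with
    | h w t p => 
      induction p using tens_ind with
      | h w t p => rfl
  triangle S T := by
    refine tensHom_ext fun _ _ _ t p => ?_
    induction p using tens_ind with
    | h w g s => simp [assocB, unitL, unitR, tmk_balance]

/-! ### Spans of equivariant maps -/

namespace RFBiset

variable {H G K : FinGpd}

/-- The pullback of right-free bisets. -/
def pb {U V W : RFBiset H G} (f : U ⟶ W) (g : V ⟶ W) : RFBiset H G :=
  ofAct (fun y x => {q : U.E y x × V.E y x // ap f q.1 = ap g q.2})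
    (fun h k q => ⟨(U.act h k q.1.1, V.act h k q.1.2), by simp [q.2]⟩)
    (fun q => Subtype.ext (by simp)) (fun h g h' g' q => Subtype.ext (by simp))
    (fun q h e => U.eq_id (congrArg (fun q => q.1.1) e))

/-- The first projection of the pullback. -/
def pbFst {U V W : RFBiset H G} (f : U ⟶ W) (g : V ⟶ W) : pb f g ⟶ U :=
  homMk (fun _ _ q => q.1.1) (fun _ _ _ => rfl)

/-- The second projection of the pullback. -/
def pbSnd {U V W : RFBiset H G} (f : U ⟶ W) (g : V ⟶ W) : pb f g ⟶ V :=
  homMk (fun _ _ q => q.1.2) (fun _ _ _ => rfl)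

/-- A square of equivariant maps is cartesian. -/
structure IsPB {P U V W : RFBiset H G} (a : P ⟶ U) (b : P ⟶ V) (f : U ⟶ W) (g : V ⟶ W) :
    Prop where
  comm : ∀ {y : H} {x : G} (p : P.E y x), ap f (ap a p) = ap g (ap b p)
  lift : ∀ {y : H} {x : G} (u : U.E y x) (v : V.E y x), ap f u = ap g v →
    ∃ p, ap a p = u ∧ ap b p = v
  inj : ∀ {y : H} {x : G} (p q : P.E y x), ap a p = ap a q → ap b p = ap b q → p = q

lemma isPB_pb {U V W : RFBiset H G} (f : U ⟶ W) (g : V ⟶ W) :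
    IsPB (pbFst f g) (pbSnd f g) f g where
  comm p := p.2
  lift u v e := ⟨⟨(u, v), e⟩, rfl, rfl⟩
  inj _ _ e e' := Subtype.ext (Prod.ext e e')

lemma isPB_right {U V W : RFBiset H G} (f : U ⟶ W) (e : W ≅ V) :
    IsPB (𝟙 U) (f ≫ e.hom) f e.inv where
  comm p := by simp [← ap_comp]
  lift u v h := ⟨u, rfl, by rw [ap_comp, h, ← ap_comp, e.inv_hom_id, ap_id]⟩
  inj _ _ h _ := h

lemma isPB_left {U V W : RFBiset H G} (f : U ⟶ W) (e : V ≅ W) :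
    IsPB (f ≫ e.inv) (𝟙 U) e.hom f where
  comm p := by simp [← ap_comp]
  lift u v h := ⟨v, by rw [ap_comp, ← h, ← ap_comp, e.hom_inv_id, ap_id], rfl⟩
  inj _ _ _ h := h

/-- The tensor product of two cartesian squares of right-free bisets is cartesian. -/
lemma IsPB.tens {P U V W : RFBiset H G} {a : P ⟶ U} {b : P ⟶ V} {f : U ⟶ W} {g : V ⟶ W}
    {P' U' V' W' : RFBiset K H} {a' : P' ⟶ U'} {b' : P' ⟶ V'} {f' : U' ⟶ W'} {g' : V' ⟶ W'}
    (h : IsPB a b f g) (h' : IsPB a' b' f' g') :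
    IsPB (tensMap a a') (tensMap b b') (tensMap f f') (tensMap g g') where
  comm p := by
    induction p using tens_ind with
    | h w p q => simp [h.comm, h'.comm]
  lift u v := by
    induction u using tens_ind with
    | h y u u' =>
      induction v using tens_ind with
      | h z v v' =>
        intro e
        obtain ⟨k, e1, e2⟩ := tmk_eq_iff.1 e
        obtain ⟨p, hp1, hp2⟩ := h.lift u (V.act k (𝟙 _) v) (by simpa using e1)
        obtain ⟨p', hp1', hp2'⟩ := h'.lift u' (V'.act (𝟙 _) (Groupoid.inv k) v')
          (by simp [← e2])
        refine ⟨tmk p p', by simp [hp1, hp1'], ?_⟩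
        simp [hp2, hp2', tmk_balance]
  inj p q := by
    induction p using tens_ind with
    | h y p p' =>
      induction q using tens_ind with
      | h z q q' =>
        intro e1 e2
        obtain ⟨k, e3, e4⟩ := tmk_eq_iff.1 e1
        obtain ⟨l, e5, e6⟩ := tmk_eq_iff.1 e2
        have hkl : k = l := W.eq_of_act (s := ap f (ap a q)) (by
          rw [← ap_act, ← e3, h.comm, e5, ap_act, h.comm])
        subst hkl
        refine tmk_eq_iff.2 ⟨k, h.inj _ _ (by simpa using e3) (by simpa using e5),
          h'.inj _ _ (by simpa using e4) (by simpa using e6)⟩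

/-- The disjoint union of bisets. -/
def sumB (U V : RFBiset H G) : RFBiset H G :=
  ofAct (fun y x => U.E y x ⊕ V.E y x) (fun h g => Sum.map (U.act h g) (V.act h g))
    (by rintro y x (s | s) <;> simp) (by rintro y y' y'' x x' x'' h g h' g' (s | s) <;> simp)
    (by
      rintro y x (s | s) h e
      · exact U.eq_id (Sum.inl_injective e)
      · exact V.eq_id (Sum.inr_injective e))

def inlB (U V : RFBiset H G) : U ⟶ sumB U V := homMk (fun _ _ s => Sum.inl s) (fun _ _ _ => rfl)

def inrB (U V : RFBiset H G) : V ⟶ sumB U V := homMk (fun _ _ s => Sum.inr s) (fun _ _ _ => rfl)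

lemma sumB_ind {U V : RFBiset H G} {y : H} {x : G} {P : (sumB U V).E y x → Prop}
    (hl : ∀ s : U.E y x, P (ap (inlB U V) s)) (hr : ∀ s : V.E y x, P (ap (inrB U V) s))
    (q : (sumB U V).E y x) : P q := Sum.rec hl hr q

/-- The map out of a disjoint union given by two maps. -/
def descB {U V W : RFBiset H G} (f : U ⟶ W) (g : V ⟶ W) : sumB U V ⟶ W :=
  homMk (fun y x => Sum.elim (fun s : U.E y x => ap f s) (fun s : V.E y x => ap g s))
    (by rintro y y' x x' h k (s | s) <;> [exact ap_act f h k s; exact ap_act g h k s])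

lemma inl_desc {U V W : RFBiset H G} (f : U ⟶ W) (g : V ⟶ W) : inlB U V ≫ descB f g = f := rfl

lemma inr_desc {U V W : RFBiset H G} (f : U ⟶ W) (g : V ⟶ W) : inrB U V ≫ descB f g = g := rfl

/-- The empty biset. -/
def emptyB (H G : FinGpd) : RFBiset H G :=
  ofAct (fun _ _ => Empty) (fun _ _ s => s) (fun _ => rfl) (fun _ _ _ _ _ => rfl)
    (fun s => s.elim)

def emptyDesc (U : RFBiset H G) : emptyB H G ⟶ U :=
  homMk (fun _ _ s => Empty.elim s) (fun _ _ s => Empty.elim s)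

/-- The maps `i` and `j` exhibit `S` as a disjoint union. -/
structure IsSum {A B S : RFBiset H G} (i : A ⟶ S) (j : B ⟶ S) : Prop where
  cover : ∀ {y : H} {x : G} (s : S.E y x), (∃ a, ap i a = s) ∨ ∃ b, ap j b = s
  inj₁ : ∀ {y : H} {x : G} (a a' : A.E y x), ap i a = ap i a' → a = a'
  inj₂ : ∀ {y : H} {x : G} (b b' : B.E y x), ap j b = ap j b' → b = b'
  disj : ∀ {y : H} {x : G} (a : A.E y x) (b : B.E y x), ap i a ≠ ap j b

lemma isSum_sumB (A B : RFBiset H G) : IsSum (inlB A B) (inrB A B) where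
  cover s := by
    induction s using sumB_ind with
    | hl s => exact Or.inl ⟨s, rfl⟩
    | hr s => exact Or.inr ⟨s, rfl⟩
  inj₁ _ _ e := Sum.inl_injective e
  inj₂ _ _ e := Sum.inr_injective e
  disj _ _ := Sum.inl_ne_inr

lemma IsSum.symm {A B S : RFBiset H G} {i : A ⟶ S} {j : B ⟶ S} (h : IsSum i j) : IsSum j i :=
  ⟨fun s => (h.cover s).symm, h.inj₂, h.inj₁, fun a b e => h.disj b a e.symm⟩

lemma IsSum.tensLeft {A B S : RFBiset H G} {i : A ⟶ S} {j : B ⟶ S} (h : IsSum i j)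
    (T : RFBiset K H) : IsSum (tensMap i (𝟙 T)) (tensMap j (𝟙 T)) where
  cover s := by
    induction s using tens_ind with
    | h y s t =>
      rcases h.cover s with ⟨a, rfl⟩ | ⟨a, rfl⟩
      · exact Or.inl ⟨tmk a t, rfl⟩
      · exact Or.inr ⟨tmk a t, rfl⟩
  inj₁ a a' e := by
    induction a using tens_ind with
    | h y a t =>
      induction a' using tens_ind with
      | h y' a' t' =>
        obtain ⟨k, e1, e2⟩ := tmk_eq_iff.1 e
        exact tmk_eq_iff.2 ⟨k, h.inj₁ _ _ (by simpa using e1), e2⟩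
  inj₂ a a' e := by
    induction a using tens_ind with
    | h y a t =>
      induction a' using tens_ind with
      | h y' a' t' =>
        obtain ⟨k, e1, e2⟩ := tmk_eq_iff.1 e
        exact tmk_eq_iff.2 ⟨k, h.inj₂ _ _ (by simpa using e1), e2⟩
  disj a b e := by
    induction a using tens_ind with
    | h y a t =>
      induction b using tens_ind with
      | h y' b t' =>
        obtain ⟨k, e1, e2⟩ := tmk_eq_iff.1 e
        exact h.disj a (B.act k (𝟙 _) b) (by simpa using e1)

lemma IsSum.tensRight {A B S : RFBiset K H} {i : A ⟶ S} {j : B ⟶ S} (h : IsSum i j)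
    (T : RFBiset H G) : IsSum (tensMap (𝟙 T) i) (tensMap (𝟙 T) j) where
  cover s := by
    induction s using tens_ind with
    | h y t s =>
      rcases h.cover s with ⟨a, rfl⟩ | ⟨a, rfl⟩
      · exact Or.inl ⟨tmk t a, rfl⟩
      · exact Or.inr ⟨tmk t a, rfl⟩
  inj₁ a a' e := by
    induction a using tens_ind with
    | h y t a =>
      induction a' using tens_ind with
      | h y' t' a' =>
        obtain ⟨k, e1, e2⟩ := tmk_eq_iff.1 e
        exact tmk_eq_iff.2 ⟨k, e1, h.inj₁ _ _ (by simpa using e2)⟩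
  inj₂ a a' e := by
    induction a using tens_ind with
    | h y t a =>
      induction a' using tens_ind with
      | h y' t' a' =>
        obtain ⟨k, e1, e2⟩ := tmk_eq_iff.1 e
        exact tmk_eq_iff.2 ⟨k, e1, h.inj₂ _ _ (by simpa using e2)⟩
  disj a b e := by
    induction a using tens_ind with
    | h y t a =>
      induction b using tens_ind with
      | h y' t' b =>
        obtain ⟨k, e1, e2⟩ := tmk_eq_iff.1 e
        exact h.disj (A.act (𝟙 _) k a) b (by simpa using e2)

/-- A span `U ⇐ apex ⇒ V` of equivariant maps. -/
structure BSpan (U V : RFBiset H G) : Type 1 where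
  apex : RFBiset H G
  l : apex ⟶ U
  r : apex ⟶ V

/-- Isomorphism of spans. -/
def BSpan.Rel {U V : RFBiset H G} (s t : BSpan U V) : Prop :=
  ∃ e : s.apex ≅ t.apex, e.hom ≫ t.l = s.l ∧ e.hom ≫ t.r = s.r

instance BSpan.setoid (U V : RFBiset H G) : Setoid (BSpan U V) where
  r := BSpan.Rel
  iseqv :=
    { refl := fun s => ⟨Iso.refl _, by simp, by simp⟩
      symm := by
        rintro s t ⟨e, h1, h2⟩
        exact ⟨e.symm, by simp [← h1], by simp [← h2]⟩
      trans := by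
        rintro s t u ⟨e, h1, h2⟩ ⟨e', h1', h2'⟩
        exact ⟨e ≪≫ e', by simp [h1, h1'], by simp [h2, h2']⟩ }

/-- Isomorphism classes of spans. -/
def SpanCls (U V : RFBiset H G) : Type 1 := Quotient (BSpan.setoid U V)

namespace SpanCls

/-- The class `[U ⇐ W ⇒ V]`. -/
def mk {U V W : RFBiset H G} (l : W ⟶ U) (r : W ⟶ V) : SpanCls U V :=
  Quotient.mk (BSpan.setoid U V) ⟨W, l, r⟩

@[elab_as_elim] lemma ind {U V : RFBiset H G} {P : SpanCls U V → Prop}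
    (h : ∀ (W : RFBiset H G) (l : W ⟶ U) (r : W ⟶ V), P (mk l r)) (s) : P s :=
  Quotient.ind (fun s => h s.apex s.l s.r) s

lemma mk_eq {U V W W' : RFBiset H G} {l : W ⟶ U} {r : W ⟶ V} {l' : W' ⟶ U} {r' : W' ⟶ V}
    (e : W ≅ W') (h1 : e.hom ≫ l' = l) (h2 : e.hom ≫ r' = r) : mk l r = mk l' r' :=
  Quotient.sound ⟨e, h1, h2⟩

/-- Vertical composition of spans, by pullback. -/
def comp {U V W : RFBiset H G} : SpanCls U V → SpanCls V W → SpanCls U W :=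
  Quotient.map₂ (fun s t => ⟨pb s.r t.l, pbFst s.r t.l ≫ s.l, pbSnd s.r t.l ≫ t.r⟩) (by
    rintro ⟨A, l, r⟩ ⟨A', l', r'⟩ ⟨e, h1, h2⟩ ⟨B, m, n⟩ ⟨B', m', n'⟩ ⟨d, h3, h4⟩
    dsimp only at e h1 h2 d h3 h4
    subst h1 h2 h3 h4
    refine ⟨isoOfBijective (homMk (fun y x q => ⟨(ap e.hom q.1.1, ap d.hom q.1.2), q.2⟩) ?_) ?_,
      ?_, ?_⟩
    · intro y y' x x' h k q
      exact Subtype.ext (Prod.ext (ap_act ..) (ap_act ..))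
    · intro y x
      constructor
      · intro p q h
        have h := congrArg Subtype.val h
        exact Subtype.ext (Prod.ext ((ap_bijective e y x).1 (congrArg Prod.fst h))
          ((ap_bijective d y x).1 (congrArg Prod.snd h)))
      · rintro ⟨⟨a, b⟩, h⟩
        obtain ⟨a, rfl⟩ := (ap_bijective e y x).2 a
        obtain ⟨b, rfl⟩ := (ap_bijective d y x).2 b
        exact ⟨⟨(a, b), h⟩, rfl⟩
    · rfl
    · rfl)

lemma mk_comp_mk {U V W A B P : RFBiset H G} {l : A ⟶ U} {r : A ⟶ V} {l' : B ⟶ V}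
    {r' : B ⟶ W} {a : P ⟶ A} {b : P ⟶ B} (h : IsPB a b r l') :
    comp (mk l r) (mk l' r') = mk (a ≫ l) (b ≫ r') := by
  symm
  refine mk_eq (isoOfBijective (homMk (fun y x q => ⟨(ap a q, ap b q), h.comm q⟩) ?_) ?_) rfl rfl
  · intro y y' x x' h k q
    exact Subtype.ext (Prod.ext (ap_act ..) (ap_act ..))
  · intro y x
    constructor
    · intro p q e
      have e := congrArg Subtype.val e
      exact h.inj _ _ (congrArg Prod.fst e) (congrArg Prod.snd e)
    · rintro ⟨⟨u, v⟩, e⟩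
      obtain ⟨p, rfl, rfl⟩ := h.lift u v e
      exact ⟨p, rfl⟩

lemma isPB_assoc {A B C V W : RFBiset H G} (r : A ⟶ V) (l : B ⟶ V) (r' : B ⟶ W) (l' : C ⟶ W) :
    IsPB (W := B) (homMk (S := pb (pbSnd r l ≫ r') l') (T := pb r l) (fun _ _ q => q.1.1)
      (fun _ _ _ => rfl))
      (homMk (S := pb (pbSnd r l ≫ r') l') (T := pb r' l') (fun _ _ q => ⟨(q.1.1.1.2, q.1.2), q.2⟩)
      (fun _ _ _ => rfl)) (pbSnd r l) (pbFst r' l') where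
  comm p := rfl
  lift := by
    rintro y x ⟨⟨u, v⟩, e⟩ ⟨⟨v', w⟩, e'⟩ (rfl : v = v')
    exact ⟨⟨(⟨(u, v), e⟩, w), e'⟩, rfl, rfl⟩
  inj := by
    rintro y x ⟨⟨p, w⟩, e⟩ ⟨⟨p', w'⟩, e'⟩ (rfl : p = p') e2
    obtain rfl : w = w' := congrArg (fun q => q.1.2) e2
    rfl

lemma comp_assoc {U V W X : RFBiset H G} (s : SpanCls U V) (t : SpanCls V W) (u : SpanCls W X) :
    comp (comp s t) u = comp s (comp t u) := by
  induction s using ind with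
  | h A l r =>
  induction t using ind with
  | h B l' r' =>
  induction u using ind with
  | h C l'' r'' =>
    rw [mk_comp_mk (isPB_pb r l'), mk_comp_mk (isPB_pb _ l''), mk_comp_mk (isPB_pb r' l'')]
    have h := isPB_assoc r l' r' l''
    rw [mk_comp_mk (a := homMk (S := pb (pbSnd r l' ≫ r') l'') (fun _ _ q => q.1.1.1.1)
      (fun _ _ _ => rfl)) (b := homMk (S := pb (pbSnd r l' ≫ r') l'') (T := pb r' l'')
        (fun _ _ q => ⟨(q.1.1.1.2, q.1.2), q.2⟩) (fun _ _ _ => rfl))]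
    · rfl
    · refine ⟨fun p => p.1.1.2, ?_, ?_⟩
      · rintro y x u ⟨⟨v', w⟩, e'⟩ (e : ap r u = ap l' v')
        exact ⟨⟨(⟨(u, v'), e⟩, w), e'⟩, rfl, rfl⟩
      · rintro y x ⟨⟨⟨⟨u, v⟩, d⟩, w⟩, e⟩ ⟨⟨⟨⟨u', v'⟩, d'⟩, w'⟩, e'⟩ (rfl : u = u') e2
        obtain rfl : w = w' := congrArg (fun q => q.1.2) e2
        obtain rfl : v = v' := congrArg (fun q => q.1.1) e2
        rfl

/-- The covariant embedding of equivariant maps in spans. -/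
def emb {U V : RFBiset H G} (φ : U ⟶ V) : SpanCls U V := mk (𝟙 U) φ

lemma mk_comp_emb {U V W A : RFBiset H G} (l : A ⟶ U) (r : A ⟶ V) (φ : V ⟶ W) :
    comp (mk l r) (emb φ) = mk l (r ≫ φ) := by
  have h := isPB_right r (Iso.refl V)
  simp only [Iso.refl_hom, Iso.refl_inv, Category.comp_id] at h
  rw [emb, mk_comp_mk h, Category.id_comp]

lemma emb_comp_mk {U V W A : RFBiset H G} (e : W ≅ U) (l : A ⟶ U) (r : A ⟶ V) :
    comp (emb e.hom) (mk l r) = mk (l ≫ e.inv) r := by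
  rw [emb, mk_comp_mk (isPB_left l e), Category.id_comp, Category.comp_id]

lemma emb_comp {U V W : RFBiset H G} (φ : U ⟶ V) (ψ : V ⟶ W) :
    emb (φ ≫ ψ) = comp (emb φ) (emb ψ) := (mk_comp_emb _ _ _).symm

lemma id_comp {U V : RFBiset H G} (s : SpanCls U V) : comp (emb (𝟙 U)) s = s := by
  induction s using ind with
  | h A l r => exact (emb_comp_mk (Iso.refl U) l r).trans (by simp)

lemma comp_id {U V : RFBiset H G} (s : SpanCls U V) : comp s (emb (𝟙 V)) = s := by
  induction s using ind with
  | h A l r => rw [mk_comp_emb, Category.comp_id]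

lemma tensMap_id (T : RFBiset H G) (S : RFBiset K H) : tensMap (𝟙 T) (𝟙 S) = 𝟙 (tens T S) :=
  tensHom_ext fun _ _ _ _ _ => rfl

lemma tensMap_comp {T T' T'' : RFBiset H G} {S S' S'' : RFBiset K H} (φ : T ⟶ T') (φ' : T' ⟶ T'')
    (ψ : S ⟶ S') (ψ' : S' ⟶ S'') :
    tensMap (φ ≫ φ') (ψ ≫ ψ') = tensMap φ ψ ≫ tensMap φ' ψ' :=
  tensHom_ext fun _ _ _ _ _ => rfl

/-- Whiskering of spans, on the right-hand factor. -/
def whL {V V' : RFBiset H G} (T : RFBiset K H) : SpanCls V V' → SpanCls (tens V T) (tens V' T) :=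
  Quotient.map (fun s => ⟨tens s.apex T, tensMap s.l (𝟙 T), tensMap s.r (𝟙 T)⟩) (by
    rintro ⟨A, l, r⟩ ⟨A', l', r'⟩ ⟨e, h1, h2⟩
    dsimp only at e h1 h2
    subst h1 h2
    exact ⟨⟨tensMap e.hom (𝟙 T), tensMap e.inv (𝟙 T),
      by rw [← tensMap_comp, e.hom_inv_id, Category.comp_id, tensMap_id],
      by rw [← tensMap_comp, e.inv_hom_id, Category.comp_id, tensMap_id]⟩,
      tensHom_ext (by simp), tensHom_ext (by simp)⟩)

/-- Whiskering of spans, on the left-hand factor. -/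
def whR {V V' : RFBiset K H} (T : RFBiset H G) : SpanCls V V' → SpanCls (tens T V) (tens T V') :=
  Quotient.map (fun s => ⟨tens T s.apex, tensMap (𝟙 T) s.l, tensMap (𝟙 T) s.r⟩) (by
    rintro ⟨A, l, r⟩ ⟨A', l', r'⟩ ⟨e, h1, h2⟩
    dsimp only at e h1 h2
    subst h1 h2
    exact ⟨⟨tensMap (𝟙 T) e.hom, tensMap (𝟙 T) e.inv,
      by rw [← tensMap_comp, e.hom_inv_id, Category.comp_id, tensMap_id],
      by rw [← tensMap_comp, e.inv_hom_id, Category.comp_id, tensMap_id]⟩,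
      tensHom_ext (by simp), tensHom_ext (by simp)⟩)

lemma whL_mk {V V' A : RFBiset H G} (T : RFBiset K H) (l : A ⟶ V) (r : A ⟶ V') :
    whL T (mk l r) = mk (tensMap l (𝟙 T)) (tensMap r (𝟙 T)) := rfl

lemma whR_mk {V V' A : RFBiset K H} (T : RFBiset H G) (l : A ⟶ V) (r : A ⟶ V') :
    whR T (mk l r) = mk (tensMap (𝟙 T) l) (tensMap (𝟙 T) r) := rfl

lemma isPB_id {U V : RFBiset H G} (f : U ⟶ V) : IsPB (𝟙 U) f f (𝟙 V) where
  comm _ := rfl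
  lift u _ e := ⟨u, rfl, e⟩
  inj _ _ e _ := e

lemma isPB_id' {U V : RFBiset H G} (f : U ⟶ V) : IsPB f (𝟙 U) (𝟙 V) f where
  comm _ := rfl
  lift _ v e := ⟨v, e.symm, rfl⟩
  inj _ _ _ e := e

lemma whL_emb {V V' : RFBiset H G} (T : RFBiset K H) (φ : V ⟶ V') :
    whL T (emb φ) = emb (tensMap φ (𝟙 T)) := by rw [emb, whL_mk, tensMap_id]; rfl

lemma whR_emb {V V' : RFBiset K H} (T : RFBiset H G) (φ : V ⟶ V') :
    whR T (emb φ) = emb (tensMap (𝟙 T) φ) := by rw [emb, whR_mk, tensMap_id]; rfl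

lemma whL_comp {V V' V'' : RFBiset H G} (T : RFBiset K H) (s : SpanCls V V')
    (t : SpanCls V' V'') : whL T (comp s t) = comp (whL T s) (whL T t) := by
  induction s using ind with
  | h A l r =>
  induction t using ind with
  | h B l' r' =>
    rw [mk_comp_mk (isPB_pb r l')]
    simp only [whL_mk]
    rw [mk_comp_mk ((isPB_pb r l').tens (isPB_id (𝟙 T)))]
    simp only [← tensMap_comp, Category.comp_id]

lemma whR_comp {V V' V'' : RFBiset K H} (T : RFBiset H G) (s : SpanCls V V')
    (t : SpanCls V' V'') : whR T (comp s t) = comp (whR T s) (whR T t) := by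
  induction s using ind with
  | h A l r =>
  induction t using ind with
  | h B l' r' =>
    rw [mk_comp_mk (isPB_pb r l')]
    simp only [whR_mk]
    rw [mk_comp_mk ((isPB_id (𝟙 T)).tens (isPB_pb r l'))]
    simp only [← tensMap_comp, Category.comp_id]

lemma wh_exchange {V V' : RFBiset H G} {T T' : RFBiset K H} (s : SpanCls V V')
    (t : SpanCls T T') : comp (whL T s) (whR V' t) = comp (whR V t) (whL T' s) := by
  induction s using ind with
  | h A l r =>
  induction t using ind with
  | h B l' r' =>
    simp only [whL_mk, whR_mk]
    rw [mk_comp_mk ((isPB_id r).tens (isPB_id' l')), mk_comp_mk ((isPB_id' l).tens (isPB_id r'))]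
    simp only [← tensMap_comp, Category.comp_id, Category.id_comp]

/-- Disjoint union of spans. -/
instance (U V : RFBiset H G) : Add (SpanCls U V) where
  add := Quotient.map₂ (fun s t => ⟨sumB s.apex t.apex, descB s.l t.l, descB s.r t.r⟩) (by
    rintro ⟨A, l, r⟩ ⟨A', l', r'⟩ ⟨e, h1, h2⟩ ⟨B, m, n⟩ ⟨B', m', n'⟩ ⟨d, h3, h4⟩
    dsimp only at e h1 h2 d h3 h4
    subst h1 h2 h3 h4
    refine ⟨isoOfBijective (descB (e.hom ≫ inlB A' B') (d.hom ≫ inrB A' B')) ?_, ?_, ?_⟩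
    · intro y x
      refine (?_ : Function.Bijective (Sum.map (fun s : A.E y x => ap e.hom s)
        (fun s : B.E y x => ap d.hom s)))
      exact Sum.map_bijective.2 ⟨ap_bijective e y x, ap_bijective d y x⟩
    · ext y x (s | s) <;> rfl
    · ext y x (s | s) <;> rfl)

lemma mk_add_mk {U V A B S : RFBiset H G} {i : A ⟶ S} {j : B ⟶ S} (h : IsSum i j)
    {l : S ⟶ U} {r : S ⟶ V} : mk (i ≫ l) (i ≫ r) + mk (j ≫ l) (j ≫ r) = mk l r := by
  refine mk_eq (isoOfBijective (descB i j) fun y x => ⟨?_, ?_⟩) ?_ ?_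
  · rintro (a | a) (b | b) e
    · exact congrArg Sum.inl (h.inj₁ _ _ e)
    · exact (h.disj _ _ e).elim
    · exact (h.disj _ _ e.symm).elim
    · exact congrArg Sum.inr (h.inj₂ _ _ e)
  · intro s
    rcases h.cover s with ⟨a, rfl⟩ | ⟨a, rfl⟩
    · exact ⟨Sum.inl a, rfl⟩
    · exact ⟨Sum.inr a, rfl⟩
  · ext y x (s | s) <;> rfl
  · ext y x (s | s) <;> rfl

lemma mk_add {U V A B : RFBiset H G} (l : A ⟶ U) (r : A ⟶ V) (l' : B ⟶ U) (r' : B ⟶ V) :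
    mk l r + mk l' r' = mk (descB l l') (descB r r') := rfl

/-- The empty span. -/
instance (U V : RFBiset H G) : Zero (SpanCls U V) := ⟨mk (emptyDesc U) (emptyDesc V)⟩

lemma mk_eq_zero {U V A : RFBiset H G} (h : ∀ y x, A.E y x → False) (l : A ⟶ U) (r : A ⟶ V) :
    mk l r = 0 := by
  symm
  refine mk_eq (isoOfBijective (emptyDesc A) fun y x => ⟨fun s => Empty.elim s, fun s =>
    (h y x s).elim⟩) ?_ ?_
  · ext y x s; exact Empty.elim s
  · ext y x s; exact Empty.elim s

instance addCommMonoid (U V : RFBiset H G) : AddCommMonoid (SpanCls U V) where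
  add_assoc a b c := by
    induction a using ind with
    | h A l r =>
    induction b using ind with
    | h B l' r' =>
    induction c using ind with
    | h C l'' r'' =>
      refine (mk_eq (isoOfBijective (homMk (fun y x => Equiv.sumAssoc (A.E y x) (B.E y x)
        (C.E y x)) ?_) fun y x => (Equiv.sumAssoc _ _ _).bijective) ?_ ?_)
      · rintro y y' x x' h k ((s | s) | s) <;> rfl
      · ext y x ((s | s) | s) <;> rfl
      · ext y x ((s | s) | s) <;> rfl
  zero_add a := by
    induction a using ind with
    | h A l r =>
      have h : IsSum (emptyDesc A) (𝟙 A) := ⟨fun s => Or.inr ⟨s, rfl⟩, fun a => Empty.elim a,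
        fun _ _ e => e, fun a => Empty.elim a⟩
      refine Eq.trans ?_ (mk_add_mk h)
      rw [mk_eq_zero (A := emptyB H G) (fun _ _ s => Empty.elim s) (emptyDesc A ≫ l)]; rfl
  add_zero a := by
    induction a using ind with
    | h A l r =>
      have h : IsSum (𝟙 A) (emptyDesc A) := ⟨fun s => Or.inl ⟨s, rfl⟩, fun _ _ e => e,
        fun a => Empty.elim a, fun _ b => Empty.elim b⟩
      refine Eq.trans ?_ (mk_add_mk h)
      rw [mk_eq_zero (A := emptyB H G) (fun _ _ s => Empty.elim s) (emptyDesc A ≫ l)]; rfl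
  add_comm a b := by
    induction a using ind with
    | h A l r =>
    induction b using ind with
    | h B l' r' => exact (mk_add_mk (isSum_sumB B A).symm (l := descB l' l) (r := descB r' r))
  nsmul := nsmulRec

/-- Pullback preserves disjoint unions in the first variable. -/
lemma isSum_pb_left {A B S C W : RFBiset H G} {i : A ⟶ S} {j : B ⟶ S} (h : IsSum i j)
    (f : S ⟶ W) (g : C ⟶ W) :
    IsSum (homMk (S := pb (i ≫ f) g) (T := pb f g) (fun _ _ q => ⟨(ap i q.1.1, q.1.2), q.2⟩)
        (fun _ _ _ => Subtype.ext (Prod.ext (ap_act ..) rfl)))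
      (homMk (S := pb (j ≫ f) g) (T := pb f g) (fun _ _ q => ⟨(ap j q.1.1, q.1.2), q.2⟩)
        (fun _ _ _ => Subtype.ext (Prod.ext (ap_act ..) rfl))) where
  cover := by
    rintro y x ⟨⟨s, c⟩, e⟩
    rcases h.cover s with ⟨a, rfl⟩ | ⟨a, rfl⟩
    · exact Or.inl ⟨⟨(a, c), e⟩, rfl⟩
    · exact Or.inr ⟨⟨(a, c), e⟩, rfl⟩
  inj₁ a b e := by
    have e := Prod.ext_iff.1 (congrArg Subtype.val e)
    exact Subtype.ext (Prod.ext (h.inj₁ _ _ e.1) e.2)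
  inj₂ a b e := by
    have e := Prod.ext_iff.1 (congrArg Subtype.val e)
    exact Subtype.ext (Prod.ext (h.inj₂ _ _ e.1) e.2)
  disj a b e := h.disj _ _ (congrArg (fun q => q.1.1) e)

/-- Reversal of spans. -/
def rev {U V : RFBiset H G} : SpanCls U V → SpanCls V U :=
  Quotient.map (fun s => ⟨s.apex, s.r, s.l⟩) (by
    rintro s t ⟨e, h1, h2⟩
    exact ⟨e, h2, h1⟩)

lemma rev_rev {U V : RFBiset H G} (s : SpanCls U V) : rev (rev s) = s := by
  induction s using ind with
  | h A l r => rfl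

lemma rev_add {U V : RFBiset H G} (s t : SpanCls U V) : rev (s + t) = rev s + rev t := by
  induction s using ind with
  | h A l r =>
  induction t using ind with
  | h B l' r' => rfl

lemma rev_comp {U V W : RFBiset H G} (s : SpanCls U V) (t : SpanCls V W) :
    rev (comp s t) = comp (rev t) (rev s) := by
  induction s using ind with
  | h A l r =>
  induction t using ind with
  | h B l' r' =>
    rw [mk_comp_mk (isPB_pb r l')]
    exact (mk_comp_mk ⟨fun p => ((isPB_pb r l').comm p).symm,
      fun u v e => ((isPB_pb r l').lift v u e.symm).imp fun _ h => h.symm,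
      fun p q e e' => (isPB_pb r l').inj p q e' e⟩).symm

lemma add_comp {U V W : RFBiset H G} (s s' : SpanCls U V) (t : SpanCls V W) :
    comp (s + s') t = comp s t + comp s' t := by
  induction s using ind with
  | h A l r =>
  induction s' using ind with
  | h B l' r' =>
  induction t using ind with
  | h C m n =>
    rw [mk_add, mk_comp_mk (isPB_pb _ m), ← mk_add_mk (isSum_pb_left (isSum_sumB A B) _ m)]
    exact congrArg₂ _ (mk_comp_mk (isPB_pb r m)).symm (mk_comp_mk (isPB_pb r' m)).symm

lemma zero_comp {U V W : RFBiset H G} (t : SpanCls V W) : comp (0 : SpanCls U V) t = 0 := by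
  induction t using ind with
  | h C m n =>
    exact (mk_comp_mk (isPB_pb (emptyDesc V) m)).trans
      (mk_eq_zero (A := pb (emptyDesc V) m) (fun y x q => Empty.elim (Subtype.val q).1) _ _)

lemma comp_add {U V W : RFBiset H G} (s : SpanCls U V) (t t' : SpanCls V W) :
    comp s (t + t') = comp s t + comp s t' := by
  rw [← rev_rev (comp s (t + t')), rev_comp, rev_add, add_comp, rev_add, rev_comp, rev_comp]
  simp only [rev_rev]

lemma comp_zero {U V W : RFBiset H G} (s : SpanCls U V) : comp s (0 : SpanCls V W) = 0 := by
  rw [← rev_rev (comp s 0), rev_comp]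
  exact congrArg rev (zero_comp (rev s))

lemma whL_add {V V' : RFBiset H G} (T : RFBiset K H) (s t : SpanCls V V') :
    whL T (s + t) = whL T s + whL T t := by
  induction s using ind with
  | h A l r =>
  induction t using ind with
  | h B l' r' =>
    rw [mk_add, whL_mk, ← mk_add_mk ((isSum_sumB A B).tensLeft T)]
    simp only [← tensMap_comp, Category.comp_id, inl_desc, inr_desc, whL_mk]

lemma whL_zero {V V' : RFBiset H G} (T : RFBiset K H) : whL T (0 : SpanCls V V') = 0 :=
  mk_eq_zero (fun y x q => by
    induction q using tens_ind with
    | h y s t => exact Empty.elim s) _ _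

lemma whR_add {V V' : RFBiset K H} (T : RFBiset H G) (s t : SpanCls V V') :
    whR T (s + t) = whR T s + whR T t := by
  induction s using ind with
  | h A l r =>
  induction t using ind with
  | h B l' r' =>
    rw [mk_add, whR_mk, ← mk_add_mk ((isSum_sumB A B).tensRight T)]
    simp only [← tensMap_comp, Category.comp_id, inl_desc, inr_desc, whR_mk]

lemma whR_zero {V V' : RFBiset K H} (T : RFBiset H G) : whR T (0 : SpanCls V V') = 0 :=
  mk_eq_zero (fun y x q => by
    induction q using tens_ind with
    | h y s t => exact Empty.elim t) _ _

end SpanCls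

end RFBiset

/-- The objects of the bicategory of right-free bisets and spans: finite groupoids. -/
structure BisetHat : Type 1 where
  gpd : FinGpd

/-- 1-cells of the bicategory of spans: right-free finite bisets. -/
def BisetHat.Cell (H G : BisetHat) : Type 1 := RFBiset H.gpd G.gpd

/-- 2-cells of the bicategory of spans: isomorphism classes of spans of equivariant maps. -/
instance (H G : BisetHat) : Category.{1} (BisetHat.Cell H G) where
  Hom U V := SpanCls (H := H.gpd) (G := G.gpd) U V
  id U := SpanCls.emb (𝟙 (show RFBiset H.gpd G.gpd from U))
  comp s t := SpanCls.comp s t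
  id_comp := SpanCls.id_comp
  comp_id := SpanCls.comp_id
  assoc := SpanCls.comp_assoc

/-- Isomorphisms of bisets, as invertible 2-cells. -/
def BisetHat.embIso {H G : BisetHat} {U V : RFBiset H.gpd G.gpd} (e : U ≅ V) :
    (show BisetHat.Cell H G from U) ≅ (show BisetHat.Cell H G from V) where
  hom := SpanCls.emb e.hom
  inv := SpanCls.emb e.inv
  hom_inv_id := (SpanCls.emb_comp _ _).symm.trans (congrArg SpanCls.emb e.hom_inv_id)
  inv_hom_id := (SpanCls.emb_comp _ _).symm.trans (congrArg SpanCls.emb e.inv_hom_id)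

lemma SpanCls.conj {H G : FinGpd} {U V U' V' A B : RFBiset H G} (l : A ⟶ U) (r : A ⟶ V)
    (l' : B ⟶ U') (r' : B ⟶ V') (e : U ≅ U') (d : V ≅ V') (c : A ≅ B)
    (h1 : c.hom ≫ l' = l ≫ e.hom) (h2 : c.hom ≫ r' = r ≫ d.hom) :
    SpanCls.mk l r =
      SpanCls.comp (SpanCls.emb e.hom) (SpanCls.comp (SpanCls.mk l' r') (SpanCls.emb d.inv)) := by
  rw [SpanCls.mk_comp_emb, SpanCls.emb_comp_mk]
  refine SpanCls.mk_eq c ?_ ?_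
  · rw [← Category.assoc, h1, Category.assoc, e.hom_inv_id, Category.comp_id]
  · rw [← Category.assoc, h2, Category.assoc, d.hom_inv_id, Category.comp_id]

/-- The bicategory of finite groupoids, right-free finite bisets and isomorphism classes of spans
of equivariant maps. -/
instance : Bicategory.{1, 1} BisetHat where
  Hom H G := BisetHat.Cell H G
  id G := idB G.gpd
  comp S T := tens T S
  homCategory H G := inferInstanceAs (Category.{1} (BisetHat.Cell H G))
  whiskerLeft S _ _ s := SpanCls.whL S s
  whiskerRight s T := SpanCls.whR T s
  associator S T U := BisetHat.embIso (assocB U T S)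
  leftUnitor T := BisetHat.embIso (unitR T)
  rightUnitor T := BisetHat.embIso (unitL T)
  whiskerLeft_id _ _ := (SpanCls.whL_emb _ _).trans (congrArg _ (SpanCls.tensMap_id _ _))
  whiskerLeft_comp _ _ _ _ _ _ := SpanCls.whL_comp _ _ _
  id_whiskerLeft s := by
    induction s using SpanCls.ind with
    | h A l r =>
      exact SpanCls.conj _ _ _ _ _ _ (unitR A) (unitR_nat l) (unitR_nat r)
  comp_whiskerLeft S T _ _ s := by
    induction s using SpanCls.ind with
    | h A l r =>
      refine SpanCls.conj _ _ _ _ _ _ (assocB A T S) ?_ ?_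
      all_goals
        refine tensHom_ext fun _ _ _ t p => ?_
        induction p using tens_ind with
        | h w u t => rfl
  id_whiskerRight _ _ := (SpanCls.whR_emb _ _).trans (congrArg _ (SpanCls.tensMap_id _ _))
  comp_whiskerRight _ _ _ := SpanCls.whR_comp _ _ _
  whiskerRight_id s := by
    induction s using SpanCls.ind with
    | h A l r =>
      exact SpanCls.conj _ _ _ _ _ _ (unitL A) (unitL_nat l) (unitL_nat r)
  whiskerRight_comp s T U := by
    induction s using SpanCls.ind with
    | h A l r =>
      refine SpanCls.conj _ _ _ _ (assocB U T _).symm (assocB U T _).symm (assocB U T A).symm ?_ ?_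
      all_goals
        refine tensHom_ext fun _ _ _ p t => ?_
        induction p using tens_ind with
        | h w u t => rfl
  whisker_assoc S _ _ s U := by
    induction s using SpanCls.ind with
    | h A l r =>
      refine SpanCls.conj _ _ _ _ _ _ (assocB U A S) ?_ ?_
      all_goals
        refine tensHom_ext fun _ _ _ t p => ?_
        induction p using tens_ind with
        | h w u t => rfl
  whisker_exchange s t := (SpanCls.wh_exchange t s)
  pentagon {a b c d e} f g h i := by
    have := congrArg SpanCls.emb (pentagon (B := BisetRF) (a := ⟨a.gpd⟩) (b := ⟨b.gpd⟩)
      (c := ⟨c.gpd⟩) (d := ⟨d.gpd⟩) (e := ⟨e.gpd⟩) f g h i)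
    refine Eq.trans ?_ (this.trans (SpanCls.emb_comp _ _))
    refine Eq.trans ?_ (SpanCls.emb_comp _ _).symm
    refine congrArg₂ SpanCls.comp (SpanCls.whR_emb _ _) ?_
    refine Eq.trans ?_ (SpanCls.emb_comp _ _).symm
    exact congrArg₂ SpanCls.comp rfl (SpanCls.whL_emb _ _)
  triangle {a b c} f g := by
    have := congrArg SpanCls.emb (triangle (B := BisetRF) (a := ⟨a.gpd⟩) (b := ⟨b.gpd⟩)
      (c := ⟨c.gpd⟩) f g)
    refine Eq.trans ?_ (this.trans (SpanCls.whR_emb _ _).symm)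
    refine Eq.trans ?_ (SpanCls.emb_comp _ _).symm
    exact congrArg₂ SpanCls.comp rfl (SpanCls.whL_emb _ _)

/-! ### `k`-linear bicategories and `k`-linearization -/

/-- A bicategory whose 2-cells with given source and target form commutative monoids, such that
vertical composition and whiskering are additive. -/
class LocallyAdditive (B : Type*) [Bicategory B] where
  addCommMonoid : ∀ {a b : B} (f g : a ⟶ b), AddCommMonoid (f ⟶ g)
  add_comp : ∀ {a b : B} {f g h : a ⟶ b} (s s' : f ⟶ g) (t : g ⟶ h),
    (s + s') ≫ t = s ≫ t + s' ≫ t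
  zero_comp : ∀ {a b : B} {f g h : a ⟶ b} (t : g ⟶ h), (0 : f ⟶ g) ≫ t = 0
  comp_add : ∀ {a b : B} {f g h : a ⟶ b} (s : f ⟶ g) (t t' : g ⟶ h),
    s ≫ (t + t') = s ≫ t + s ≫ t'
  comp_zero : ∀ {a b : B} {f g h : a ⟶ b} (s : f ⟶ g), s ≫ (0 : g ⟶ h) = 0
  whiskerLeft_add : ∀ {a b c : B} (f : a ⟶ b) {g h : b ⟶ c} (s t : g ⟶ h),
    f ◁ (s + t) = f ◁ s + f ◁ t
  whiskerLeft_zero : ∀ {a b c : B} (f : a ⟶ b) (g h : b ⟶ c), f ◁ (0 : g ⟶ h) = 0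
  add_whiskerRight : ∀ {a b c : B} {f g : a ⟶ b} (s t : f ⟶ g) (h : b ⟶ c),
    (s + t) ▷ h = s ▷ h + t ▷ h
  zero_whiskerRight : ∀ {a b c : B} (f g : a ⟶ b) (h : b ⟶ c), (0 : f ⟶ g) ▷ h = 0

attribute [reducible, instance] LocallyAdditive.addCommMonoid

instance : LocallyAdditive BisetHat where
  addCommMonoid {a b} f g := SpanCls.addCommMonoid (H := a.gpd) (G := b.gpd) f g
  add_comp := SpanCls.add_comp
  zero_comp := SpanCls.zero_comp
  comp_add := SpanCls.comp_add
  comp_zero := SpanCls.comp_zero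
  whiskerLeft_add f _ _ s t := SpanCls.whL_add f s t
  whiskerLeft_zero f _ _ := SpanCls.whL_zero f
  add_whiskerRight s t h := SpanCls.whR_add h s t
  zero_whiskerRight _ _ h := SpanCls.whR_zero h

open TensorProduct in
/-- Group-complete a commutative monoid and extend scalars from `ℤ` to `k`. -/
abbrev kExt (k : Type*) [CommRing k] (M : Type*) [AddCommMonoid M] :=
  k ⊗[ℤ] Algebra.GrothendieckAddGroup M

namespace kExt

open TensorProduct

variable {k : Type*} [CommRing k] {M N A : Type*} [AddCommMonoid M] [AddCommMonoid N]
  [AddCommGroup A] [Module k A]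

/-- The canonical map `M → k ⊗ M^gp`. -/
noncomputable def of : M →+ kExt k M :=
  ((TensorProduct.mk ℤ k (Algebra.GrothendieckAddGroup M) 1).toAddMonoidHom).comp
    Algebra.GrothendieckAddGroup.of

/-- The unique `k`-linear extension of an additive map. -/
noncomputable def lift (f : M →+ A) : kExt k M →ₗ[k] A :=
  LinearMap.liftBaseChange k (Algebra.GrothendieckAddGroup.lift f).toIntLinearMap

@[simp] lemma lift_of (f : M →+ A) (m : M) : lift (k := k) f (of m) = f m := by
  have := DFunLike.congr_fun (Algebra.GrothendieckAddGroup.lift.symm_apply_apply f) m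
  refine Eq.trans ?_ this
  change LinearMap.liftBaseChange k _ (1 ⊗ₜ[ℤ] _) = _
  rw [LinearMap.liftBaseChange_tmul, one_smul]
  rfl

lemma hom_ext {f g : kExt k M →ₗ[k] A} (h : ∀ m : M, f (of m) = g (of m)) : f = g := by
  refine TensorProduct.AlgebraTensorModule.ext fun c x => ?_
  have e : (f.toAddMonoidHom.comp
      (TensorProduct.mk ℤ k (Algebra.GrothendieckAddGroup M) 1).toAddMonoidHom) =
      (g.toAddMonoidHom.comp
      (TensorProduct.mk ℤ k (Algebra.GrothendieckAddGroup M) 1).toAddMonoidHom) := by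
    apply Algebra.GrothendieckAddGroup.lift.symm.injective
    exact AddMonoidHom.ext h
  have e' : f (1 ⊗ₜ x) = g (1 ⊗ₜ x) := DFunLike.congr_fun e x
  have hc : c ⊗ₜ[ℤ] x = c • ((1 : k) ⊗ₜ[ℤ] x) := by simp [TensorProduct.smul_tmul']
  rw [hc, map_smul, map_smul, e']

/-- The `k`-linear map induced by an additive map. -/
noncomputable def map (f : M →+ N) : kExt k M →ₗ[k] kExt k N := lift (of.comp f)

@[simp] lemma map_of (f : M →+ N) (m : M) : map (k := k) f (of m) = of (f m) := lift_of _ _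

/-- The `k`-bilinear map induced by a biadditive map. -/
noncomputable def map₂ {P : Type*} [AddCommMonoid P] (f : M →+ N →+ P) :
    kExt k M →ₗ[k] kExt k N →ₗ[k] kExt k P :=
  lift
    { toFun := fun m => map (f m)
      map_zero' := hom_ext fun n => by simp
      map_add' := fun m m' => hom_ext fun n => by simp }

@[simp] lemma map₂_of {P : Type*} [AddCommMonoid P] (f : M →+ N →+ P) (m : M) (n : N) :
    map₂ (k := k) f (of m) (of n) = of (f m n) := by
  simp [map₂]

@[elab_as_elim] lemma ind {p : kExt k M → Prop} (zero : p 0) (of : ∀ m, p (of m))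
    (add : ∀ x y, p x → p y → p (x + y)) (smul : ∀ (c : k) x, p x → p (c • x)) (x) : p x := by
  let S : Submodule k (kExt k M) :=
    Submodule.span k (Set.range (kExt.of : M → kExt k M))
  have hS : S.mkQ = 0 := hom_ext fun m => by
    simpa using (Submodule.subset_span (Set.mem_range_self m) : kExt.of m ∈ S)
  have hx : x ∈ S := by
    rw [← Submodule.ker_mkQ S, hS]; trivial
  induction hx using Submodule.span_induction with
  | mem x h => obtain ⟨m, rfl⟩ := h; exact of m
  | zero => exact zero
  | add x y _ _ hx hy => exact add x y hx hy
  | smul c x _ hx => exact smul c x hx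

end kExt

/-- Objects of the `k`-linearization of a bicategory: those of the bicategory. -/
structure KLin (k : Type*) (B : Type*) where
  as : B

namespace KLin

universe w v u₁

variable {k : Type u} [CommRing k] {B : Type u₁} [Bicategory.{w, v} B] [LocallyAdditive B]

/-- The 1-cells of the `k`-linearization: those of the bicategory. -/
structure Cell (X Y : KLin k B) : Type v where
  as : X.as ⟶ Y.as

/-- Vertical composition of 2-cells as a biadditive map. -/
def compHom {a b : B} (f g h : a ⟶ b) : (f ⟶ g) →+ (g ⟶ h) →+ (f ⟶ h) where
  toFun s :=
    { toFun := fun t => s ≫ t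
      map_zero' := LocallyAdditive.comp_zero s
      map_add' := LocallyAdditive.comp_add s }
  map_zero' := AddMonoidHom.ext LocallyAdditive.zero_comp
  map_add' s s' := AddMonoidHom.ext (LocallyAdditive.add_comp s s')

def whiskerLeftHom {a b c : B} (f : a ⟶ b) (g h : b ⟶ c) : (g ⟶ h) →+ (f ≫ g ⟶ f ≫ h) where
  toFun s := f ◁ s
  map_zero' := LocallyAdditive.whiskerLeft_zero f g h
  map_add' := LocallyAdditive.whiskerLeft_add f

def whiskerRightHom {a b c : B} (f g : a ⟶ b) (h : b ⟶ c) : (f ⟶ g) →+ (f ≫ h ⟶ g ≫ h) where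
  toFun s := s ▷ h
  map_zero' := LocallyAdditive.zero_whiskerRight f g h
  map_add' s t := LocallyAdditive.add_whiskerRight s t h

noncomputable instance (X Y : KLin k B) : Category (Cell X Y) where
  Hom f g := kExt k (f.as ⟶ g.as)
  id f := kExt.of (𝟙 f.as)
  comp s t := kExt.map₂ (compHom _ _ _) s t
  id_comp s := by
    induction s using kExt.ind with
    | zero => simp
    | of s => simp [compHom]
    | add s t hs ht => rw [map_add, hs, ht]
    | smul c s hs => rw [map_smul, hs]
  comp_id s := by
    induction s using kExt.ind with
    | zero => simp
    | of s => simp [compHom]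
    | add s t hs ht => rw [map_add, LinearMap.add_apply, hs, ht]
    | smul c s hs => rw [map_smul, LinearMap.smul_apply, hs]
  assoc s t u := by
    induction s using kExt.ind with
    | zero => simp
    | add s s' hs hs' => simp only [map_add, LinearMap.add_apply, hs, hs']
    | smul c s hs => simp only [map_smul, LinearMap.smul_apply, hs]
    | of s =>
    induction t using kExt.ind with
    | zero => simp
    | add s s' hs hs' => simp only [map_add, LinearMap.add_apply, hs, hs']
    | smul c s hs => simp only [map_smul, LinearMap.smul_apply, hs]
    | of t =>
    induction u using kExt.ind with
    | zero => simp
    | add s s' hs hs' => simp only [map_add, hs, hs']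
    | smul c s hs => simp only [map_smul, hs]
    | of u => simp [compHom]

noncomputable instance (X Y : KLin k B) : Preadditive (Cell X Y) where
  homGroup f g := inferInstanceAs (AddCommGroup (kExt k (f.as ⟶ g.as)))
  add_comp f g h s s' t := LinearMap.map_add₂ (kExt.map₂ (compHom f.as g.as h.as)) s s' t
  comp_add f g h s t t' := (kExt.map₂ (compHom f.as g.as h.as) s).map_add t t'

noncomputable instance (X Y : KLin k B) : Linear k (Cell X Y) where
  homModule f g := inferInstanceAs (Module k (kExt k (f.as ⟶ g.as)))
  smul_comp f g h c s t := LinearMap.map_smul₂ (kExt.map₂ (compHom f.as g.as h.as)) c s t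
  comp_smul f g h s c t := (kExt.map₂ (compHom f.as g.as h.as) s).map_smul c t

/-- A 2-cell of the bicategory, as a 2-cell of its `k`-linearization. -/
noncomputable def of {X Y : KLin k B} {f g : Cell X Y} (s : f.as ⟶ g.as) : f ⟶ g := kExt.of s

lemma of_comp {X Y : KLin k B} {f g h : Cell X Y} (s : f.as ⟶ g.as) (t : g.as ⟶ h.as) :
    of (s ≫ t) = of (f := f) s ≫ of (f := g) (g := h) t := (kExt.map₂_of (compHom f.as g.as h.as) s t).symm

lemma of_id {X Y : KLin k B} (f : Cell X Y) : of (𝟙 f.as) = 𝟙 f := rfl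

/-- Induction on 2-cells: they are `k`-linear combinations of 2-cells of the bicategory. -/
@[elab_as_elim] lemma ind {X Y : KLin k B} {f g : Cell X Y} {p : (f ⟶ g) → Prop} (zero : p 0)
    (add : ∀ x y, p x → p y → p (x + y)) (smul : ∀ (c : k) x, p x → p (c • x))
    (of : ∀ s : f.as ⟶ g.as, p (of s)) (x) : p x := kExt.ind zero of add smul x

/-- Invertible 2-cells of the bicategory are invertible in the `k`-linearization. -/
noncomputable def isoOf {X Y : KLin k B} {f g : Cell X Y} (e : f.as ≅ g.as) : f ≅ g where
  hom := of e.hom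
  inv := of e.inv
  hom_inv_id := by rw [← of_comp, e.hom_inv_id, of_id]
  inv_hom_id := by rw [← of_comp, e.inv_hom_id, of_id]

/-- Left whiskering, extended `k`-linearly. -/
noncomputable def wL {X Y Z : KLin k B} (f : Cell X Y) {g h : Cell Y Z} :
    (g ⟶ h) →ₗ[k] ((⟨f.as ≫ g.as⟩ : Cell X Z) ⟶ ⟨f.as ≫ h.as⟩) :=
  kExt.map (whiskerLeftHom f.as g.as h.as)

/-- Right whiskering, extended `k`-linearly. -/
noncomputable def wR {X Y Z : KLin k B} {f g : Cell X Y} (h : Cell Y Z) :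
    (f ⟶ g) →ₗ[k] ((⟨f.as ≫ h.as⟩ : Cell X Z) ⟶ ⟨g.as ≫ h.as⟩) :=
  kExt.map (whiskerRightHom f.as g.as h.as)

lemma wL_of {X Y Z : KLin k B} (f : Cell X Y) {g h : Cell Y Z} (s : g.as ⟶ h.as) :
    wL f (of s) = of (f.as ◁ s) := kExt.map_of _ _

lemma wR_of {X Y Z : KLin k B} {f g : Cell X Y} (h : Cell Y Z) (s : f.as ⟶ g.as) :
    wR h (of s) = of (s ▷ h.as) := kExt.map_of _ _

lemma of_comp₃ {X Y : KLin k B} {f g h i : Cell X Y} (s : f.as ⟶ g.as) (t : g.as ⟶ h.as)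
    (u : h.as ⟶ i.as) : of (s ≫ t ≫ u) = of (f := f) (g := g) s ≫ of (g := h) t ≫ of (g := i) u := by
  rw [← of_comp, ← of_comp]

/-- The `k`-linearization of a locally additive bicategory: the monoids of 2-cells are
group-completed and tensored with `k`; compositions are extended bilinearly. -/
noncomputable instance : Bicategory.{max u w, v} (KLin k B) where
  Hom X Y := Cell X Y
  id X := ⟨𝟙 X.as⟩
  comp f g := ⟨f.as ≫ g.as⟩
  homCategory X Y := inferInstanceAs (Category (Cell X Y))
  whiskerLeft f _ _ s := wL f s
  whiskerRight s h := wR h s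
  associator f g h := isoOf (α_ f.as g.as h.as)
  leftUnitor f := isoOf (λ_ f.as)
  rightUnitor f := isoOf (ρ_ f.as)
  whiskerLeft_id f g := (wL_of f (𝟙 g.as)).trans (by rw [Bicategory.whiskerLeft_id]; rfl)
  whiskerLeft_comp f _ _ _ s t := by
    induction s using ind with
    | zero => simp
    | add s s' hs hs' => simp only [map_add, Preadditive.add_comp, hs, hs']
    | smul c s hs => simp only [map_smul, Linear.smul_comp, hs]
    | of s =>
    induction t using ind with
    | zero => simp
    | add s s' hs hs' => simp only [map_add, Preadditive.comp_add, hs, hs']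
    | smul c s hs => simp only [map_smul, Linear.comp_smul, hs]
    | of t => simp only [wL_of, ← of_comp, Bicategory.whiskerLeft_comp]
  id_whiskerLeft s := by
    induction s using ind with
    | zero => simp
    | add s s' hs hs' => simp only [map_add, Preadditive.comp_add, Preadditive.add_comp, hs, hs']
    | smul c s hs => simp only [map_smul, Linear.comp_smul, Linear.smul_comp, hs]
    | of s => exact (wL_of _ s).trans (by simp only [isoOf, ← of_comp, Bicategory.id_whiskerLeft])
  comp_whiskerLeft f g _ _ s := by
    induction s using ind with
    | zero => simp
    | add s s' hs hs' => simp only [map_add, Preadditive.comp_add, Preadditive.add_comp, hs, hs']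
    | smul c s hs => simp only [map_smul, Linear.comp_smul, Linear.smul_comp, hs]
    | of s =>
      refine (wL_of ⟨f.as ≫ g.as⟩ s).trans ?_
      rw [Bicategory.comp_whiskerLeft]
      refine (of_comp₃ (g := ⟨_⟩) (h := ⟨_⟩) _ _ _).trans ?_
      exact congrArg (fun x => of _ ≫ x ≫ of _)
        ((congrArg (wL f) (wL_of g s)).trans (wL_of f (g := ⟨_⟩) (h := ⟨_⟩) (g.as ◁ s))).symm
  id_whiskerRight f g := (wR_of g (𝟙 f.as)).trans (by rw [Bicategory.id_whiskerRight]; rfl)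
  comp_whiskerRight s t h := by
    induction s using ind with
    | zero => simp
    | add s s' hs hs' => simp only [map_add, Preadditive.add_comp, hs, hs']
    | smul c s hs => simp only [map_smul, Linear.smul_comp, hs]
    | of s =>
    induction t using ind with
    | zero => simp
    | add s s' hs hs' => simp only [map_add, Preadditive.comp_add, hs, hs']
    | smul c s hs => simp only [map_smul, Linear.comp_smul, hs]
    | of t => simp only [wR_of, ← of_comp, Bicategory.comp_whiskerRight]
  whiskerRight_id s := by
    induction s using ind with
    | zero => simp
    | add s s' hs hs' => simp only [map_add, Preadditive.comp_add, Preadditive.add_comp, hs, hs']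
    | smul c s hs => simp only [map_smul, Linear.comp_smul, Linear.smul_comp, hs]
    | of s => exact (wR_of _ s).trans (by simp only [isoOf, ← of_comp, Bicategory.whiskerRight_id])
  whiskerRight_comp s g h := by
    induction s using ind with
    | zero => simp
    | add s s' hs hs' => simp only [map_add, Preadditive.comp_add, Preadditive.add_comp, hs, hs']
    | smul c s hs => simp only [map_smul, Linear.comp_smul, Linear.smul_comp, hs]
    | of s =>
      refine (wR_of ⟨g.as ≫ h.as⟩ s).trans ?_
      rw [Bicategory.whiskerRight_comp]
      refine (of_comp₃ (g := ⟨_⟩) (h := ⟨_⟩) _ _ _).trans ?_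
      exact congrArg (fun x => of _ ≫ x ≫ of _)
        ((congrArg (wR h) (wR_of g s)).trans (wR_of h (f := ⟨_⟩) (g := ⟨_⟩) (s ▷ g.as))).symm
  whisker_assoc f _ _ s h := by
    induction s using ind with
    | zero => simp
    | add s s' hs hs' => simp only [map_add, Preadditive.comp_add, Preadditive.add_comp, hs, hs']
    | smul c s hs => simp only [map_smul, Linear.comp_smul, Linear.smul_comp, hs]
    | of s =>
      refine ((congrArg (wR h) (wL_of f s)).trans
        (wR_of h (f := ⟨_⟩) (g := ⟨_⟩) (f.as ◁ s))).trans ?_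
      rw [Bicategory.whisker_assoc]
      refine (of_comp₃ (g := ⟨_⟩) (h := ⟨_⟩) _ _ _).trans ?_
      exact congrArg (fun x => of _ ≫ x ≫ of _)
        ((congrArg (wL f) (wR_of h s)).trans (wL_of f (g := ⟨_⟩) (h := ⟨_⟩) (s ▷ h.as))).symm
  whisker_exchange {_ _ _ f g h i} s t := by
    induction s using ind with
    | zero => simp
    | add s s' hs hs' => simp only [map_add, Preadditive.add_comp, Preadditive.comp_add, hs, hs']
    | smul c s hs => simp only [map_smul, Linear.smul_comp, Linear.comp_smul, hs]
    | of s =>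
    induction t using ind with
    | zero => simp
    | add s s' hs hs' => simp only [map_add, Preadditive.comp_add, Preadditive.add_comp, hs, hs']
    | smul c s hs => simp only [map_smul, Linear.comp_smul, Linear.smul_comp, hs]
    | of t => simp only [wR_of, wL_of, ← of_comp, Bicategory.whisker_exchange]
  pentagon f g h i := by
    refine Eq.trans ?_ (of_comp (g := ⟨_⟩) _ _)
    rw [← Bicategory.pentagon]
    refine Eq.trans ?_ (of_comp₃ (g := ⟨_⟩) (h := ⟨_⟩) _ _ _).symm
    exact congrArg₂ (fun x y => x ≫ of _ ≫ y) (wR_of i (f := ⟨_⟩) (g := ⟨_⟩) _)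
      (wL_of f (g := ⟨_⟩) (h := ⟨_⟩) _)
  triangle f g := by
    refine Eq.trans ?_ (wR_of g (f := ⟨_⟩) (g := ⟨_⟩) _).symm
    rw [← Bicategory.triangle]
    refine Eq.trans ?_ (of_comp (g := ⟨_⟩) _ _).symm
    exact congrArg (fun x => of _ ≫ x) (wL_of f (g := ⟨_⟩) (h := ⟨_⟩) _)

end KLin

/-! ### Bimodules -/

open TensorProduct in
/-- A `G,H`-bimodule over `k`: a functor from `Hᵒᵖ × G` to `k`-modules. -/
abbrev Bimod (k : Type u) [CommRing k] (H G : FinGpd) := Hᵒᵖ × G ⥤ ModuleCat.{u} k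

namespace Bimod

open TensorProduct

variable {k : Type u} [CommRing k] {H G K L : FinGpd}

/-- The module `M(y,x)`. -/
def E (M : Bimod k H G) (y : H) (x : G) : Type u := M.obj (op y, x)

noncomputable instance (M : Bimod k H G) (y : H) (x : G) : AddCommGroup (M.E y x) :=
  inferInstanceAs (AddCommGroup (M.obj (op y, x)))

noncomputable instance (M : Bimod k H G) (y : H) (x : G) : Module k (M.E y x) :=
  inferInstanceAs (Module k (M.obj (op y, x)))

/-- The two-sided action `m ↦ g · m · h`. -/
def act (M : Bimod k H G) {y y' : H} {x x' : G} (h : y' ⟶ y) (g : x ⟶ x') :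
    M.E y x →ₗ[k] M.E y' x' :=
  (M.map (X := (op y, x)) (Y := (op y', x')) (h.op, g)).hom

@[simp] lemma act_id (M : Bimod k H G) {y : H} {x : G} (s : M.E y x) :
    M.act (𝟙 y) (𝟙 x) s = s :=
  ConcreteCategory.congr_hom (M.map_id (op y, x)) s

@[simp] lemma act_act (M : Bimod k H G) {y y' y'' : H} {x x' x'' : G} (h : y' ⟶ y) (g : x ⟶ x')
    (h' : y'' ⟶ y') (g' : x' ⟶ x'') (s : M.E y x) :
    M.act h' g' (M.act h g s) = M.act (h' ≫ h) (g ≫ g') s :=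
  (ConcreteCategory.congr_hom (M.map_comp (X := (op y, x)) (Y := (op y', x'))
    (Z := (op y'', x'')) (h.op, g) (h'.op, g')) s).symm

/-- Build a bimodule from modules with a two-sided action. -/
def ofAct (E : H → G → Type u) [∀ y x, AddCommGroup (E y x)] [∀ y x, Module k (E y x)]
    (act : ∀ {y y' : H} {x x' : G}, (y' ⟶ y) → (x ⟶ x') → E y x →ₗ[k] E y' x')
    (act_id : ∀ {y : H} {x : G}, act (𝟙 y) (𝟙 x) = LinearMap.id)
    (act_act : ∀ {y y' y'' : H} {x x' x'' : G} (h : y' ⟶ y) (g : x ⟶ x') (h' : y'' ⟶ y')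
      (g' : x' ⟶ x''), act h' g' ∘ₗ act h g = act (h' ≫ h) (g ≫ g')) : Bimod k H G where
  obj p := ModuleCat.of k (E p.1.unop p.2)
  map f := ModuleCat.ofHom (act f.1.unop f.2)
  map_id _ := ModuleCat.hom_ext act_id
  map_comp f g := ModuleCat.hom_ext (act_act f.1.unop f.2 g.1.unop g.2).symm

/-- The component of an equivariant map. -/
def ap {M N : Bimod k H G} (φ : M ⟶ N) (y : H) (x : G) : M.E y x →ₗ[k] N.E y x :=
  (φ.app (op y, x)).hom

@[simp] lemma ap_id (M : Bimod k H G) {y : H} {x : G} : ap (𝟙 M) y x = LinearMap.id := rfl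

@[simp] lemma ap_comp {M N P : Bimod k H G} (φ : M ⟶ N) (ψ : N ⟶ P) {y : H} {x : G}
    (m : M.E y x) : ap (φ ≫ ψ) y x m = ap ψ y x (ap φ y x m) := rfl

@[simp] lemma ap_act {M N : Bimod k H G} (φ : M ⟶ N) {y y' : H} {x x' : G} (h : y' ⟶ y)
    (g : x ⟶ x') (m : M.E y x) : ap φ y' x' (M.act h g m) = N.act h g (ap φ y x m) :=
  ConcreteCategory.congr_hom (φ.naturality
    (X := (op y, x)) (Y := (op y', x')) (h.op, g)) m

lemma hom_ext {M N : Bimod k H G} {φ ψ : M ⟶ N}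
    (e : ∀ (y : H) (x : G), ap φ y x = ap ψ y x) : φ = ψ :=
  NatTrans.ext (funext fun p => ModuleCat.hom_ext (e p.1.unop p.2))

/-- Build an equivariant map from its components. -/
noncomputable def homMk {M N : Bimod k H G} (f : ∀ (y : H) (x : G), M.E y x →ₗ[k] N.E y x)
    (nat : ∀ {y y' : H} {x x' : G} (h : y' ⟶ y) (g : x ⟶ x'),
      f y' x' ∘ₗ M.act h g = N.act h g ∘ₗ f y x) : M ⟶ N where
  app p := ModuleCat.ofHom (f p.1.unop p.2)
  naturality _ _ u := ModuleCat.hom_ext (nat u.1.unop u.2)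

@[simp] lemma ap_homMk {M N : Bimod k H G} (f : ∀ (y : H) (x : G), M.E y x →ₗ[k] N.E y x)
    (nat) {y : H} {x : G} : ap (homMk (M := M) (N := N) f nat) y x = f y x := rfl

/-! ### Tensor product of bimodules -/

open Classical in
/-- The summand at `y` in `⨁ y, M(y,x) ⊗ N(z,y)`. -/
noncomputable def preMk (M : Bimod k H G) (N : Bimod k K H) (z : K) (x : G) (y : H) :
    M.E y x →ₗ[k] N.E z y →ₗ[k] (DirectSum H fun y => M.E y x ⊗[k] N.E z y) :=
  (TensorProduct.mk k (M.E y x) (N.E z y)).compr₂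
    (DirectSum.lof k H (fun y => M.E y x ⊗[k] N.E z y) y)

/-- The relations `(m · g) ⊗ n = m ⊗ (g · n)`. -/
noncomputable def tensRel (M : Bimod k H G) (N : Bimod k K H) (z : K) (x : G) :
    Submodule k (DirectSum H fun y => M.E y x ⊗[k] N.E z y) :=
  Submodule.span k {d | ∃ (y y' : H) (g : y' ⟶ y) (m : M.E y x) (n : N.E z y'),
    d = preMk M N z x y' (M.act g (𝟙 x) m) n - preMk M N z x y m (N.act (𝟙 z) g n)}

/-- The value at `(z,x)` of the tensor product `M ⊗_H N`. -/
abbrev T (M : Bimod k H G) (N : Bimod k K H) (z : K) (x : G) : Type u :=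
  (DirectSum H fun y => M.E y x ⊗[k] N.E z y) ⧸ tensRel M N z x

/-- The pure tensor `m ⊗ n` at `y`. -/
noncomputable def mk₀ (M : Bimod k H G) (N : Bimod k K H) (z : K) (x : G) (y : H) :
    M.E y x →ₗ[k] N.E z y →ₗ[k] T M N z x :=
  (preMk M N z x y).compr₂ (tensRel M N z x).mkQ

lemma mk₀_balance (M : Bimod k H G) (N : Bimod k K H) (z : K) (x : G) {y y' : H} (g : y' ⟶ y)
    (m : M.E y x) (n : N.E z y') :
    mk₀ M N z x y' (M.act g (𝟙 x) m) n = mk₀ M N z x y m (N.act (𝟙 z) g n) :=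
  (Submodule.Quotient.eq _).2 (Submodule.subset_span ⟨y, y', g, m, n, rfl⟩)

open Classical in
/-- Linear maps out of `M ⊗_H N` are balanced bilinear maps. -/
noncomputable def lift₀ {M : Bimod k H G} {N : Bimod k K H} {z : K} {x : G} {A : Type*}
    [AddCommGroup A] [Module k A] (f : ∀ y : H, M.E y x →ₗ[k] N.E z y →ₗ[k] A)
    (hf : ∀ (y y' : H) (g : y' ⟶ y) (m : M.E y x) (n : N.E z y'),
      f y' (M.act g (𝟙 x) m) n = f y m (N.act (𝟙 z) g n)) : T M N z x →ₗ[k] A :=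
  (tensRel M N z x).liftQ (DirectSum.toModule k H A fun y => TensorProduct.lift (f y)) (by
    refine Submodule.span_le.2 ?_
    rintro _ ⟨y, y', g, m, n, rfl⟩
    simp [preMk, hf])

lemma lift₀_mk₀ {M : Bimod k H G} {N : Bimod k K H} {z : K} {x : G} {A : Type*}
    [AddCommGroup A] [Module k A] (f : ∀ y : H, M.E y x →ₗ[k] N.E z y →ₗ[k] A) (hf) {y : H}
    (m : M.E y x) (n : N.E z y) : lift₀ f hf (mk₀ M N z x y m n) = f y m n := by
  refine (Submodule.liftQ_apply _ _ _).trans ?_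
  simp [preMk]

lemma hom_ext₀ {M : Bimod k H G} {N : Bimod k K H} {z : K} {x : G} {A : Type*}
    [AddCommGroup A] [Module k A] {f g : T M N z x →ₗ[k] A}
    (h : ∀ (y : H) (m : M.E y x) (n : N.E z y), f (mk₀ M N z x y m n) = g (mk₀ M N z x y m n)) :
    f = g := by
  classical
  refine Submodule.linearMap_qext _ (DirectSum.linearMap_ext k fun y => ?_)
  exact TensorProduct.ext' fun m n => h y m n

lemma mk₀_balance_act (M : Bimod k H G) (N : Bimod k K H) {z z' : K} {x x' : G} (h : z' ⟶ z)
    (g : x ⟶ x') (y y' : H) (l : y' ⟶ y) (m : M.E y x) (n : N.E z y') :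
    (mk₀ M N z' x' y').compl₁₂ (M.act (𝟙 y') g) (N.act h (𝟙 y')) (M.act l (𝟙 x) m) n =
      (mk₀ M N z' x' y).compl₁₂ (M.act (𝟙 y) g) (N.act h (𝟙 y)) m (N.act (𝟙 z) l n) := by
  simpa using mk₀_balance M N z' x' l (M.act (𝟙 _) g m) (N.act h (𝟙 _) n)

/-- The tensor product `M ⊗_H N` of bimodules. -/
noncomputable def tens (M : Bimod k H G) (N : Bimod k K H) : Bimod k K G :=
  ofAct (fun z x => T M N z x)
    (fun {z z' x x'} h g => lift₀ (fun y => (mk₀ M N z' x' y).compl₁₂ (M.act (𝟙 y) g)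
      (N.act h (𝟙 y))) (mk₀_balance_act M N h g))
    (hom_ext₀ fun y m n => by simp [lift₀_mk₀])
    (fun h g h' g' => hom_ext₀ fun y m n => by simp [lift₀_mk₀])

/-- The pure tensor `m ⊗ n` at `y`. -/
noncomputable def mk {M : Bimod k H G} {N : Bimod k K H} {z : K} {x : G} {y : H} :
    M.E y x →ₗ[k] N.E z y →ₗ[k] (tens M N).E z x := mk₀ M N z x y

lemma mk_balance {M : Bimod k H G} {N : Bimod k K H} {z : K} {x : G} {y y' : H} (g : y' ⟶ y)
    (m : M.E y x) (n : N.E z y') :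
    (mk (M.act g (𝟙 x) m) n : (tens M N).E z x) = mk m (N.act (𝟙 z) g n) := mk₀_balance ..

@[simp] lemma tens_act (M : Bimod k H G) (N : Bimod k K H) {z z' : K} {x x' : G} {y : H}
    (h : z' ⟶ z) (g : x ⟶ x') (m : M.E y x) (n : N.E z y) :
    (tens M N).act h g (mk m n) = mk (M.act (𝟙 y) g m) (N.act h (𝟙 y) n) :=
  lift₀_mk₀ _ (mk₀_balance_act M N h g) _ _

/-- Linear maps out of `M ⊗_H N` are balanced bilinear maps. -/
noncomputable def lift {M : Bimod k H G} {N : Bimod k K H} {z : K} {x : G} {A : Type*}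
    [AddCommGroup A] [Module k A] (f : ∀ y : H, M.E y x →ₗ[k] N.E z y →ₗ[k] A)
    (hf : ∀ (y y' : H) (g : y' ⟶ y) (m : M.E y x) (n : N.E z y'),
      f y' (M.act g (𝟙 x) m) n = f y m (N.act (𝟙 z) g n)) : (tens M N).E z x →ₗ[k] A :=
  lift₀ f hf

@[simp] lemma lift_mk {M : Bimod k H G} {N : Bimod k K H} {z : K} {x : G} {A : Type*}
    [AddCommGroup A] [Module k A] (f : ∀ y : H, M.E y x →ₗ[k] N.E z y →ₗ[k] A) (hf) {y : H}
    (m : M.E y x) (n : N.E z y) : lift f hf (mk m n) = f y m n := lift₀_mk₀ ..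

lemma lin_ext {M : Bimod k H G} {N : Bimod k K H} {z : K} {x : G} {A : Type*}
    [AddCommGroup A] [Module k A] {f g : (tens M N).E z x →ₗ[k] A}
    (h : ∀ (y : H) (m : M.E y x) (n : N.E z y), f (mk m n) = g (mk m n)) : f = g := hom_ext₀ h

lemma tens_hom_ext {M : Bimod k H G} {N : Bimod k K H} {P : Bimod k K G} {φ ψ : tens M N ⟶ P}
    (h : ∀ (z : K) (x : G) (y : H) (m : M.E y x) (n : N.E z y),
      ap φ z x (mk m n) = ap ψ z x (mk m n)) : φ = ψ := hom_ext fun z x => lin_ext (h z x)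

/-- Elements of a tensor product are sums of pure tensors. -/
@[elab_as_elim] lemma tens_ind {M : Bimod k H G} {N : Bimod k K H} {z : K} {x : G}
    {p : (tens M N).E z x → Prop} (zero : p 0) (add : ∀ a b, p a → p b → p (a + b))
    (mk : ∀ (y : H) (m : M.E y x) (n : N.E z y), p (mk m n)) (a) : p a := by
  let S : Submodule k ((tens M N).E z x) :=
    Submodule.span k {a | ∃ (y : H) (m : M.E y x) (n : N.E z y), Bimod.mk m n = a}
  have hS : S.mkQ = 0 := lin_ext fun y m n => by
    simpa using (Submodule.subset_span ⟨y, m, n, rfl⟩ : Bimod.mk m n ∈ S)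
  have hx : a ∈ S := by
    rw [← Submodule.ker_mkQ S, hS]; trivial
  induction hx using Submodule.closure_induction with
  | zero => exact zero
  | add x y _ _ hx hy => exact add x y hx hy
  | smul_mem c x h =>
    obtain ⟨y, m, n, rfl⟩ := h
    rw [← map_smul]
    exact mk y m (c • n)

/-- Build an equivariant map out of a tensor product. -/
noncomputable def tensHom {M : Bimod k H G} {N : Bimod k K H} {P : Bimod k K G}
    (f : ∀ (z : K) (x : G) (y : H), M.E y x →ₗ[k] N.E z y →ₗ[k] P.E z x)
    (hf : ∀ {z : K} {x : G} {y y' : H} (g : y' ⟶ y) (m : M.E y x) (n : N.E z y'),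
      f z x y' (M.act g (𝟙 x) m) n = f z x y m (N.act (𝟙 z) g n))
    (nat : ∀ {z z' : K} {x x' : G} {y : H} (h : z' ⟶ z) (g : x ⟶ x') (m : M.E y x) (n : N.E z y),
      f z' x' y (M.act (𝟙 y) g m) (N.act h (𝟙 y) n) = P.act h g (f z x y m n)) : tens M N ⟶ P :=
  homMk (fun z x => lift (f z x) (fun _ _ => hf)) (fun h g => lin_ext fun y m n => by simp [nat])

@[simp] lemma ap_tensHom {M : Bimod k H G} {N : Bimod k K H} {P : Bimod k K G}
    (f : ∀ (z : K) (x : G) (y : H), M.E y x →ₗ[k] N.E z y →ₗ[k] P.E z x) (hf) (nat)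
    {z : K} {x : G} {y : H} (m : M.E y x) (n : N.E z y) :
    ap (tensHom (P := P) f hf nat) z x (mk m n) = f z x y m n :=
  lift_mk _ (fun _ _ => hf) _ _

/-- The map of tensor products induced by two equivariant maps. -/
noncomputable def tensMap {M M' : Bimod k H G} {N N' : Bimod k K H} (φ : M ⟶ M') (ψ : N ⟶ N') :
    tens M N ⟶ tens M' N' :=
  tensHom (fun z x y => mk.compl₁₂ (ap φ y x) (ap ψ z y)) (by simp [mk_balance]) (by simp)

@[simp] lemma ap_tensMap {M M' : Bimod k H G} {N N' : Bimod k K H} (φ : M ⟶ M') (ψ : N ⟶ N')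
    {z : K} {x : G} {y : H} (m : M.E y x) (n : N.E z y) :
    ap (tensMap φ ψ) z x (mk m n) = mk (ap φ y x m) (ap ψ z y n) := by simp [tensMap]

/-- `m ⊗ n ↦ (p ⊗ m) ⊗ n` for fixed `p`. -/
noncomputable def assocFwd (P : Bimod k G L) (M : Bimod k H G) (N : Bimod k K H) {z : K} {x : L}
    {y : G} (p : P.E y x) : (tens M N).E z y →ₗ[k] (tens (tens P M) N).E z x :=
  lift (fun _ => mk ∘ₗ mk p) (by intros; simp [← mk_balance])

@[simp] lemma assocFwd_mk (P : Bimod k G L) (M : Bimod k H G) (N : Bimod k K H) {z : K} {x : L}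
    {y : G} {w : H} (p : P.E y x) (m : M.E w y) (n : N.E z w) :
    assocFwd P M N p (mk m n) = mk (mk p m) n := by simp [assocFwd]

lemma assocBwd_bal (P : Bimod k G L) (M : Bimod k H G) (N : Bimod k K H) {z : K} {x : L}
    {y : H} (n : N.E z y) (w w' : G) (g : w' ⟶ w) (p : P.E w x) (m : M.E y w') :
    (mk.compl₂ (mk.flip n) : P.E w' x →ₗ[k] M.E y w' →ₗ[k] (tens P (tens M N)).E z x)
      (P.act g (𝟙 x) p) m =
    (mk.compl₂ (mk.flip n) : P.E w x →ₗ[k] M.E y w →ₗ[k] (tens P (tens M N)).E z x)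
      p (M.act (𝟙 y) g m) := by
  simp [mk_balance]

/-- `p ⊗ m ↦ p ⊗ (m ⊗ n)` for fixed `n`. -/
noncomputable def assocBwd (P : Bimod k G L) (M : Bimod k H G) (N : Bimod k K H) {z : K} {x : L}
    {y : H} (n : N.E z y) : (tens P M).E y x →ₗ[k] (tens P (tens M N)).E z x :=
  lift (M := P) (N := M) (fun _ => mk.compl₂ (mk.flip n)) (assocBwd_bal P M N n)

@[simp] lemma assocBwd_mk (P : Bimod k G L) (M : Bimod k H G) (N : Bimod k K H) {z : K} {x : L}
    {y : H} {w : G} (p : P.E w x) (m : M.E y w) (n : N.E z y) :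
    assocBwd P M N n (mk p m) = mk p (mk m n) :=
  lift_mk (fun _ => mk.compl₂ (mk.flip n)) (assocBwd_bal P M N n) p m

/-- The associativity isomorphism `p ⊗ (m ⊗ n) ↦ (p ⊗ m) ⊗ n`. -/
noncomputable def assocM (P : Bimod k G L) (M : Bimod k H G) (N : Bimod k K H) :
    tens P (tens M N) ≅ tens (tens P M) N where
  hom := tensHom (fun z x y =>
      { toFun := fun p => assocFwd P M N p
        map_add' := fun p p' => lin_ext (by simp)
        map_smul' := fun c p => lin_ext (by simp) })
      (by
        intro z x y y' g p q
        induction q using tens_ind with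
        | zero => simp
        | add a b ha hb => simp only [map_add, ha, hb]
        | mk w m n => simp [mk_balance])
      (by
        intro z z' x x' y h g p q
        induction q using tens_ind with
        | zero => simp
        | add a b ha hb => simp only [map_add, ha, hb]
        | mk w m n => simp)
  inv := tensHom (fun z x y => LinearMap.flip
      { toFun := fun n => assocBwd P M N n
        map_add' := fun p p' => lin_ext (by simp)
        map_smul' := fun c p => lin_ext (by simp) })
      (by
        intro z x y y' g q n
        induction q using tens_ind with
        | zero => simp
        | add a b ha hb => simp only [map_add, LinearMap.add_apply, ha, hb]
        | mk w m n => simp [mk_balance])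
      (by
        intro z z' x x' y h g q n
        induction q using tens_ind with
        | zero => simp
        | add a b ha hb => simp only [map_add, LinearMap.add_apply, ha, hb]
        | mk w m n => simp)
  hom_inv_id := by
    refine tens_hom_ext fun z x y p q => ?_
    induction q using tens_ind with
    | zero => simp
    | add a b ha hb => simp only [map_add, ha, hb]
    | mk w m n => simp
  inv_hom_id := by
    refine tens_hom_ext fun z x y q n => ?_
    induction q using tens_ind with
    | zero => simp
    | add a b ha hb => simp only [map_add, LinearMap.add_apply, ha, hb]
    | mk w m n => simp

@[simp] lemma assocM_hom_mk (P : Bimod k G L) (M : Bimod k H G) (N : Bimod k K H) {z : K} {x : L}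
    {y : G} {w : H} (p : P.E y x) (m : M.E w y) (n : N.E z w) :
    ap (assocM P M N).hom z x (mk p (mk m n)) = mk (mk p m) n := by simp [assocM]

@[simp] lemma assocM_inv_mk (P : Bimod k G L) (M : Bimod k H G) (N : Bimod k K H) {z : K} {x : L}
    {y : G} {w : H} (p : P.E y x) (m : M.E w y) (n : N.E z w) :
    ap (assocM P M N).inv z x (mk (mk p m) n) = mk p (mk m n) := by simp [assocM]

/-- Two maps out of a triple tensor product agree if they agree on pure tensors. -/
lemma tens_hom_ext₃ {P : Bimod k G L} {M : Bimod k H G} {N : Bimod k K H} {Q : Bimod k K L}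
    {φ ψ : tens P (tens M N) ⟶ Q}
    (e : ∀ (z : K) (x : L) (y : G) (w : H) (p : P.E y x) (m : M.E w y) (n : N.E z w),
      ap φ z x (mk p (mk m n)) = ap ψ z x (mk p (mk m n))) : φ = ψ := by
  refine tens_hom_ext fun z x y p q => ?_
  induction q using tens_ind with
  | zero => simp
  | add a b ha hb => simp only [map_add, ha, hb]
  | mk w m n => exact e z x y w p m n

lemma tens_hom_ext₃' {P : Bimod k G L} {M : Bimod k H G} {N : Bimod k K H} {Q : Bimod k K L}
    {φ ψ : tens (tens P M) N ⟶ Q}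
    (e : ∀ (z : K) (x : L) (y : G) (w : H) (p : P.E y x) (m : M.E w y) (n : N.E z w),
      ap φ z x (mk (mk p m) n) = ap ψ z x (mk (mk p m) n)) : φ = ψ := by
  refine (cancel_epi (assocM P M N).hom).1 (tens_hom_ext₃ fun z x y w p m n => ?_)
  simpa using e z x y w p m n

/-! ### Linearization of bisets -/

/-- The permutation bimodule `k[S]` of a biset. -/
noncomputable def lin (k : Type u) [CommRing k] (S : RFBiset H G) : Bimod k H G :=
  ofAct (fun y x => S.E y x →₀ k) (fun h g => Finsupp.lmapDomain k k (S.act h g))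
    (Finsupp.lhom_ext' fun s => LinearMap.ext_ring (by simp))
    (fun h g h' g' => Finsupp.lhom_ext' fun s => LinearMap.ext_ring (by simp))

/-- The basis element of `k[S]` given by an element of `S`. -/
noncomputable def bas {S : RFBiset H G} {y : H} {x : G} (s : S.E y x) : (lin k S).E y x :=
  Finsupp.single s 1

@[simp] lemma act_bas {S : RFBiset H G} {y y' : H} {x x' : G} (h : y' ⟶ y) (g : x ⟶ x')
    (s : S.E y x) : (lin k S).act h g (bas s) = bas (S.act h g s) :=
  Finsupp.mapDomain_single

/-- The linear map out of `k[S](y,x)` with given values on the basis. -/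
noncomputable def linLift {S : RFBiset H G} {y : H} {x : G} {A : Type*} [AddCommGroup A]
    [Module k A] (f : S.E y x → A) : (lin k S).E y x →ₗ[k] A := Finsupp.linearCombination k f

@[simp] lemma linLift_bas {S : RFBiset H G} {y : H} {x : G} {A : Type*} [AddCommGroup A]
    [Module k A] (f : S.E y x → A) (s : S.E y x) : linLift (k := k) f (bas s) = f s :=
  (Finsupp.linearCombination_single k 1 s).trans (one_smul k _)

lemma bas_ext {S : RFBiset H G} {y : H} {x : G} {A : Type*} [AddCommGroup A]
    [Module k A] {f g : (lin k S).E y x →ₗ[k] A} (e : ∀ s : S.E y x, f (bas s) = g (bas s)) :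
    f = g := Finsupp.lhom_ext' fun s => LinearMap.ext_ring (e s)

lemma lin_hom_ext {S : RFBiset H G} {M : Bimod k H G} {φ ψ : lin k S ⟶ M}
    (e : ∀ (y : H) (x : G) (s : S.E y x), ap φ y x (bas s) = ap ψ y x (bas s)) : φ = ψ :=
  hom_ext fun y x => bas_ext (e y x)

lemma bas_ext₂ {T : RFBiset H G} {S : RFBiset K H} {Q : Bimod k K G}
    {φ ψ : tens (lin k T) (lin k S) ⟶ Q}
    (e : ∀ (z : K) (x : G) (y : H) (t : T.E y x) (s : S.E z y),
      ap φ z x (mk (bas t) (bas s)) = ap ψ z x (mk (bas t) (bas s))) : φ = ψ := by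
  refine tens_hom_ext fun z x y m n => ?_
  have := bas_ext (f := mk.compr₂ (ap φ z x)) (g := mk.compr₂ (ap ψ z x))
    fun t => bas_ext fun s => e z x y t s
  exact LinearMap.congr_fun₂ this m n

/-- `t ⊗ s ↦ [t, s]`. -/
noncomputable def linTensBwd (T : RFBiset H G) (S : RFBiset K H) (z : K) (x : G) (y : H) :
    (lin k T).E y x →ₗ[k] (lin k S).E z y →ₗ[k] (lin k (T.tens S)).E z x :=
  linLift fun t => linLift fun s => bas (RFBiset.tmk t s)

@[simp] lemma linTensBwd_bas (T : RFBiset H G) (S : RFBiset K H) {z : K} {x : G} {y : H}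
    (t : T.E y x) (s : S.E z y) :
    linTensBwd (k := k) T S z x y (bas t) (bas s) = bas (RFBiset.tmk t s) := by
  simp [linTensBwd]

lemma linTensBwd_bal (T : RFBiset H G) (S : RFBiset K H) {z : K} {x : G} {y y' : H} (g : y' ⟶ y)
    (m : (lin k T).E y x) (n : (lin k S).E z y') :
    linTensBwd T S z x y' ((lin k T).act g (𝟙 x) m) n =
      linTensBwd T S z x y m ((lin k S).act (𝟙 z) g n) :=
  LinearMap.congr_fun₂
      (f := (linTensBwd T S z x y').compl₁₂ ((lin k T).act g (𝟙 x)) LinearMap.id)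
      (g := (linTensBwd T S z x y).compl₂ ((lin k S).act (𝟙 z) g))
      (bas_ext fun t => bas_ext fun s => by simp [RFBiset.tmk_balance]) m n

lemma linTensBwd_nat (T : RFBiset H G) (S : RFBiset K H) {z z' : K} {x x' : G} {y : H}
    (h : z' ⟶ z) (g : x ⟶ x') (m : (lin k T).E y x) (n : (lin k S).E z y) :
    linTensBwd T S z' x' y ((lin k T).act (𝟙 y) g m) ((lin k S).act h (𝟙 y) n) =
      (lin k (T.tens S)).act h g (linTensBwd T S z x y m n) :=
  LinearMap.congr_fun₂
      (f := (linTensBwd T S z' x' y).compl₁₂ ((lin k T).act (𝟙 y) g) ((lin k S).act h (𝟙 y)))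
      (g := (linTensBwd T S z x y).compr₂ ((lin k (T.tens S)).act h g))
      (bas_ext fun t => bas_ext fun s => by simp) m n

/-- `t ⊗ s ↦ [t, s]`. -/
noncomputable def linTensInv (T : RFBiset H G) (S : RFBiset K H) :
    tens (lin k T) (lin k S) ⟶ lin k (T.tens S) :=
  tensHom (fun z x y => linTensBwd T S z x y) (linTensBwd_bal T S) (linTensBwd_nat T S)

@[simp] lemma linTensInv_bas (T : RFBiset H G) (S : RFBiset K H) {z : K} {x : G} {y : H}
    (t : T.E y x) (s : S.E z y) :
    ap (linTensInv (k := k) T S) z x (mk (bas t) (bas s)) = bas (RFBiset.tmk t s) :=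
  (ap_tensHom (fun z x y => linTensBwd T S z x y) (linTensBwd_bal T S) (linTensBwd_nat T S)
    (bas t) (bas s)).trans (linTensBwd_bas T S t s)

/-- The canonical isomorphism `k[T ×_H S] ≅ k[T] ⊗_H k[S]`, `[t, s] ↦ t ⊗ s`. -/
noncomputable def linTens (T : RFBiset H G) (S : RFBiset K H) :
    lin k (T.tens S) ≅ tens (lin k T) (lin k S) where
  hom := homMk (fun z x => linLift (RFBiset.tlift (fun y t s => mk (bas t) (bas s)) (by
      intro y y' t g s
      have := mk_balance (M := lin k T) (N := lin k S) g (bas t) (bas s)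
      simpa using this))) (by
    intro z z' x x' h g
    refine bas_ext fun q => ?_
    induction q using RFBiset.tens_ind with
    | h y t s => simp)
  inv := linTensInv T S
  hom_inv_id := lin_hom_ext fun z x q => by
    induction q using RFBiset.tens_ind with
    | h y t s => simp
  inv_hom_id := bas_ext₂ fun z x y t s => by simp

@[simp] lemma linTens_hom_bas (T : RFBiset H G) (S : RFBiset K H) {z : K} {x : G} {y : H}
    (t : T.E y x) (s : S.E z y) :
    ap (linTens (k := k) T S).hom z x (bas (RFBiset.tmk t s)) = mk (bas t) (bas s) := by
  simp [linTens]

@[simp] lemma linTens_inv_bas (T : RFBiset H G) (S : RFBiset K H) {z : K} {x : G} {y : H}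
    (t : T.E y x) (s : S.E z y) :
    ap (linTens (k := k) T S).inv z x (mk (bas t) (bas s)) = bas (RFBiset.tmk t s) := by
  simp [linTens]

end Bimod

namespace Bimod

variable {k : Type u} [CommRing k] {H G K L : FinGpd}

/-! ### Unit isomorphisms -/

/-- Two maps out of `M ⊗ k[S]` agree if they agree on the elements `m ⊗ s`. -/
lemma tens_bas_extR {M : Bimod k H G} {S : RFBiset K H} {Q : Bimod k K G}
    {φ ψ : tens M (lin k S) ⟶ Q}
    (e : ∀ (z : K) (x : G) (y : H) (m : M.E y x) (s : S.E z y),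
      ap φ z x (mk m (bas s)) = ap ψ z x (mk m (bas s))) : φ = ψ :=
  tens_hom_ext fun z x y m n => LinearMap.congr_fun
    (bas_ext (f := ap φ z x ∘ₗ mk m) (g := ap ψ z x ∘ₗ mk m) fun s => e z x y m s) n

/-- Two maps out of `k[S] ⊗ M` agree if they agree on the elements `s ⊗ m`. -/
lemma tens_bas_extL {S : RFBiset H G} {M : Bimod k K H} {Q : Bimod k K G}
    {φ ψ : tens (lin k S) M ⟶ Q}
    (e : ∀ (z : K) (x : G) (y : H) (s : S.E y x) (m : M.E z y),
      ap φ z x (mk (bas s) m) = ap ψ z x (mk (bas s) m)) : φ = ψ :=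
  tens_hom_ext fun z x y n m => LinearMap.congr_fun
    (bas_ext (f := ap φ z x ∘ₗ mk.flip m) (g := ap ψ z x ∘ₗ mk.flip m) fun s => e z x y s m) n

/-- `m ⊗ h ↦ m · h`. -/
noncomputable def unitRBil (M : Bimod k H G) (z : H) (x : G) (y : H) :
    M.E y x →ₗ[k] (lin k (RFBiset.idB H)).E z y →ₗ[k] M.E z x :=
  LinearMap.flip (linLift fun s => M.act (RFBiset.idB.hom s) (𝟙 x))

@[simp] lemma unitRBil_bas (M : Bimod k H G) {z : H} {x : G} {y : H} (m : M.E y x)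
    (s : (RFBiset.idB H).E z y) :
    unitRBil M z x y m (bas s) = M.act (RFBiset.idB.hom s) (𝟙 x) m := by
  simp [unitRBil]

lemma unitRBil_bal (M : Bimod k H G) {z : H} {x : G} {y y' : H} (g : y' ⟶ y) (m : M.E y x)
    (n : (lin k (RFBiset.idB H)).E z y') :
    unitRBil M z x y' (M.act g (𝟙 x) m) n =
      unitRBil M z x y m ((lin k (RFBiset.idB H)).act (𝟙 z) g n) :=
  LinearMap.congr_fun (bas_ext (f := unitRBil M z x y' (M.act g (𝟙 x) m))
    (g := unitRBil M z x y m ∘ₗ (lin k (RFBiset.idB H)).act (𝟙 z) g) fun s => by simp) n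

lemma unitRBil_nat (M : Bimod k H G) {z z' : H} {x x' : G} {y : H} (h : z' ⟶ z) (g : x ⟶ x')
    (m : M.E y x) (n : (lin k (RFBiset.idB H)).E z y) :
    unitRBil M z' x' y (M.act (𝟙 y) g m) ((lin k (RFBiset.idB H)).act h (𝟙 y) n) =
      M.act h g (unitRBil M z x y m n) :=
  LinearMap.congr_fun (bas_ext
    (f := unitRBil M z' x' y (M.act (𝟙 y) g m) ∘ₗ (lin k (RFBiset.idB H)).act h (𝟙 y))
    (g := M.act h g ∘ₗ unitRBil M z x y m) fun s => by simp) n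

noncomputable def unitRHom (M : Bimod k H G) : tens M (lin k (RFBiset.idB H)) ⟶ M :=
  tensHom (unitRBil M) (unitRBil_bal M) (unitRBil_nat M)

@[simp] lemma unitRHom_mk (M : Bimod k H G) {z : H} {x : G} {y : H} (m : M.E y x)
    (s : (RFBiset.idB H).E z y) :
    ap (unitRHom M) z x (mk m (bas s)) = M.act (RFBiset.idB.hom s) (𝟙 x) m :=
  (ap_tensHom (unitRBil M) (unitRBil_bal M) (unitRBil_nat M) m (bas s)).trans
    (unitRBil_bas M m s)

/-- The unit isomorphism `m ⊗ h ↦ m · h`. -/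
noncomputable def unitRM (M : Bimod k H G) : tens M (lin k (RFBiset.idB H)) ≅ M where
  hom := unitRHom M
  inv := homMk (fun y _ => mk.flip (bas (RFBiset.idB.of (𝟙 y)))) (by
    intro y y' x x' h g
    ext m
    simpa using mk_balance h (M.act (𝟙 y) g m)
      (bas (RFBiset.idB.of (𝟙 y')) : (lin k (RFBiset.idB H)).E y' y'))
  hom_inv_id := by
    refine tens_bas_extR fun z x y m s => ?_
    simp [mk_balance, RFBiset.idB.of_hom]
  inv_hom_id := hom_ext fun y x => by ext m; simp

/-- `g ⊗ m ↦ g · m`. -/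
noncomputable def unitLBil (M : Bimod k H G) (z : H) (x : G) (y : G) :
    (lin k (RFBiset.idB G)).E y x →ₗ[k] M.E z y →ₗ[k] M.E z x :=
  linLift fun s => M.act (𝟙 z) (RFBiset.idB.hom s)

@[simp] lemma unitLBil_bas (M : Bimod k H G) {z : H} {x : G} {y : G} (m : M.E z y)
    (s : (RFBiset.idB G).E y x) :
    unitLBil M z x y (bas s) m = M.act (𝟙 z) (RFBiset.idB.hom s) m := by
  simp [unitLBil]

lemma unitLBil_bal (M : Bimod k H G) {z : H} {x : G} {y y' : G} (g : y' ⟶ y)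
    (n : (lin k (RFBiset.idB G)).E y x) (m : M.E z y') :
    unitLBil M z x y' ((lin k (RFBiset.idB G)).act g (𝟙 x) n) m =
      unitLBil M z x y n (M.act (𝟙 z) g m) :=
  LinearMap.congr_fun (bas_ext
    (f := (unitLBil M z x y').flip m ∘ₗ (lin k (RFBiset.idB G)).act g (𝟙 x))
    (g := (unitLBil M z x y).flip (M.act (𝟙 z) g m)) fun s => by simp) n

lemma unitLBil_nat (M : Bimod k H G) {z z' : H} {x x' : G} {y : G} (h : z' ⟶ z) (g : x ⟶ x')
    (n : (lin k (RFBiset.idB G)).E y x) (m : M.E z y) :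
    unitLBil M z' x' y ((lin k (RFBiset.idB G)).act (𝟙 y) g n) (M.act h (𝟙 y) m) =
      M.act h g (unitLBil M z x y n m) :=
  LinearMap.congr_fun (bas_ext
    (f := (unitLBil M z' x' y).flip (M.act h (𝟙 y) m) ∘ₗ (lin k (RFBiset.idB G)).act (𝟙 y) g)
    (g := M.act h g ∘ₗ (unitLBil M z x y).flip m) fun s => by simp) n

noncomputable def unitLHom (M : Bimod k H G) : tens (lin k (RFBiset.idB G)) M ⟶ M :=
  tensHom (unitLBil M) (unitLBil_bal M) (unitLBil_nat M)

@[simp] lemma unitLHom_mk (M : Bimod k H G) {z : H} {x : G} {y : G} (m : M.E z y)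
    (s : (RFBiset.idB G).E y x) :
    ap (unitLHom M) z x (mk (bas s) m) = M.act (𝟙 z) (RFBiset.idB.hom s) m :=
  (ap_tensHom (unitLBil M) (unitLBil_bal M) (unitLBil_nat M) (bas s) m).trans
    (unitLBil_bas M m s)

/-- The unit isomorphism `g ⊗ m ↦ g · m`. -/
noncomputable def unitLM (M : Bimod k H G) : tens (lin k (RFBiset.idB G)) M ≅ M where
  hom := unitLHom M
  inv := homMk (fun _ x => mk (bas (RFBiset.idB.of (𝟙 x)))) (by
    intro y y' x x' h g
    ext m
    simpa using (mk_balance g (bas (RFBiset.idB.of (𝟙 x')) : (lin k (RFBiset.idB G)).E x' x')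
      (M.act h (𝟙 x) m)).symm)
  hom_inv_id := by
    refine tens_bas_extL fun z x y s m => ?_
    simp [← mk_balance, RFBiset.idB.of_hom]
  inv_hom_id := hom_ext fun y x => by ext m; simp

lemma unitRM_nat {M M' : Bimod k H G} (φ : M ⟶ M') :
    (unitRM M).hom ≫ φ = tensMap φ (𝟙 _) ≫ (unitRM M').hom :=
  tens_bas_extR fun _ _ _ _ _ => by simp [unitRM]

lemma unitLM_nat {M M' : Bimod k H G} (φ : M ⟶ M') :
    (unitLM M).hom ≫ φ = tensMap (𝟙 _) φ ≫ (unitLM M').hom :=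
  tens_bas_extL fun _ _ _ _ _ => by simp [unitLM]

lemma tensMap_id (M : Bimod k H G) (N : Bimod k K H) : tensMap (𝟙 M) (𝟙 N) = 𝟙 (tens M N) :=
  tens_hom_ext fun _ _ _ _ _ => by simp

lemma tensMap_comp {M M' M'' : Bimod k H G} {N N' N'' : Bimod k K H} (φ : M ⟶ M') (φ' : M' ⟶ M'')
    (ψ : N ⟶ N') (ψ' : N' ⟶ N'') :
    tensMap (φ ≫ φ') (ψ ≫ ψ') = tensMap φ ψ ≫ tensMap φ' ψ' :=
  tens_hom_ext fun _ _ _ _ _ => by simp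

/-- The isomorphism of tensor products induced by two isomorphisms. -/
noncomputable def tensIso {M M' : Bimod k H G} {N N' : Bimod k K H} (e : M ≅ M') (d : N ≅ N') :
    tens M N ≅ tens M' N' where
  hom := tensMap e.hom d.hom
  inv := tensMap e.inv d.inv
  hom_inv_id := by rw [← tensMap_comp, e.hom_inv_id, d.hom_inv_id, tensMap_id]
  inv_hom_id := by rw [← tensMap_comp, e.inv_hom_id, d.inv_hom_id, tensMap_id]

@[simp] lemma ap_add {M N : Bimod k H G} (φ ψ : M ⟶ N) (y : H) (x : G) :
    ap (φ + ψ) y x = ap φ y x + ap ψ y x := rfl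

@[simp] lemma ap_zero {M N : Bimod k H G} (y : H) (x : G) : ap (0 : M ⟶ N) y x = 0 := rfl

@[simp] lemma ap_smul {M N : Bimod k H G} (c : k) (φ : M ⟶ N) (y : H) (x : G) :
    ap (c • φ) y x = c • ap φ y x := rfl

/-! ### Right-free permutation bimodules -/

/-- A right-free permutation bimodule: one which has a finite basis that is stable under the
two-sided action and on which `H` acts freely (freeness is asked of the basis elements, since
`0` and norms such as `∑ h, s · h` are always fixed). Such a basis, a right-free finite biset `S`, is
given here as a family of bases indexed by the sets `S(y,x)`. -/
def IsPermRF (M : Bimod k H G) : Prop :=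
  ∃ (S : RFBiset H G) (b : ∀ (y : H) (x : G), Module.Basis (S.E y x) k (M.E y x)),
    ∀ {y y' : H} {x x' : G} (h : y' ⟶ y) (g : x ⟶ x') (s : S.E y x),
      M.act h g (b y x s) = b y' x' (S.act h g s)

lemma isPermRF_iff {M : Bimod k H G} : IsPermRF M ↔ ∃ S : RFBiset H G, Nonempty (lin k S ≅ M) := by
  constructor
  · rintro ⟨S, b, hb⟩
    refine ⟨S, ⟨⟨homMk (fun y x => linLift (b y x)) fun h g => bas_ext fun s => ?_,
      homMk (fun y x => (b y x).constr k bas) fun {y y' x x'} h g => (b y x).ext fun s => ?_,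
      lin_hom_ext fun y x s => ?_, hom_ext fun y x => (b y x).ext fun s => ?_⟩⟩⟩
    · simp [hb]
    · simp [hb]
    · simp
    · simp
  · rintro ⟨S, ⟨e⟩⟩
    have h1 : ∀ (y : H) (x : G), ap e.inv y x ∘ₗ ap e.hom y x = LinearMap.id := fun y x =>
      congrArg (fun φ => ap φ y x) e.hom_inv_id
    have h2 : ∀ (y : H) (x : G), ap e.hom y x ∘ₗ ap e.inv y x = LinearMap.id := fun y x =>
      congrArg (fun φ => ap φ y x) e.inv_hom_id
    have hb : ∀ (y : H) (x : G) (s : S.E y x), (Module.Basis.ofRepr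
        (LinearEquiv.ofLinearMap (M := M.E y x) (M₂ := S.E y x →₀ k) (ap e.inv y x) (ap e.hom y x)
          (h1 y x) (h2 y x)) : Module.Basis (S.E y x) k (M.E y x)) s = ap e.hom y x (bas s) :=
      fun y x s => rfl
    exact ⟨S, fun y x => _, fun h g s => by rw [hb, hb, ← ap_act, act_bas]⟩

lemma isPermRF_lin (S : RFBiset H G) : IsPermRF (lin k S) := isPermRF_iff.2 ⟨S, ⟨Iso.refl _⟩⟩

lemma IsPermRF.tens {M : Bimod k H G} {N : Bimod k K H} (hM : IsPermRF M) (hN : IsPermRF N) :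
    IsPermRF (M.tens N) := by
  obtain ⟨S, ⟨e⟩⟩ := isPermRF_iff.1 hM
  obtain ⟨T, ⟨d⟩⟩ := isPermRF_iff.1 hN
  exact isPermRF_iff.2 ⟨S.tens T, ⟨linTens S T ≪≫ tensIso e d⟩⟩

end Bimod

namespace Bimod

variable {k : Type u} [CommRing k] {H G K L J : FinGpd}

lemma tensMap_comp_left {M M' M'' : Bimod k H G} (N : Bimod k K H) (φ : M ⟶ M') (φ' : M' ⟶ M'') :
    tensMap (φ ≫ φ') (𝟙 N) = tensMap φ (𝟙 N) ≫ tensMap φ' (𝟙 N) := by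
  rw [← tensMap_comp, Category.comp_id]

lemma tensMap_comp_right {N N' N'' : Bimod k K H} (M : Bimod k H G) (φ : N ⟶ N') (φ' : N' ⟶ N'') :
    tensMap (𝟙 M) (φ ≫ φ') = tensMap (𝟙 M) φ ≫ tensMap (𝟙 M) φ' := by
  rw [← tensMap_comp, Category.comp_id]

lemma assocM_nat₁ {P P' : Bimod k G L} (M : Bimod k H G) (N : Bimod k K H) (φ : P ⟶ P') :
    tensMap φ (𝟙 (tens M N)) =
      (assocM P M N).hom ≫ tensMap (tensMap φ (𝟙 M)) (𝟙 N) ≫ (assocM P' M N).inv :=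
  tens_hom_ext₃ fun _ _ _ _ _ _ _ => by simp

lemma assocM_nat₂ {M M' : Bimod k H G} (P : Bimod k G L) (N : Bimod k K H) (φ : M ⟶ M') :
    tensMap (𝟙 P) (tensMap φ (𝟙 N)) =
      (assocM P M N).hom ≫ tensMap (tensMap (𝟙 P) φ) (𝟙 N) ≫ (assocM P M' N).inv :=
  tens_hom_ext₃ fun _ _ _ _ _ _ _ => by simp

lemma assocM_nat₃ {N N' : Bimod k K H} (P : Bimod k G L) (M : Bimod k H G) (φ : N ⟶ N') :
    tensMap (𝟙 (tens P M)) φ =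
      (assocM P M N).inv ≫ tensMap (𝟙 P) (tensMap (𝟙 M) φ) ≫ (assocM P M N').hom :=
  tens_hom_ext₃' fun _ _ _ _ _ _ _ => by simp

lemma tensMap_exchange {M M' : Bimod k H G} {N N' : Bimod k K H} (φ : M ⟶ M') (ψ : N ⟶ N') :
    tensMap (𝟙 M) ψ ≫ tensMap φ (𝟙 N') = tensMap φ (𝟙 N) ≫ tensMap (𝟙 M') ψ := by
  simp only [← tensMap_comp, Category.comp_id, Category.id_comp]

lemma assocM_pentagon (Q : Bimod k L J) (P : Bimod k G L) (M : Bimod k H G) (N : Bimod k K H) :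
    tensMap (𝟙 Q) (assocM P M N).hom ≫ (assocM Q (tens P M) N).hom ≫
      tensMap (assocM Q P M).hom (𝟙 N) =
    (assocM Q P (tens M N)).hom ≫ (assocM (tens Q P) M N).hom := by
  have : Epi (tensMap (𝟙 Q) (assocM P M N).inv) :=
    inferInstanceAs (Epi (tensIso (Iso.refl Q) (assocM P M N).symm).hom)
  refine (cancel_epi (tensMap (𝟙 Q) (assocM P M N).inv)).1 (tens_hom_ext fun z x y q n => ?_)
  induction n using tens_ind with
  | zero => simp
  | add a b ha hb => simp only [map_add, ha, hb]
  | mk w m n =>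
    induction m using tens_ind with
    | zero => simp
    | add a b ha hb => simp only [map_add, LinearMap.add_apply, ha, hb]
    | mk w p m => simp

lemma assocM_triangle (M : Bimod k H G) (N : Bimod k K H) :
    (assocM M (lin k (RFBiset.idB H)) N).hom ≫ tensMap (unitRM M).hom (𝟙 N) =
      tensMap (𝟙 M) (unitLM N).hom := by
  refine (cancel_epi (assocM M (lin k (RFBiset.idB H)) N).inv).1 (tens_hom_ext fun z x y q n => ?_)
  induction q using tens_ind with
  | zero => simp
  | add a b ha hb => simp only [map_add, LinearMap.add_apply, ha, hb]
  | mk w m g =>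
    have := bas_ext (f := (ap ((assocM M (lin k (RFBiset.idB H)) N).inv ≫
      (assocM M (lin k (RFBiset.idB H)) N).hom ≫ tensMap (unitRM M).hom (𝟙 N)) z x) ∘ₗ
        mk.flip n ∘ₗ mk m) (g := (ap ((assocM M (lin k (RFBiset.idB H)) N).inv ≫
          tensMap (𝟙 M) (unitLM N).hom) z x) ∘ₗ mk.flip n ∘ₗ mk m)
      fun s => by simp [unitRM, unitLM, mk_balance]
    exact LinearMap.congr_fun this g

lemma add_tensMap {M M' : Bimod k H G} {N N' : Bimod k K H} (φ φ' : M ⟶ M') (ψ : N ⟶ N') :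
    tensMap (φ + φ') ψ = tensMap φ ψ + tensMap φ' ψ :=
  tens_hom_ext fun _ _ _ _ _ => by simp

lemma tensMap_add {M M' : Bimod k H G} {N N' : Bimod k K H} (φ : M ⟶ M') (ψ ψ' : N ⟶ N') :
    tensMap φ (ψ + ψ') = tensMap φ ψ + tensMap φ ψ' :=
  tens_hom_ext fun _ _ _ _ _ => by simp

lemma zero_tensMap {M M' : Bimod k H G} {N N' : Bimod k K H} (ψ : N ⟶ N') :
    tensMap (0 : M ⟶ M') ψ = 0 :=
  tens_hom_ext fun _ _ _ _ _ => by simp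

lemma tensMap_zero {M M' : Bimod k H G} {N N' : Bimod k K H} (φ : M ⟶ M') :
    tensMap φ (0 : N ⟶ N') = 0 :=
  tens_hom_ext fun _ _ _ _ _ => by simp

lemma smul_tensMap {M M' : Bimod k H G} {N N' : Bimod k K H} (c : k) (φ : M ⟶ M') (ψ : N ⟶ N') :
    tensMap (c • φ) ψ = c • tensMap φ ψ :=
  tens_hom_ext fun _ _ _ _ _ => by simp

lemma tensMap_smul {M M' : Bimod k H G} {N N' : Bimod k K H} (c : k) (φ : M ⟶ M') (ψ : N ⟶ N') :
    tensMap φ (c • ψ) = c • tensMap φ ψ :=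
  tens_hom_ext fun _ _ _ _ _ => by simp

end Bimod

/-- The objects of the bicategory of right-free permutation bimodules: finite groupoids. -/
structure PermRF (k : Type u) : Type 1 where
  gpd : FinGpd

namespace PermRF

open Yoshida.Bimod

variable {k : Type u} [CommRing k]

/-- The 1-cells `H ⟶ G`: right-free permutation `G,H`-bimodules. -/
structure Cell (H G : PermRF k) : Type (u + 1) where
  bimod : Bimod k H.gpd G.gpd
  perm : IsPermRF bimod

/-- The 2-cells: equivariant maps. -/
noncomputable instance (H G : PermRF k) : Category.{u} (Cell H G) where
  Hom M N := M.bimod ⟶ N.bimod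
  id M := 𝟙 M.bimod
  comp φ ψ := NatTrans.vcomp φ ψ

noncomputable instance (H G : PermRF k) : Preadditive (Cell H G) where
  homGroup M N := inferInstanceAs (AddCommGroup (M.bimod ⟶ N.bimod))
  add_comp M N P φ φ' ψ := Preadditive.add_comp M.bimod N.bimod P.bimod φ φ' ψ
  comp_add M N P φ ψ ψ' := Preadditive.comp_add M.bimod N.bimod P.bimod φ ψ ψ'

noncomputable instance (H G : PermRF k) : Linear k (Cell H G) where
  homModule M N := inferInstanceAs (Module k (M.bimod ⟶ N.bimod))
  smul_comp M N P c φ ψ := Linear.smul_comp M.bimod N.bimod P.bimod c φ ψ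
  comp_smul M N P φ c ψ := Linear.comp_smul M.bimod N.bimod P.bimod φ c ψ

/-- An isomorphism of bimodules as an isomorphism of 1-cells. -/
def isoMk {H G : PermRF k} {M N : Cell H G} (e : M.bimod ≅ N.bimod) : M ≅ N where
  hom := e.hom
  inv := e.inv
  hom_inv_id := e.hom_inv_id
  inv_hom_id := e.inv_hom_id

/-- The bicategory of finite groupoids, right-free permutation bimodules and equivariant maps. -/
noncomputable instance : Bicategory.{u, u + 1} (PermRF k) where
  Hom H G := Cell H G
  id G := ⟨lin k (RFBiset.idB G.gpd), isPermRF_lin _⟩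
  comp M N := ⟨tens N.bimod M.bimod, N.perm.tens M.perm⟩
  homCategory H G := inferInstanceAs (Category.{u} (Cell H G))
  whiskerLeft M _ _ φ := tensMap φ (𝟙 M.bimod)
  whiskerRight φ N := tensMap (𝟙 N.bimod) φ
  associator M N P := isoMk (assocM P.bimod N.bimod M.bimod)
  leftUnitor M := isoMk (unitRM M.bimod)
  rightUnitor M := isoMk (unitLM M.bimod)
  whiskerLeft_id _ _ := tensMap_id _ _
  whiskerLeft_comp _ _ _ _ _ _ := tensMap_comp_left _ _ _
  id_whiskerLeft φ := by
    rw [← Category.assoc]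
    exact (Iso.eq_comp_inv (unitRM _)).2 (unitRM_nat φ).symm
  comp_whiskerLeft _ _ _ _ _ := assocM_nat₁ _ _ _
  id_whiskerRight _ _ := tensMap_id _ _
  comp_whiskerRight _ _ _ := tensMap_comp_right _ _ _
  whiskerRight_id φ := by
    rw [← Category.assoc]
    exact (Iso.eq_comp_inv (unitLM _)).2 (unitLM_nat φ).symm
  whiskerRight_comp _ _ _ := assocM_nat₃ _ _ _
  whisker_assoc _ _ _ _ _ := assocM_nat₂ _ _ _
  whisker_exchange s t := (tensMap_exchange t s).symm
  pentagon _ _ _ _ := assocM_pentagon _ _ _ _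
  triangle _ _ := assocM_triangle _ _

end PermRF

/-! ### Sums over fibers -/

lemma finsum_fiber_sigma {ι A : Type*} {β : ι → Type*} [AddCommMonoid A] [Finite ι]
    [∀ i, Finite (β i)] (f : (Σ i, β i) → A) : ∑ᶠ p, f p = ∑ᶠ i, ∑ᶠ j, f ⟨i, j⟩ := by
  have := Fintype.ofFinite ι
  have := fun i => Fintype.ofFinite (β i)
  simp only [finsum_eq_sum_of_fintype, Fintype.sum_sigma]

lemma finsum_fiber_sum {ι κ A : Type*} [AddCommMonoid A] [Finite ι] [Finite κ] (f : ι ⊕ κ → A) :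
    ∑ᶠ p, f p = ∑ᶠ i, f (Sum.inl i) + ∑ᶠ j, f (Sum.inr j) := by
  have := Fintype.ofFinite ι
  have := Fintype.ofFinite κ
  simp only [finsum_eq_sum_of_fintype, Fintype.sum_sum_type]

lemma map_finsum_fiber {k : Type*} [CommRing k] {ι A B : Type*} [AddCommGroup A] [AddCommGroup B]
    [Module k A] [Module k B] [Finite ι] (φ : A →ₗ[k] B) (f : ι → A) :
    φ (∑ᶠ i, f i) = ∑ᶠ i, φ (f i) :=
  AddMonoidHom.map_finsum φ.toAddMonoidHom (Set.toFinite _)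

namespace Bimod

variable {k : Type u} [CommRing k] {H G K L : FinGpd}

/-- The value of the sum-over-fibers map on a basis element: `u ↦ ∑ r(w)`, the sum being over
the fiber of `l` over `u`. -/
noncomputable def fibSum (k : Type u) [CommRing k] {U V W : RFBiset H G} (l : W ⟶ U) (r : W ⟶ V)
    {y : H} {x : G} (u : U.E y x) : (lin k V).E y x :=
  ∑ᶠ w : {w : W.E y x // RFBiset.ap l w = u}, bas (RFBiset.ap r w.1)

lemma fibSum_eq {U V W : RFBiset H G} {l : W ⟶ U} {r : W ⟶ V} {y : H} {x : G} {u : U.E y x}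
    {ι : Type*} (f : ι → W.E y x) (inj : Function.Injective f)
    (h1 : ∀ i, RFBiset.ap l (f i) = u) (h2 : ∀ w, RFBiset.ap l w = u → ∃ i, f i = w) :
    fibSum k l r u = ∑ᶠ i, bas (RFBiset.ap r (f i)) := by
  let F : ι → {w : W.E y x // RFBiset.ap l w = u} := fun i => ⟨f i, h1 i⟩
  have hF : Function.Bijective F :=
    ⟨fun i j e => inj (congrArg Subtype.val e), fun w =>
      (h2 w.1 w.2).imp fun i hi => Subtype.ext hi⟩
  exact (finsum_eq_of_bijective F hF fun i => rfl).symm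

lemma fibSum_act {U V W : RFBiset H G} (l : W ⟶ U) (r : W ⟶ V) {y y' : H} {x x' : G}
    (h : y' ⟶ y) (g : x ⟶ x') (u : U.E y x) :
    fibSum k l r (U.act h g u) = (lin k V).act h g (fibSum k l r u) := by
  rw [fibSum_eq (ι := {w : W.E y x // RFBiset.ap l w = u}) (fun w => W.act h g w.1), fibSum,
    map_finsum_fiber]
  · simp
  · intro w w' e
    have := congrArg (W.act (Groupoid.inv h) (Groupoid.inv g)) e
    exact Subtype.ext (by simpa using this)
  · rintro ⟨w, rfl⟩; simp
  · intro w hw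
    exact ⟨⟨W.act (Groupoid.inv h) (Groupoid.inv g) w, by simp [hw]⟩, by simp⟩

/-- The sum-over-fibers map `k[U] ⟶ k[V]` of a span `U ⇐ W ⇒ V`. -/
noncomputable def sumFib (k : Type u) [CommRing k] {U V W : RFBiset H G} (l : W ⟶ U) (r : W ⟶ V) :
    lin k U ⟶ lin k V :=
  homMk (fun _ _ => linLift fun u => fibSum k l r u)
    (fun h g => bas_ext fun u => by simp [fibSum_act])

@[simp] lemma sumFib_bas {U V W : RFBiset H G} (l : W ⟶ U) (r : W ⟶ V) {y : H} {x : G}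
    (u : U.E y x) : ap (sumFib k l r) y x (bas u) = fibSum k l r u := by simp [sumFib]

lemma sumFib_comp {U V W A B P : RFBiset H G} {l : A ⟶ U} {r : A ⟶ V} {l' : B ⟶ V}
    {r' : B ⟶ W} {a : P ⟶ A} {b : P ⟶ B} (h : RFBiset.IsPB a b r l') :
    sumFib k (a ≫ l) (b ≫ r') = sumFib k l r ≫ sumFib k l' r' := by
  refine lin_hom_ext fun y x u => ?_
  rw [ap_comp, sumFib_bas, sumFib_bas]
  conv_rhs => rw [fibSum, map_finsum_fiber]
  simp only [sumFib_bas]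
  have e := finsum_fiber_sigma (ι := {w : A.E y x // RFBiset.ap l w = u})
    (β := fun w => {w' : B.E y x // RFBiset.ap l' w' = RFBiset.ap r w.1})
    (fun p => (bas (RFBiset.ap r' p.2.1) : (lin k W).E y x))
  refine Eq.trans ?_ e
  choose q hq1 hq2 using fun (p : Σ w : {w : A.E y x // RFBiset.ap l w = u},
    {w' : B.E y x // RFBiset.ap l' w' = RFBiset.ap r w.1}) => h.lift p.1.1 p.2.1 p.2.2.symm
  rw [fibSum_eq q]
  · simp [hq2]
  · rintro ⟨⟨w, hw⟩, ⟨w', hw'⟩⟩ ⟨⟨v, hv⟩, ⟨v', hv'⟩⟩ e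
    have e1 := congrArg (fun p => RFBiset.ap a p) e
    have e2 := congrArg (fun p => RFBiset.ap b p) e
    simp only [hq1, hq2] at e1 e2
    subst e1 e2
    rfl
  · intro i; simp [hq1, i.1.2]
  · intro w hw
    exact ⟨⟨⟨RFBiset.ap a w, hw⟩, ⟨RFBiset.ap b w, (h.comm w).symm⟩⟩,
      h.inj _ _ (hq1 _) (hq2 _)⟩

lemma sumFib_congr {U V W W' : RFBiset H G} (e : W ≅ W') (l : W' ⟶ U) (r : W' ⟶ V) :
    sumFib k (e.hom ≫ l) (e.hom ≫ r) = sumFib k l r := by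
  refine lin_hom_ext fun y x u => ?_
  rw [sumFib_bas, sumFib_bas, fibSum_eq (l := l)
    (ι := {w : W.E y x // RFBiset.ap (e.hom ≫ l) w = u}) (fun w => RFBiset.ap e.hom w.1)]
  · simp [fibSum]
  · exact fun w w' h => Subtype.ext ((RFBiset.ap_bijective e y x).1 h)
  · exact fun w => w.2
  · intro w hw
    obtain ⟨v, rfl⟩ := (RFBiset.ap_bijective e y x).2 w
    exact ⟨⟨v, hw⟩, rfl⟩

lemma sumFib_desc {U V A B : RFBiset H G} (l : A ⟶ U) (r : A ⟶ V) (l' : B ⟶ U) (r' : B ⟶ V) :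
    sumFib k (RFBiset.descB l l') (RFBiset.descB r r') = sumFib k l r + sumFib k l' r' := by
  refine lin_hom_ext fun y x u => ?_
  rw [ap_add, LinearMap.add_apply, sumFib_bas, sumFib_bas, sumFib_bas]
  have e := finsum_fiber_sum (ι := {w : A.E y x // RFBiset.ap l w = u})
    (κ := {w : B.E y x // RFBiset.ap l' w = u})
    (Sum.elim (fun w => (bas (RFBiset.ap r w.1) : (lin k V).E y x))
      (fun w => bas (RFBiset.ap r' w.1)))
  refine Eq.trans ?_ e
  rw [fibSum_eq (W := RFBiset.sumB A B) (l := RFBiset.descB l l')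
    (ι := {w : A.E y x // RFBiset.ap l w = u} ⊕ {w : B.E y x // RFBiset.ap l' w = u})
    (Sum.elim (fun w => RFBiset.ap (RFBiset.inlB A B) w.1)
      (fun w => RFBiset.ap (RFBiset.inrB A B) w.1))]
  · refine finsum_congr ?_
    rintro (w | w) <;> rfl
  · rintro (w | w) (w' | w') e
    · exact congrArg Sum.inl (Subtype.ext (Sum.inl_injective e))
    · exact (Sum.inl_ne_inr e).elim
    · exact (Sum.inr_ne_inl e).elim
    · exact congrArg Sum.inr (Subtype.ext (Sum.inr_injective e))
  · rintro (w | w)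
    · exact w.2
    · exact w.2
  · intro w
    induction w using RFBiset.sumB_ind with
    | hl w => exact fun h => ⟨Sum.inl ⟨w, h⟩, rfl⟩
    | hr w => exact fun h => ⟨Sum.inr ⟨w, h⟩, rfl⟩

lemma sumFib_empty {U V W : RFBiset H G} (h : ∀ y x, W.E y x → False) (l : W ⟶ U) (r : W ⟶ V) :
    sumFib k l r = 0 := by
  refine lin_hom_ext fun y x u => ?_
  have : IsEmpty {w : W.E y x // RFBiset.ap l w = u} := ⟨fun w => h y x w.1⟩
  rw [sumFib_bas, fibSum, finsum_of_isEmpty]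
  rfl

lemma fibSum_id {U V : RFBiset H G} (φ : U ⟶ V) {y : H} {x : G} (u : U.E y x) :
    fibSum k (𝟙 U) φ u = bas (RFBiset.ap φ u) := by
  rw [fibSum_eq (ι := Unit) (fun _ => u)]
  · exact finsum_unique _
  · exact fun _ _ _ => rfl
  · exact fun _ => rfl
  · exact fun w h => ⟨(), h.symm⟩

lemma fibSum_tensLeft {V V' A : RFBiset H G} (T : RFBiset K H) (l : A ⟶ V) (r : A ⟶ V')
    {z : K} {x : G} {y : H} (v : V.E y x) (t : T.E z y) :
    ap (linTens V' T).hom z x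
      (fibSum k (RFBiset.tensMap l (𝟙 T)) (RFBiset.tensMap r (𝟙 T)) (RFBiset.tmk v t)) =
      mk (fibSum k l r v) (bas t) := by
  rw [fibSum_eq (W := RFBiset.tens A T) (ι := {w : A.E y x // RFBiset.ap l w = v})
    (fun w => RFBiset.tmk w.1 t), map_finsum_fiber, fibSum]
  · have := map_finsum_fiber (mk.flip (bas t) : (lin k V').E y x →ₗ[k] (tens (lin k V') (lin k T)).E z x)
      (fun w : {w : A.E y x // RFBiset.ap l w = v} => bas (RFBiset.ap r w.1))
    refine Eq.trans ?_ this.symm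
    simp
  · rintro ⟨w, hw⟩ ⟨w', hw'⟩ e
    obtain ⟨g, e1, e2⟩ := RFBiset.tmk_eq_iff.1 e
    dsimp only at e1
    obtain rfl : g = 𝟙 y := V.eq_id (s := v) (by
      have := congrArg (fun w => RFBiset.ap l w) e1
      simp only [RFBiset.ap_act, hw, hw'] at this
      exact this.symm)
    exact Subtype.ext (by simpa using e1)
  · rintro ⟨w, rfl⟩; rfl
  · intro w
    induction w using RFBiset.tens_ind with
    | h y' w t' =>
      intro e
      obtain ⟨g, e1, e2⟩ := RFBiset.tmk_eq_iff.1 e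
      refine ⟨⟨A.act (Groupoid.inv g) (𝟙 x) w, by simp [e1]⟩, ?_⟩
      rw [RFBiset.tmk_balance]
      simp [← e2]

lemma fibSum_tensRight {V V' A : RFBiset K H} (T : RFBiset H G) (l : A ⟶ V) (r : A ⟶ V')
    {z : K} {x : G} {y : H} (t : T.E y x) (v : V.E z y) :
    ap (linTens T V').hom z x
      (fibSum k (RFBiset.tensMap (𝟙 T) l) (RFBiset.tensMap (𝟙 T) r) (RFBiset.tmk t v)) =
      mk (bas t) (fibSum k l r v) := by
  rw [fibSum_eq (W := RFBiset.tens T A) (ι := {w : A.E z y // RFBiset.ap l w = v})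
    (fun w => RFBiset.tmk t w.1), map_finsum_fiber, fibSum]
  · have := map_finsum_fiber (mk (bas t) : (lin k V').E z y →ₗ[k] (tens (lin k T) (lin k V')).E z x)
      (fun w : {w : A.E z y // RFBiset.ap l w = v} => bas (RFBiset.ap r w.1))
    refine Eq.trans ?_ this.symm
    simp
  · rintro ⟨w, hw⟩ ⟨w', hw'⟩ e
    obtain ⟨g, e1, e2⟩ := RFBiset.tmk_eq_iff.1 e
    obtain rfl : g = 𝟙 y := T.eq_id (s := t) e1.symm
    exact Subtype.ext (by simpa using e2)
  · rintro ⟨w, rfl⟩; rfl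
  · intro w
    induction w using RFBiset.tens_ind with
    | h y' t' w =>
      intro e
      obtain ⟨g, e1, e2⟩ := RFBiset.tmk_eq_iff.1 e
      refine ⟨⟨A.act (𝟙 z) g w, by simpa using e2⟩, ?_⟩
      have e1 : t' = T.act g (𝟙 x) t := e1
      rw [← RFBiset.tmk_balance, e1]

end Bimod

/-- The sum-over-fibers map of an isomorphism class of spans, as an additive map. -/
noncomputable def RFBiset.SpanCls.toLin (k : Type u) [CommRing k] {H G : FinGpd}
    (U V : RFBiset H G) : SpanCls U V →+ (Bimod.lin k U ⟶ Bimod.lin k V) where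
  toFun := Quotient.lift (fun s => Bimod.sumFib k s.l s.r) (by
    rintro ⟨A, l, r⟩ ⟨A', l', r'⟩ ⟨e, h1, h2⟩
    dsimp only at e h1 h2
    subst h1 h2
    exact Bimod.sumFib_congr e l' r')
  map_zero' := Bimod.sumFib_empty (W := emptyB H G) (fun _ _ s => Empty.elim s) _ _
  map_add' s t := by
    induction s using SpanCls.ind with
    | h A l r =>
    induction t using SpanCls.ind with
    | h B l' r' => exact Bimod.sumFib_desc l r l' r'

namespace Bimod

variable {k : Type u} [CommRing k] {H G K L : FinGpd}

open RFBiset (SpanCls)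

lemma toLin_mk {U V W : RFBiset H G} (l : W ⟶ U) (r : W ⟶ V) :
    SpanCls.toLin k U V (SpanCls.mk l r) = sumFib k l r := rfl

lemma toLin_comp {U V W : RFBiset H G} (s : SpanCls U V) (t : SpanCls V W) :
    SpanCls.toLin k U W (SpanCls.comp s t) = SpanCls.toLin k U V s ≫ SpanCls.toLin k V W t := by
  induction s using SpanCls.ind with
  | h A l r =>
  induction t using SpanCls.ind with
  | h B l' r' => exact sumFib_comp (RFBiset.isPB_pb r l')

lemma ap_toLin_emb {U V : RFBiset H G} (φ : U ⟶ V) {y : H} {x : G} (u : U.E y x) :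
    ap (SpanCls.toLin k U V (SpanCls.emb φ)) y x (bas u) = bas (RFBiset.ap φ u) :=
  (sumFib_bas _ _ _).trans (fibSum_id φ u)

lemma toLin_id (U : RFBiset H G) : SpanCls.toLin k U U (SpanCls.emb (𝟙 U)) = 𝟙 (lin k U) :=
  lin_hom_ext fun _ _ u => ap_toLin_emb _ u

lemma toLin_whL {V V' : RFBiset H G} (T : RFBiset K H) (s : SpanCls V V') :
    SpanCls.toLin k _ _ (SpanCls.whL T s) ≫ (linTens V' T).hom =
      (linTens V T).hom ≫ tensMap (SpanCls.toLin k V V' s) (𝟙 (lin k T)) := by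
  induction s using SpanCls.ind with
  | h A l r =>
    refine lin_hom_ext fun z x q => ?_
    induction q using RFBiset.tens_ind with
    | h y v t =>
      simp only [SpanCls.whL_mk, toLin_mk, ap_comp, sumFib_bas, fibSum_tensLeft, linTens_hom_bas,
        ap_tensMap, ap_id, LinearMap.id_apply]

lemma toLin_whR {V V' : RFBiset K H} (T : RFBiset H G) (s : SpanCls V V') :
    SpanCls.toLin k _ _ (SpanCls.whR T s) ≫ (linTens T V').hom =
      (linTens T V).hom ≫ tensMap (𝟙 (lin k T)) (SpanCls.toLin k V V' s) := by
  induction s using SpanCls.ind with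
  | h A l r =>
    refine lin_hom_ext fun z x q => ?_
    induction q using RFBiset.tens_ind with
    | h y t v =>
      simp only [SpanCls.whR_mk, toLin_mk, ap_comp, sumFib_bas, fibSum_tensRight, linTens_hom_bas,
        ap_tensMap, ap_id, LinearMap.id_apply]

lemma toLin_assoc (U : RFBiset G L) (T : RFBiset H G) (S : RFBiset K H) :
    SpanCls.toLin k _ _ (SpanCls.emb (RFBiset.assocB U T S).hom) =
      (linTens U (RFBiset.tens T S)).hom ≫ tensMap (𝟙 (lin k U)) (linTens T S).hom ≫
        (assocM (lin k U) (lin k T) (lin k S)).hom ≫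
          tensMap (linTens U T).inv (𝟙 (lin k S)) ≫ (linTens (RFBiset.tens U T) S).inv := by
  refine lin_hom_ext fun z x q => ?_
  induction q using RFBiset.tens_ind with
  | h y u p =>
    induction p using RFBiset.tens_ind with
    | h w t s =>
      rw [ap_toLin_emb]
      simp [RFBiset.assocB]

lemma toLin_unitR (T : RFBiset H G) :
    SpanCls.toLin k _ _ (SpanCls.emb (RFBiset.unitR T).hom) =
      (linTens T (RFBiset.idB H)).hom ≫ (unitRM (lin k T)).hom := by
  refine lin_hom_ext fun z x q => ?_
  induction q using RFBiset.tens_ind with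
  | h y t s =>
    rw [ap_toLin_emb]
    simp [RFBiset.unitR, unitRM]

lemma toLin_unitL (T : RFBiset H G) :
    SpanCls.toLin k _ _ (SpanCls.emb (RFBiset.unitL T).hom) =
      (linTens (RFBiset.idB G) T).hom ≫ (unitLM (lin k T)).hom := by
  refine lin_hom_ext fun z x q => ?_
  induction q using RFBiset.tens_ind with
  | h y t s =>
    rw [ap_toLin_emb]
    simp [RFBiset.unitL, unitLM]

end Bimod

/-! ### The linearization pseudo-functor -/

/-- The image of a 2-cell of the `k`-linearized bicategory of spans: the `k`-linear extension of
the sum-over-fibers construction. -/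
noncomputable def linMap₂ (k : Type u) [CommRing k] {X Y : KLin k BisetHat}
    (U V : KLin.Cell X Y) : (U ⟶ V) →ₗ[k] (Bimod.lin k (H := X.as.gpd) (G := Y.as.gpd) U.as ⟶
      Bimod.lin k (H := X.as.gpd) (G := Y.as.gpd) V.as) :=
  kExt.lift (SpanCls.toLin k (H := X.as.gpd) (G := Y.as.gpd) U.as V.as)

section

variable {k : Type u} [CommRing k] {X Y Z : KLin k BisetHat}

lemma linMap₂_of {U V : KLin.Cell X Y} (s : U.as ⟶ V.as) :
    linMap₂ k U V (KLin.of s) = SpanCls.toLin k (H := X.as.gpd) (G := Y.as.gpd) U.as V.as s :=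
  kExt.lift_of _ _

lemma linMap₂_comp {U V W : KLin.Cell X Y} (s : U ⟶ V) (t : V ⟶ W) :
    linMap₂ k U W (s ≫ t) = linMap₂ k U V s ≫ linMap₂ k V W t := by
  induction s using KLin.ind with
  | zero => simp
  | add s s' hs hs' => simp only [map_add, Preadditive.add_comp, hs, hs']
  | smul c s hs => simp only [map_smul, Linear.smul_comp, hs]
  | of s =>
  induction t using KLin.ind with
  | zero => simp
  | add s s' hs hs' => simp only [map_add, Preadditive.comp_add, hs, hs']
  | smul c s hs => simp only [map_smul, Linear.comp_smul, hs]
  | of t =>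
    rw [← KLin.of_comp, linMap₂_of, linMap₂_of, linMap₂_of]
    exact Bimod.toLin_comp (H := X.as.gpd) (G := Y.as.gpd) s t

lemma linMap₂_wL (S : KLin.Cell X Y) {U V : KLin.Cell Y Z} (s : U ⟶ V) :
    linMap₂ k _ _ (KLin.wL S s) ≫ (Bimod.linTens (K := X.as.gpd) (H := Y.as.gpd) (G := Z.as.gpd)
      V.as S.as).hom = (Bimod.linTens (K := X.as.gpd) (H := Y.as.gpd) (G := Z.as.gpd)
      U.as S.as).hom ≫ Bimod.tensMap (linMap₂ k U V s) (𝟙 _) := by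
  induction s using KLin.ind with
  | zero => simp only [map_zero, Limits.zero_comp, Limits.comp_zero, Bimod.zero_tensMap]
  | add s s' hs hs' => simp only [map_add, Preadditive.add_comp, Preadditive.comp_add, hs, hs',
      Bimod.add_tensMap]
  | smul c s hs => simp only [map_smul, Linear.smul_comp, Linear.comp_smul, hs,
      Bimod.smul_tensMap]
  | of s =>
    rw [KLin.wL_of, linMap₂_of, linMap₂_of]
    exact Bimod.toLin_whL (K := X.as.gpd) (H := Y.as.gpd) (G := Z.as.gpd) S.as s

lemma linMap₂_wR (S : KLin.Cell Y Z) {U V : KLin.Cell X Y} (s : U ⟶ V) :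
    linMap₂ k _ _ (KLin.wR S s) ≫ (Bimod.linTens (K := X.as.gpd) (H := Y.as.gpd) (G := Z.as.gpd)
      S.as V.as).hom = (Bimod.linTens (K := X.as.gpd) (H := Y.as.gpd) (G := Z.as.gpd)
      S.as U.as).hom ≫ Bimod.tensMap (𝟙 _) (linMap₂ k U V s) := by
  induction s using KLin.ind with
  | zero => simp only [map_zero, Limits.zero_comp, Limits.comp_zero, Bimod.tensMap_zero]
  | add s s' hs hs' => simp only [map_add, Preadditive.add_comp, Preadditive.comp_add, hs, hs',
      Bimod.tensMap_add]
  | smul c s hs => simp only [map_smul, Linear.smul_comp, Linear.comp_smul, hs,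
      Bimod.tensMap_smul]
  | of s =>
    rw [KLin.wR_of, linMap₂_of, linMap₂_of]
    exact Bimod.toLin_whR (K := X.as.gpd) (H := Y.as.gpd) (G := Z.as.gpd) S.as s

end

/-- The `k`-linear pseudo-functor from the `k`-linearized bicategory of right-free bisets and spans
to the bicategory of right-free permutation bimodules: the identity on objects, `U ↦ k[U]` on
1-cells, and the `k`-linear extension of sum-over-fibers on 2-cells. -/
noncomputable def P (k : Type u) [CommRing k] : Pseudofunctor (KLin k BisetHat) (PermRF k) where
  obj X := ⟨X.as.gpd⟩
  map {X Y} U := ⟨Bimod.lin k (H := X.as.gpd) (G := Y.as.gpd) U.as, Bimod.isPermRF_lin _⟩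
  map₂ {X Y U V} s := linMap₂ k U V s
  map₂_id {X Y} U := (linMap₂_of (k := k) (𝟙 U.as)).trans
    (Bimod.toLin_id (H := X.as.gpd) (G := Y.as.gpd) U.as)
  map₂_comp s t := linMap₂_comp s t
  mapId X := Iso.refl _
  mapComp {X Y Z} S T := PermRF.isoMk (Bimod.linTens (K := X.as.gpd) (H := Y.as.gpd)
    (G := Z.as.gpd) T.as S.as)
  map₂_whisker_left {X Y Z} S U V s := by
    refine Eq.trans ((Iso.eq_comp_inv _).2 (linMap₂_wL S s)) (Category.assoc _ _ _)
  map₂_whisker_right {X Y Z U V} s S := by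
    refine Eq.trans ((Iso.eq_comp_inv _).2 (linMap₂_wR S s)) (Category.assoc _ _ _)
  map₂_associator {W X Y Z} S T U := (linMap₂_of (k := k) _).trans
    (Bimod.toLin_assoc (K := W.as.gpd) (H := X.as.gpd) (G := Y.as.gpd) (L := Z.as.gpd)
      U.as T.as S.as)
  map₂_left_unitor {X Y} T := by
    refine (linMap₂_of (k := k) _).trans ((Bimod.toLin_unitR (H := X.as.gpd) (G := Y.as.gpd)
      T.as).trans ?_)
    refine congrArg ((Bimod.linTens (k := k) (K := X.as.gpd) (H := X.as.gpd) (G := Y.as.gpd)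
      T.as (idB X.as.gpd)).hom ≫ ·) ?_
    exact (congrArg (· ≫ (Bimod.unitRM _).hom) (Bimod.tensMap_id _ _)).symm
  map₂_right_unitor {X Y} T := by
    refine (linMap₂_of (k := k) _).trans ((Bimod.toLin_unitL (H := X.as.gpd) (G := Y.as.gpd)
      T.as).trans ?_)
    refine congrArg ((Bimod.linTens (k := k) (K := X.as.gpd) (H := Y.as.gpd) (G := Y.as.gpd)
      (idB Y.as.gpd) T.as).hom ≫ ·) ?_
    exact (congrArg (· ≫ (Bimod.unitLM _).hom) (Bimod.tensMap_id _ _)).symm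

noncomputable instance {k : Type u} [CommRing k] (X Y : KLin k BisetHat) : Preadditive (X ⟶ Y) :=
  inferInstanceAs (Preadditive (KLin.Cell X Y))

noncomputable instance {k : Type u} [CommRing k] (X Y : KLin k BisetHat) : Linear k (X ⟶ Y) :=
  inferInstanceAs (Linear k (KLin.Cell X Y))

noncomputable instance {k : Type u} [CommRing k] (X Y : PermRF k) : Preadditive (X ⟶ Y) :=
  inferInstanceAs (Preadditive (PermRF.Cell X Y))

noncomputable instance {k : Type u} [CommRing k] (X Y : PermRF k) : Linear k (X ⟶ Y) :=
  inferInstanceAs (Linear k (PermRF.Cell X Y))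

/-! ### Ideals of 2-cells and the cohomological 2-cells -/

/-- The `k`-linear bicategorical ideal generated by a class of 2-cells: the smallest class of
2-cells that contains it, is closed under `k`-linear combinations and under vertical composition
with arbitrary 2-cells, and under horizontal composition with arbitrary 2-cells (the horizontal
composite of `s : f ⟶ f'` and `t : g ⟶ g'` is `s ▷ g ≫ f' ◁ t : f ≫ g ⟶ f' ≫ g'`). -/
inductive IdealGen (k : Type*) [CommRing k] {B : Type*} [Bicategory B]
    [∀ a b : B, Preadditive (a ⟶ b)] [∀ a b : B, Linear k (a ⟶ b)]
    (gen : ∀ {a b : B} {f g : a ⟶ b}, (f ⟶ g) → Prop) :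
    ∀ {a b : B} {f g : a ⟶ b}, (f ⟶ g) → Prop
  | of {a b : B} {f g : a ⟶ b} {s : f ⟶ g} : gen s → IdealGen k gen s
  | zero {a b : B} (f g : a ⟶ b) : IdealGen k gen (0 : f ⟶ g)
  | add {a b : B} {f g : a ⟶ b} {s t : f ⟶ g} :
      IdealGen k gen s → IdealGen k gen t → IdealGen k gen (s + t)
  | smul {a b : B} {f g : a ⟶ b} (c : k) {s : f ⟶ g} : IdealGen k gen s → IdealGen k gen (c • s)
  | comp_left {a b : B} {f g h : a ⟶ b} (s : f ⟶ g) {t : g ⟶ h} :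
      IdealGen k gen t → IdealGen k gen (s ≫ t)
  | comp_right {a b : B} {f g h : a ⟶ b} {s : f ⟶ g} (t : g ⟶ h) :
      IdealGen k gen s → IdealGen k gen (s ≫ t)
  | hcomp_left {a b c : B} {f f' : a ⟶ b} {g g' : b ⟶ c} (s : f ⟶ f') {t : g ⟶ g'} :
      IdealGen k gen t → IdealGen k gen (s ▷ g ≫ f' ◁ t)
  | hcomp_right {a b c : B} {f f' : a ⟶ b} {g g' : b ⟶ c} {s : f ⟶ f'} (t : g ⟶ g') :
      IdealGen k gen s → IdealGen k gen (s ▷ g ≫ f' ◁ t)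

/-- A finite group as a finite groupoid with one object. -/
def FinGpd.ofGroup (G : Type) [Group G] [Finite G] : FinGpd where
  carrier := SingleObj G
  finite_obj := inferInstanceAs (Finite Unit)
  finite_hom _ _ := inferInstanceAs (Finite G)

/-- The `G,H`-biset `G(i-,-)` of a faithful functor `i : H ⥤ G`; for the inclusion of a subgroup
this is `G` with its left `G`-action and its right `H`-action. -/
def RFBiset.indB {H G : FinGpd} (i : H ⥤ G) [i.Faithful] : RFBiset H G :=
  ofAct (fun y x => (i.obj y ⟶ x)) (fun h g s => i.map h ≫ s ≫ g) (by simp) (by simp)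
    (fun s h e => i.map_injective (by simpa using congrArg (· ≫ Groupoid.inv s) e))

/-- The `H,G`-biset `G(-,i-)` of a functor `i : H ⥤ G`; for the inclusion of a subgroup
this is `G` with its left `H`-action and its right `G`-action. -/
def RFBiset.resB {H G : FinGpd} (i : H ⥤ G) : RFBiset G H :=
  ofAct (fun y x => (y ⟶ i.obj x)) (fun h g s => h ≫ s ≫ i.map g) (by simp) (by simp)
    (fun s h e => by simpa using congrArg (· ≫ Groupoid.inv s) e)

/-- The multiplication map `μ : G ×_H G ⟶ G`, `[g, g'] ↦ g · g'`. -/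
def RFBiset.mulB {H G : FinGpd} (i : H ⥤ G) [i.Faithful] :
    RFBiset.tens (RFBiset.indB i) (RFBiset.resB i) ⟶ RFBiset.idB G :=
  RFBiset.tensHom (fun {z x y} (g : i.obj y ⟶ x) (g' : z ⟶ i.obj y) => RFBiset.idB.of (g' ≫ g))
    (fun {z x y y'} (g : i.obj y ⟶ x) (h : y' ⟶ y) (g' : z ⟶ i.obj y') =>
      show g' ≫ i.map h ≫ g ≫ 𝟙 x = (𝟙 z ≫ g' ≫ i.map h) ≫ g by simp)
    (fun {z z' x x' y} (h : z' ⟶ z) (l : x ⟶ x') (g : i.obj y ⟶ x) (g' : z ⟶ i.obj y) =>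
      show (h ≫ g' ≫ i.map (𝟙 y)) ≫ i.map (𝟙 y) ≫ g ≫ l = h ≫ (g' ≫ g) ≫ l by simp)

/-- The inclusion of a subgroup, as a functor of one-object groupoids. -/
def FinGpd.incl {G : Type} [Group G] [Finite G] (H : Subgroup G) :
    FinGpd.ofGroup H ⥤ FinGpd.ofGroup G :=
  SingleObj.mapHom H G H.subtype

instance {G : Type} [Group G] [Finite G] (H : Subgroup G) : (FinGpd.incl H).Faithful where
  map_injective h := Subtype.val_injective h

/-- The cohomological 2-cell `[G ⇐ G ×_H G ⇒ G] - [G : H] · id` of a subgroup `H ≤ G`, an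
endomorphism of the identity 1-cell of `G`; both legs of the span are the multiplication map. -/
noncomputable def cohCell (k : Type u) [CommRing k] {G : Type} [Group G] [Finite G]
    (H : Subgroup G) :
    (𝟙 (⟨⟨FinGpd.ofGroup G⟩⟩ : KLin k BisetHat)) ⟶ 𝟙 (⟨⟨FinGpd.ofGroup G⟩⟩ : KLin k BisetHat) :=
  KLin.of (f := 𝟙 (⟨⟨FinGpd.ofGroup G⟩⟩ : KLin k BisetHat))
      (g := 𝟙 (⟨⟨FinGpd.ofGroup G⟩⟩ : KLin k BisetHat))
      (SpanCls.mk (RFBiset.mulB (FinGpd.incl H)) (RFBiset.mulB (FinGpd.incl H))) -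
    (H.index : k) • 𝟙 _

/-- The class of cohomological 2-cells, for all subgroups of finite groups. -/
inductive IsCoh (k : Type u) [CommRing k] :
    ∀ {X Y : KLin k BisetHat} {f g : X ⟶ Y}, (f ⟶ g) → Prop
  | mk {G : Type} [Group G] [Finite G] (H : Subgroup G) : IsCoh k (cohCell k H)

end Yoshida

/-! Fix right-free bisets `U` and `V`. An equivariant map `k[U] ⟶ k[V]` is a matrix of coefficients
indexed by the pairs `(u, v)` of points over the same objects, and equivariance says that the matrix
is constant on the orbits of `U × V` under the two-sided action. There are finitely many orbits, so
these maps form a free module on the set of orbits. An orbit with its two projections is itself a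
span from `U` to `V`, and summing over fibers sends it to the indicator matrix of the orbit
(`coeff_orbSpan`). The orbit spans therefore go to a basis. This gives fullness
(`linMap₂_surjective`). It also reduces the statement on the kernel to two facts: the cohomological
ideal is killed, and modulo this ideal every 2-cell is a linear combination of orbit spans
(`exists_idealGen_sub_sum`).

For the second fact, a span is the sum of its restrictions to the orbits of its apex, so the apex
`W` may be taken transitive. Its map to `U × V` then lands in a single orbit `R`, and the span
factors through `[R ⇐ W ⇒ R]`, both of whose legs are the same map `γ` (`SpanCls.mk_factor`). It
remains to see that such a span is a scalar modulo the ideal. Pick a point `w` of `W` over `(y, x)`,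
let `D` be the group of pairs `(g, h)` with `g · γ(w) = γ(w) · h`, and let `E ≤ D` be the same group
for `w`. Right-freeness makes the projection from `D` to the automorphisms of `x` injective, so
induction along it is a right-free 1-cell. By orbit-stabilizer, `R` is `G(x,-) ×_D D ×_D H(-,y)`,
`W` is `G(x,-) ×_D (D ×_E D) ×_D H(-,y)`, and `γ` is induced by the multiplication map `μ`
(`IsTransitive.exists_mulB`). Hence `[R ⇐ W ⇒ R] - [D : E] · id` is a whiskered and conjugated
cohomological 2-cell (`exists_idealGen_sub`).

For the first fact, the fibers of `μ : D ×_E D ⟶ D` are in bijection with `D / E`, so the generators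
go to zero (`toLin_mulB`), and linearity and compatibility with both compositions do the rest
(`linMap₂_eq_zero`). -/

namespace Yoshida

/-! ### Orbits of bisets, and decomposition of spans along the orbits of the apex. -/

namespace RFBiset

variable {H G : FinGpd}

/-- Two points of a biset are in the same orbit if the two-sided action moves one to the other. -/
def orbSetoid (W : RFBiset H G) : Setoid (Σ (y : H) (x : G), W.E y x) where
  r a b := ∃ (h : b.1 ⟶ a.1) (g : a.2.1 ⟶ b.2.1), W.act h g a.2.2 = b.2.2
  iseqv :=
    { refl := fun a => ⟨𝟙 _, 𝟙 _, by simp⟩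
      symm := by
        rintro ⟨y, x, a⟩ ⟨y', x', b⟩ ⟨h, g, e⟩
        dsimp only at h g e
        subst e
        exact ⟨Groupoid.inv h, Groupoid.inv g, by simp⟩
      trans := by
        rintro ⟨y, x, a⟩ ⟨y', x', b⟩ ⟨y'', x'', c⟩ ⟨h, g, e⟩ ⟨h', g', e'⟩
        dsimp only at h g e h' g' e'
        subst e
        subst e'
        exact ⟨h' ≫ h, g ≫ g', by simp⟩ }

/-- The orbits of a biset. -/
def Orb (W : RFBiset H G) : Type := Quotient W.orbSetoid

/-- The orbit of a point. -/
def cls {W : RFBiset H G} {y : H} {x : G} (w : W.E y x) : W.Orb :=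
  Quotient.mk W.orbSetoid ⟨y, x, w⟩

instance (W : RFBiset H G) : Finite W.Orb := Quotient.finite _

lemma cls_eq_iff {W : RFBiset H G} {y y' : H} {x x' : G} {a : W.E y x} {b : W.E y' x'} :
    cls a = cls b ↔ ∃ (h : y' ⟶ y) (g : x ⟶ x'), W.act h g a = b :=
  Quotient.eq (r := W.orbSetoid)

@[simp] lemma cls_act {W : RFBiset H G} {y y' : H} {x x' : G} (h : y' ⟶ y) (g : x ⟶ x')
    (w : W.E y x) : cls (W.act h g w) = cls w :=
  (cls_eq_iff.2 ⟨h, g, rfl⟩).symm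

lemma cls_surj {W : RFBiset H G} (o : W.Orb) : ∃ (y : H) (x : G) (w : W.E y x), cls w = o := by
  obtain ⟨⟨y, x, w⟩, rfl⟩ := Quotient.exists_rep o
  exact ⟨y, x, w, rfl⟩

/-- The union of the orbits that satisfy a predicate. -/
def sub (W : RFBiset H G) (q : W.Orb → Prop) : RFBiset H G :=
  ofAct (fun y x => {w : W.E y x // q (cls w)})
    (fun h g w => ⟨W.act h g w.1, by rw [cls_act]; exact w.2⟩)
    (fun w => Subtype.ext (by simp)) (fun h g h' g' w => Subtype.ext (by simp))
    (fun w h e => W.eq_id (congrArg Subtype.val e))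

/-- The inclusion of a union of orbits. -/
def incl (W : RFBiset H G) (q : W.Orb → Prop) : W.sub q ⟶ W :=
  homMk (fun _ _ w => w.1) (fun _ _ _ => rfl)

/-- A map whose image lies in a union of orbits. -/
def corestrict {W R : RFBiset H G} (q : R.Orb → Prop) (φ : W ⟶ R)
    (h : ∀ {y : H} {x : G} (w : W.E y x), q (cls (ap φ w))) : W ⟶ R.sub q :=
  homMk (fun _ _ w => ⟨ap φ w, h w⟩) (fun _ _ _ => Subtype.ext (ap_act ..))

lemma incl_injective {W : RFBiset H G} {q : W.Orb → Prop} {y : H} {x : G}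
    {a b : (W.sub q).E y x} (e : ap (W.incl q) a = ap (W.incl q) b) : a = b := Subtype.ext e

/-- Unions of orbits are stable under the action, so a partition of a set of orbits is a disjoint
union of bisets. This is the form in which `SpanCls.mk_add_mk` turns it into an addition of spans.
-/
lemma isSum_sub {W : RFBiset H G} {q q₁ q₂ : W.Orb → Prop} (h : ∀ o, q o ↔ q₁ o ∨ q₂ o)
    (hd : ∀ o, q₁ o → ¬ q₂ o) :
    IsSum (corestrict q (W.incl q₁) fun w => (h _).2 (Or.inl w.2))
      (corestrict q (W.incl q₂) fun w => (h _).2 (Or.inr w.2)) where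
  cover s := ((h _).1 s.2).imp (fun h => ⟨⟨s.1, h⟩, rfl⟩) (fun h => ⟨⟨s.1, h⟩, rfl⟩)
  inj₁ a b e := incl_injective (congrArg (fun s => ap (W.incl q) s) e)
  inj₂ a b e := incl_injective (congrArg (fun s => ap (W.incl q) s) e)
  disj a b e := hd _ a.2 (by
    have e : a.1 = b.1 := congrArg Subtype.val e
    rw [e]; exact b.2)

/-- Addition of spans is only binary, so the decomposition is made for an arbitrary finite set of
orbits, which can grow one orbit at a time. -/
lemma SpanCls.mk_sub_eq_sum {U V W : RFBiset H G} (l : W ⟶ U) (r : W ⟶ V) (s : Finset W.Orb) :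
    SpanCls.mk (W.incl (· ∈ s) ≫ l) (W.incl (· ∈ s) ≫ r) =
      ∑ o ∈ s, SpanCls.mk (W.incl (· = o) ≫ l) (W.incl (· = o) ≫ r) := by
  classical
  induction s using Finset.induction_on with
  | empty => exact SpanCls.mk_eq_zero (fun y x w => by simpa using w.2) _ _
  | insert a s ha ih =>
    rw [Finset.sum_insert ha, ← ih, ← SpanCls.mk_add_mk (isSum_sub (q := (· ∈ insert a s))
      (q₁ := (· = a)) (q₂ := (· ∈ s)) (fun o => Finset.mem_insert) (by rintro o rfl; exact ha))]
    rfl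

/-- A span is the sum of its restrictions to the orbits of its apex. -/
lemma SpanCls.mk_eq_sum {U V W : RFBiset H G} [Fintype W.Orb] (l : W ⟶ U) (r : W ⟶ V) :
    SpanCls.mk l r = ∑ o, SpanCls.mk (W.incl (· = o) ≫ l) (W.incl (· = o) ≫ r) := by
  rw [← SpanCls.mk_sub_eq_sum]
  symm
  -- For the set of all orbits the inclusion is bijective, so restricting to it does not change the
  -- class of the span.
  refine SpanCls.mk_eq (isoOfBijective (W.incl _) fun y x => ⟨fun a b => incl_injective, ?_⟩)
    rfl rfl
  exact fun w => ⟨⟨w, Finset.mem_univ _⟩, rfl⟩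

/-! ### Products of bisets, orbit spans, and the factorization of a span through an orbit. -/

/-- The pointwise product of bisets. -/
def prodB (U V : RFBiset H G) : RFBiset H G :=
  ofAct (fun y x => U.E y x × V.E y x) (fun h g w => (U.act h g w.1, V.act h g w.2))
    (by simp) (by simp) (fun _ _ e => U.eq_id (congrArg Prod.fst e))

def fstB (U V : RFBiset H G) : prodB U V ⟶ U := homMk (fun _ _ w => w.1) (fun _ _ _ => rfl)

def sndB (U V : RFBiset H G) : prodB U V ⟶ V := homMk (fun _ _ w => w.2) (fun _ _ _ => rfl)

/-- The map to a product with given components. -/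
def pairB {W U V : RFBiset H G} (l : W ⟶ U) (r : W ⟶ V) : W ⟶ prodB U V :=
  homMk (fun _ _ w => (ap l w, ap r w)) (fun _ _ _ => Prod.ext (ap_act ..) (ap_act ..))

/-- A pair of points, as a point of the product. -/
def pair {U V : RFBiset H G} {y : H} {x : G} (u : U.E y x) (v : V.E y x) : (prodB U V).E y x :=
  (u, v)

lemma pair_act {U V : RFBiset H G} {y y' : H} {x x' : G} (h : y' ⟶ y) (g : x ⟶ x')
    (u : U.E y x) (v : V.E y x) :
    (prodB U V).act h g (pair u v) = pair (U.act h g u) (V.act h g v) := rfl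

/-- The span given by an orbit of `U × V`. -/
def orbSpan {U V : RFBiset H G} (o : (prodB U V).Orb) : SpanCls U V :=
  SpanCls.mk ((prodB U V).incl (· = o) ≫ fstB U V) ((prodB U V).incl (· = o) ≫ sndB U V)

/-- The biset has exactly one orbit. -/
def IsTransitive (W : RFBiset H G) {y : H} {x : G} (w : W.E y x) : Prop :=
  ∀ (y' : H) (x' : G) (w' : W.E y' x'), ∃ (h : y' ⟶ y) (g : x ⟶ x'), W.act h g w = w'

lemma isTransitive_sub {W : RFBiset H G} {y : H} {x : G} (w : W.E y x) {o : W.Orb}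
    (ho : cls w = o) : (W.sub (· = o)).IsTransitive (y := y) (x := x) ⟨w, ho⟩ := by
  rintro y' x' ⟨w', h'⟩
  obtain ⟨h, g, e⟩ := cls_eq_iff.1 (ho.trans h'.symm)
  exact ⟨h, g, Subtype.ext e⟩

/-- Both pullbacks are along identities. The lemma isolates `[R ⇐ W ⇒ R]`, the only part of the span
that depends on `W`; if that part is a scalar, the span is the same scalar times `[U ⇐ R ⇒ V]`. -/
lemma SpanCls.mk_factor {U V W R : RFBiset H G} (γ : W ⟶ R) (l : R ⟶ U) (r : R ⟶ V) :
    SpanCls.mk (γ ≫ l) (γ ≫ r) =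
      SpanCls.comp (SpanCls.mk l (𝟙 R)) (SpanCls.comp (SpanCls.mk γ γ) (SpanCls.emb r)) := by
  rw [SpanCls.mk_comp_emb, SpanCls.mk_comp_mk (SpanCls.isPB_id' γ), Category.id_comp]

/-! ### Stabilizers, and isomorphisms between transitive bisets. -/

/-- The pairs `(g, h)` of automorphisms such that `g · w = w · h`. -/
def stab (W : RFBiset H G) {y : H} {x : G} (w : W.E y x) : Subgroup (End x × End y) where
  carrier := {d | W.act (𝟙 y) d.1 w = W.act d.2 (𝟙 x) w}
  one_mem' := rfl
  -- `(a a') · w = a · (w · h') = (a · w) · h' = w · (h h')`. Comparing a left with a right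
  -- translate, instead of asking that `g · w · h = w`, gives a subgroup of the product with no
  -- opposite group.
  mul_mem' := by
    rintro ⟨a, h⟩ ⟨a', h'⟩ e e'
    have e : W.act (𝟙 y) a w = W.act h (𝟙 x) w := e
    have e' : W.act (𝟙 y) a' w = W.act h' (𝟙 x) w := e'
    have e1 := congrArg (W.act (𝟙 y) a) e'
    have e2 := congrArg (W.act h' (𝟙 x)) e
    simp only [act_act, Category.comp_id, Category.id_comp] at e1 e2
    exact e1.trans e2
  inv_mem' := by
    rintro ⟨a, h⟩ e
    have e : W.act (𝟙 y) a w = W.act h (𝟙 x) w := e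
    have e1 := congrArg (W.act (Groupoid.inv h) (Groupoid.inv a)) e
    simp only [act_act, Groupoid.inv_comp, Category.comp_id, Category.id_comp] at e1
    have e2 : (a : x ⟶ x) ≫ Groupoid.inv a = 𝟙 x := Groupoid.comp_inv _
    rw [e2] at e1
    exact e1.symm

instance (y : H) (x : G) : Finite (End x × End y) :=
  inferInstanceAs (Finite ((x ⟶ x) × (y ⟶ y)))

/-- The first projection from a group of pairs of automorphisms, as a functor. -/
def fstF {y : H} {x : G} (D : Subgroup (End x × End y)) : FinGpd.ofGroup D ⥤ G :=
  SingleObj.functor (X := x) ((MonoidHom.fst _ _).comp D.subtype)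

/-- The second projection from a group of pairs of automorphisms, as a functor. -/
def sndF {y : H} {x : G} (D : Subgroup (End x × End y)) : FinGpd.ofGroup D ⥤ H :=
  SingleObj.functor (X := y) ((MonoidHom.snd _ _).comp D.subtype)

/-- Over a right-free biset, a pair in a stabilizer is determined by its first component. -/
instance (R : RFBiset H G) {y : H} {x : G} (r : R.E y x) : (fstF (R.stab r)).Faithful where
  map_injective {a b} d d' e := by
    have h1 : (d : R.stab r).1.1 = (d' : R.stab r).1.1 := e
    have h2 := (d : R.stab r).2
    have h3 := (d' : R.stab r).2
    -- If `(g, h)` and `(g, h')` both lie in the stabilizer, then `r · h = g · r = r · h'`, and `h =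
    -- h'` by freeness of the right action.
    refine Subtype.ext (Prod.ext h1 (R.eq_of_act (x := x) (s := r) ?_))
    refine h2.symm.trans (Eq.trans ?_ h3)
    rw [h1]

/-- Transitive bisets with points that have the same stabilizer are isomorphic. -/
lemma IsTransitive.exists_iso {T W : RFBiset H G} {y : H} {x : G} {τ : T.E y x} {w : W.E y x}
    (hT : T.IsTransitive τ) (hW : W.IsTransitive w)
    (h : ∀ (h : y ⟶ y) (g : x ⟶ x), T.act h g τ = τ ↔ W.act h g w = w) :
    ∃ e : T ≅ W, ap e.hom τ = w := by
  -- Two pairs move a base point to the same place exactly when their quotient fixes it, so the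
  -- hypothesis on stabilizers says that `τ` and `w` have the same coincidences everywhere.
  have key : ∀ {y' : H} {x' : G} (a b : y' ⟶ y) (c d : x ⟶ x'),
      T.act a c τ = T.act b d τ ↔ W.act a c w = W.act b d w := by
    intro y' x' a b c d
    have aux : ∀ {S : RFBiset H G} (s : S.E y x), S.act a c s = S.act b d s ↔
        S.act (Groupoid.inv b ≫ a) (c ≫ Groupoid.inv d) s = s := by
      intro S s
      constructor
      · intro e
        simpa using congrArg (S.act (Groupoid.inv b) (Groupoid.inv d)) e
      · intro e
        simpa using congrArg (S.act b d) e
    rw [aux, aux, h]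
  have hT' := hT
  unfold IsTransitive at hT'
  -- For each point `t` of `T`, a pair that carries `τ` to `t` is chosen; the isomorphism applies
  -- this pair to `w`. By `key` the result does not depend on the choice (`hf`), which gives
  -- equivariance, and read backwards `key` gives injectivity.
  choose a c hac using hT'
  have hf : ∀ {y' : H} {x' : G} (b : y' ⟶ y) (d : x ⟶ x'),
      W.act (a _ _ (T.act b d τ)) (c _ _ (T.act b d τ)) w = W.act b d w := fun b d =>
    (key _ _ _ _).1 (hac _ _ _)
  refine ⟨isoOfBijective (homMk (fun y' x' t => W.act (a _ _ t) (c _ _ t) w) ?_) fun y' x' => ⟨?_, ?_⟩, ?_⟩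
  · intro y' y'' x' x'' b d t
    obtain ⟨b', d', rfl⟩ := hT _ _ t
    rw [hf, act_act, act_act, hf]
  · intro s t e
    rw [← hac _ _ s, ← hac _ _ t]
    exact (key _ _ _ _).2 e
  · intro t
    obtain ⟨b, d, rfl⟩ := hW _ _ t
    exact ⟨T.act b d τ, hf b d⟩
  · have := hf (𝟙 y) (𝟙 x)
    simp only [act_id] at this
    exact this

/-- Equivariant maps out of a transitive biset that agree at its base point are equal. -/
lemma IsTransitive.hom_ext {T W : RFBiset H G} {y : H} {x : G} {τ : T.E y x}
    (hT : T.IsTransitive τ) {φ ψ : T ⟶ W} (e : ap φ τ = ap ψ τ) : φ = ψ := by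
  ext y' x' t
  obtain ⟨b, d, rfl⟩ := hT _ _ t
  rw [ap_act, ap_act, e]

/-! ### The bisets `G(x,-) ×_D X ×_D H(-,y)` for a group `D` of pairs of automorphisms. -/

/-- The object of the one-object groupoid of a group. -/
abbrev pt (D : Type) [Group D] [Finite D] : FinGpd.ofGroup D := SingleObj.star D

/-- An element of a group as a morphism. -/
def arr {D : Type} [Group D] [Finite D] (d : D) : pt D ⟶ pt D := d

lemma exists_arr {D : Type} [Group D] [Finite D] (f : pt D ⟶ pt D) : ∃ d : D, arr d = f :=
  ⟨f, rfl⟩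

section

variable {y : H} {x : G} (D : Subgroup (End x × End y))

/-- The elements of `H(-, y)`, as elements of the restriction biset. -/
def resOf {y' : H} (s : y' ⟶ y) : (resB (sndF D)).E y' (pt D) := s

/-- `D` acts on `H(-, y)` on the left, through the second components of its elements. -/
lemma resOf_act {y' y'' : H} (s : y' ⟶ y) (h : y'' ⟶ y') (d : D) :
    (resB (sndF D)).act h (arr d) (resOf D s) = resOf D (h ≫ s ≫ (show y ⟶ y from d.1.2)) := rfl

variable [(fstF D).Faithful]

/-- The elements of `G(x, -)`, as elements of the induction biset. -/
def indOf {x' : G} (t : x ⟶ x') : (indB (fstF D)).E (pt D) x' := t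

/-- `D` acts on `G(x, -)` on the right, through the first components. This action is free only if
the first projection is injective, which is why faithfulness is assumed for `fstF D` and not for
`sndF D`. -/
lemma indOf_act {x' x'' : G} (t : x ⟶ x') (g : x' ⟶ x'') (d : D) :
    (indB (fstF D)).act (arr d) g (indOf D t) = indOf D ((show x ⟶ x from d.1.1) ≫ t ≫ g) := rfl

variable {X : RFBiset (FinGpd.ofGroup D) (FinGpd.ofGroup D)} (ξ : X.E (pt D) (pt D))

/-- The base point `[1, [ξ, 1]]` of `G ×_D X ×_D H`. -/
def basePt : (tens (indB (fstF D)) (tens X (resB (sndF D)))).E y x :=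
  tmk (indOf D (𝟙 x)) (tmk ξ (resOf D (𝟙 y)))

/-- The two outer factors absorb the two-sided action and leave `ξ` alone: `g · [1, [ξ, 1]] · h =
[g, [ξ, h]]`. -/
lemma act_basePt {y' : H} {x' : G} (h : y' ⟶ y) (g : x ⟶ x') :
    (tens (indB (fstF D)) (tens X (resB (sndF D)))).act h g (basePt D ξ) =
      tmk (indOf D g) (tmk ξ (resOf D h)) := by
  have e1 := indOf_act D (𝟙 x) g 1
  have e2 := resOf_act D (𝟙 y) h 1
  have e3 : (show x ⟶ x from (1 : D).1.1) = 𝟙 x := rfl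
  have e4 : (show y ⟶ y from (1 : D).1.2) = 𝟙 y := rfl
  rw [e3, Category.id_comp, Category.id_comp] at e1
  rw [e4, Category.comp_id, Category.comp_id] at e2
  exact congrArg₂ tmk e1 (congrArg₂ tmk (act_id X ξ) e2)

lemma isTransitive_basePt {ξ : X.E (pt D) (pt D)} (hξ : X.IsTransitive ξ) :
    (tens (indB (fstF D)) (tens X (resB (sndF D)))).IsTransitive (basePt D ξ) := by
  intro y' x' q
  induction q using tens_ind with
  | h a t q =>
  induction q using tens_ind with
  | h b q s =>
  obtain ⟨d', d, rfl⟩ := hξ _ _ q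
  obtain ⟨t, rfl⟩ : ∃ t' : x ⟶ x', indOf D t' = t := ⟨t, rfl⟩
  obtain ⟨s, rfl⟩ : ∃ s' : y' ⟶ y, resOf D s' = s := ⟨s, rfl⟩
  obtain ⟨d', rfl⟩ := exists_arr d'
  obtain ⟨d, rfl⟩ := exists_arr d
  -- A general point is `[t, [d · ξ · d', s]]`. Balancing moves `d` to the left factor and `d'` to
  -- the right one, which gives `[t · d, [ξ, d' · s]]`, and `act_basePt` applies to that.
  refine ⟨s ≫ (show y ⟶ y from d'.1.2), (show x ⟶ x from d.1.1) ≫ t, ?_⟩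
  have e1 := indOf_act D t (𝟙 _) d
  have e2 := resOf_act D s (𝟙 _) d'
  rw [Category.comp_id] at e1
  rw [Category.id_comp] at e2
  rw [act_basePt, ← e1, ← e2, ← tmk_balance ξ, tmk_balance (indOf D t), tens_act, act_act,
    act_id, Category.id_comp, Category.id_comp]
  rfl

/-- The stabilizer of the base point. -/
lemma act_basePt_eq_iff (h : y ⟶ y) (g : x ⟶ x) :
    (tens (indB (fstF D)) (tens X (resB (sndF D)))).act h g (basePt D ξ) = basePt D ξ ↔
      ∃ d d' : D, d.1.1 = g ∧ h ≫ d'.1.2 = 𝟙 y ∧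
        X.act (𝟙 _) (arr d) ξ = X.act (arr d') (𝟙 _) ξ := by
  have e1 (d : D) := indOf_act D (𝟙 x) (𝟙 x) d
  have e2 (d : D) := resOf_act D h (𝟙 y) d
  simp only [Category.comp_id, Category.id_comp] at e1 e2
  -- An equality `[g, [ξ, h]] = [1, [ξ, 1]]` is witnessed by one element of `D` for each tensor
  -- sign: `d` satisfies `g = d.1.1` and `[d · ξ, h] = [ξ, 1]`, and `d'` witnesses this second
  -- equality.
  rw [act_basePt, basePt, tmk_eq_iff]
  constructor
  · rintro ⟨d, h1, h2⟩
    obtain ⟨d, rfl⟩ := exists_arr d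
    rw [tens_act, act_id, tmk_eq_iff] at h2
    obtain ⟨d', h3, h4⟩ := h2
    obtain ⟨d', rfl⟩ := exists_arr d'
    exact ⟨d, d', (h1.trans (e1 d)).symm, (e2 d').symm.trans h4, h3⟩
  · rintro ⟨d, d', rfl, h1, h2⟩
    refine ⟨arr d, (e1 d).symm, ?_⟩
    rw [tens_act, act_id, tmk_eq_iff]
    exact ⟨arr d', h2, (e2 d').trans h1⟩

/-- A transitive biset is of the form `G ×_D X ×_D H`, as soon as `X` is a transitive `D,D`-biset
with the right stabilizer. -/
lemma IsTransitive.exists_iso_basePt {W : RFBiset H G} {w : W.E y x} (hW : W.IsTransitive w)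
    (hD : W.stab w ≤ D) {ξ : X.E (pt D) (pt D)} (hξ : X.IsTransitive ξ)
    (hX : ∀ d d' : D, X.act (𝟙 _) (arr d) ξ = X.act (arr d') (𝟙 _) ξ ↔ d = d' ∧ d.1 ∈ W.stab w) :
    ∃ e : tens (indB (fstF D)) (tens X (resB (sndF D))) ≅ W, ap e.hom (basePt D ξ) = w := by
  refine (isTransitive_basePt D hξ).exists_iso hW fun h g => ?_
  rw [act_basePt_eq_iff]
  constructor
  · rintro ⟨d, d', rfl, h1, h2⟩
    obtain ⟨rfl, hd⟩ := (hX d d').1 h2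
    have hd : W.act (𝟙 y) d.1.1 w = W.act d.1.2 (𝟙 x) w := hd
    simpa [h1] using congrArg (W.act h (𝟙 x)) hd
  · intro e
    -- The equation `g · w · h = w` is rewritten as `g · w = w · h⁻¹`. The resulting pair serves
    -- both as `d` and as `d'`.
    have hd : ((show End x from g), (show End y from Groupoid.inv h)) ∈ W.stab w := by
      have := congrArg (W.act (Groupoid.inv h) (𝟙 x)) e
      simp only [act_act, Groupoid.inv_comp, Category.comp_id] at this
      exact this
    exact ⟨⟨_, hD hd⟩, ⟨_, hD hd⟩, rfl, Groupoid.comp_inv h, (hX _ _).2 ⟨rfl, hd⟩⟩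

end

/-! ### The `D,D`-bisets `D` and `D ×_E D` for a subgroup `E ≤ D`. -/

section

variable {D : Type} [Group D] [Finite D] (E : Subgroup D)

lemma isTransitive_idB : (idB (FinGpd.ofGroup D)).IsTransitive (idB.of (arr (1 : D))) := by
  intro y x d
  obtain ⟨d, rfl⟩ : ∃ d' : D, idB.of (arr d') = d := ⟨d, rfl⟩
  refine ⟨arr 1, arr d, ?_⟩
  -- Composition in the one-object groupoid is multiplication in reverse order, so `h ≫ s ≫ g` is `g
  -- * s * h`, the usual two-sided action.
  have e : (idB (FinGpd.ofGroup D)).act (arr 1) (arr d) (idB.of (arr 1)) =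
    idB.of (arr (d * 1 * 1)) := rfl
  rw [mul_one, mul_one] at e
  exact e

/-- In the identity biset, `d · 1 = 1 · d'` forces `d = d'` and nothing else. This is the case of
`IsTransitive.exists_iso_basePt` in which `D` is the whole stabilizer. -/
lemma act_idB_eq_iff (d d' : D) :
    (idB (FinGpd.ofGroup D)).act (𝟙 _) (arr d) (idB.of (arr 1)) =
      (idB (FinGpd.ofGroup D)).act (arr d') (𝟙 _) (idB.of (arr 1)) ↔ d = d' := by
  have e1 : (idB (FinGpd.ofGroup D)).act (𝟙 _) (arr d) (idB.of (arr 1)) =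
    idB.of (arr (d * 1 * 1)) := rfl
  have e2 : (idB (FinGpd.ofGroup D)).act (arr d') (𝟙 _) (idB.of (arr 1)) =
    idB.of (arr (1 * 1 * d')) := rfl
  rw [e1, e2, mul_one, mul_one, mul_one, one_mul]
  exact ⟨fun h => h, fun h => congrArg (fun d => idB.of (arr d)) h⟩

/-- The element `[g, h]` of `D ×_E D`. -/
def mulMk (g h : D) : (tens (indB (FinGpd.incl E)) (resB (FinGpd.incl E))).E (pt D) (pt D) :=
  tmk (y := pt E) (show (indB (FinGpd.incl E)).E (pt E) (pt D) from arr g)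
    (show (resB (FinGpd.incl E)).E (pt D) (pt E) from arr h)

lemma mulB_mulMk (g h : D) : ap (mulB (FinGpd.incl E)) (mulMk E g h) = idB.of (arr (g * h)) := rfl

lemma act_mulMk (g h d d' : D) :
    (tens (indB (FinGpd.incl E)) (resB (FinGpd.incl E))).act (arr d') (arr d) (mulMk E g h) =
      mulMk E (d * g) (h * d') := by
  have e : (tens (indB (FinGpd.incl E)) (resB (FinGpd.incl E))).act (arr d') (arr d)
    (mulMk E g h) = mulMk E (d * g * 1) (1 * h * d') := rfl
  rw [e, mul_one, one_mul]

/-- The balancing relation of `D ×_E D` in terms of group elements: `[g' e, h] = [g', e h]` for `e`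
in `E`. The factors `1` in the proof come from the identity morphisms in the two actions. -/
lemma mulMk_eq_iff (g h g' h' : D) :
    mulMk E g h = mulMk E g' h' ↔ ∃ e : D, e ∈ E ∧ g = g' * e ∧ e * h = h' := by
  refine tmk_eq_iff.trans ⟨?_, ?_⟩
  · rintro ⟨e, e1, e2⟩
    obtain ⟨e, rfl⟩ := exists_arr e
    have e1 : g = 1 * g' * e := e1
    have e2 : e * h * 1 = h' := e2
    exact ⟨e.1, e.2, by simpa using e1, by simpa using e2⟩
  · rintro ⟨e, he, e1, e2⟩
    refine ⟨arr ⟨e, he⟩, ?_, ?_⟩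
    · exact (by simpa using e1 : g = 1 * g' * e)
    · exact (by simpa using e2 : e * h * 1 = h')

lemma exists_mulMk {y x : FinGpd.ofGroup D}
    (q : (tens (indB (FinGpd.incl E)) (resB (FinGpd.incl E))).E y x) :
    ∃ g h : D, mulMk E g h = q := by
  induction q using tens_ind with
  | h b t s => exact ⟨t, s, rfl⟩

lemma isTransitive_mulMk :
    (tens (indB (FinGpd.incl E)) (resB (FinGpd.incl E))).IsTransitive (mulMk E 1 1) := by
  intro y x q
  obtain ⟨g, h, rfl⟩ := exists_mulMk E q
  have e := act_mulMk E 1 1 g h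
  rw [mul_one, one_mul] at e
  exact ⟨arr h, arr g, e⟩

/-- `[d, 1] = [1, d']` needs an element `e` of `E` with `d = e` and `e = d'`. The point `[1, 1]`
thus has the diagonal copy of `E` as stabilizer, so `D ×_E D` models a transitive biset whose
stabilizer is the subgroup `E` of `D`. -/
lemma act_mulMk_eq_iff (d d' : D) :
    (tens (indB (FinGpd.incl E)) (resB (FinGpd.incl E))).act (𝟙 _) (arr d) (mulMk E 1 1) =
      (tens (indB (FinGpd.incl E)) (resB (FinGpd.incl E))).act (arr d') (𝟙 _) (mulMk E 1 1) ↔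
          d = d' ∧ d ∈ E := by
  have e1 := act_mulMk E 1 1 d 1
  have e2 := act_mulMk E 1 1 1 d'
  refine (Eq.congr e1 e2).trans ((mulMk_eq_iff ..).trans ?_)
  constructor
  · rintro ⟨e, he, h1, h2⟩
    simp only [mul_one, one_mul] at h1 h2
    subst h1 h2
    exact ⟨rfl, he⟩
  · rintro ⟨rfl, h⟩
    exact ⟨d, h, by simp, by simp⟩

end

/-! ### Maps between transitive bisets as induced multiplication maps. -/

/-- An equivariant map between transitive bisets comes from the multiplication map of a subgroup
of a finite group by induction and restriction. -/
lemma IsTransitive.exists_mulB {W R : RFBiset H G} (γ : W ⟶ R) {y : H} {x : G} {w : W.E y x}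
    (hW : W.IsTransitive w) (hR : R.IsTransitive (ap γ w)) :
    ∃ (D : Subgroup (End x × End y)) (_ : (fstF D).Faithful) (E : Subgroup D)
      (e : tens (indB (fstF D)) (tens (idB _) (resB (sndF D))) ≅ R)
      (c : tens (indB (fstF D)) (tens (tens (indB (FinGpd.incl E)) (resB (FinGpd.incl E)))
        (resB (sndF D))) ≅ W),
      c.hom ≫ γ = tensMap (𝟙 _) (tensMap (mulB (FinGpd.incl E)) (𝟙 _)) ≫ e.hom := by
  -- An equivariant map can only enlarge stabilizers, so the stabilizer of `w` is a subgroup of `D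
  -- := R.stab (ap γ w)`; this subgroup is the `E` of the conclusion.
  have hle : W.stab w ≤ R.stab (ap γ w) := by
    intro d hd
    have hd : W.act (𝟙 y) d.1 w = W.act d.2 (𝟙 x) w := hd
    exact (ap_act γ _ _ _).symm.trans ((congrArg (ap γ) hd).trans (ap_act γ _ _ _))
  obtain ⟨e, he⟩ := hR.exists_iso_basePt (R.stab (ap γ w)) le_rfl isTransitive_idB
    fun d d' => (act_idB_eq_iff d d').trans ⟨fun h => ⟨h, d.2⟩, fun h => h.1⟩
  obtain ⟨c, hc⟩ := hW.exists_iso_basePt (R.stab (ap γ w)) hle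
    (isTransitive_mulMk ((W.stab w).subgroupOf (R.stab (ap γ w)))) fun d d' =>
      (act_mulMk_eq_iff _ d d').trans (and_congr_right fun _ => Subgroup.mem_subgroupOf)
  -- Maps out of a transitive biset are determined at one point. Both sides send `[1, [[1, 1], 1]]`
  -- to `γ(w)`, since `μ[1, 1] = 1`. Faithfulness of `fstF D` is the instance for stabilizers in the
  -- right-free biset `R`.
  refine ⟨_, inferInstance, _, e, c, (isTransitive_basePt _ (isTransitive_mulMk _)).hom_ext ?_⟩
  rw [ap_comp, hc, ap_comp]
  have h1 : ap (mulB (FinGpd.incl ((W.stab w).subgroupOf (R.stab (ap γ w))))) (mulMk _ 1 1) =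
      idB.of (arr 1) := (mulB_mulMk _ 1 1).trans (by rw [mul_one])
  exact he.symm.trans (congrArg (fun ξ => ap e.hom (basePt _ ξ)) h1.symm)

end RFBiset

open RFBiset

/-! ### Closure properties of ideals of 2-cells. -/

namespace IdealGen

variable {k : Type u} [CommRing k] {gen : ∀ {a b : KLin k BisetHat} {f g : a ⟶ b}, (f ⟶ g) → Prop}

lemma neg {a b : KLin k BisetHat} {f g : a ⟶ b} {s : f ⟶ g} (h : IdealGen k gen s) :
    IdealGen k gen (-s) := by
  have := h.smul (-1)
  rwa [neg_one_smul] at this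

lemma sub {a b : KLin k BisetHat} {f g : a ⟶ b} {s t : f ⟶ g} (hs : IdealGen k gen s)
    (ht : IdealGen k gen t) : IdealGen k gen (s - t) := by
  rw [sub_eq_add_neg]
  exact hs.add ht.neg

lemma sum {a b : KLin k BisetHat} {f g : a ⟶ b} {ι : Type*} (S : Finset ι) (s : ι → (f ⟶ g))
    (h : ∀ i ∈ S, IdealGen k gen (s i)) : IdealGen k gen (∑ i ∈ S, s i) := by
  classical
  induction S using Finset.induction_on with
  | empty => exact IdealGen.zero f g
  | insert i S hi ih =>
    rw [Finset.sum_insert hi]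
    exact (h i (Finset.mem_insert_self i S)).add
      (ih fun j hj => h j (Finset.mem_insert_of_mem hj))

/-- Whiskering is horizontal composition with an identity 2-cell, so the ideal is closed under it.
-/
lemma whiskerLeft {a b c : KLin k BisetHat} (f : a ⟶ b) {g g' : b ⟶ c} {t : g ⟶ g'}
    (h : IdealGen k gen t) : IdealGen k gen (f ◁ t) := by
  have := h.hcomp_left (𝟙 f)
  rwa [Bicategory.id_whiskerRight, Category.id_comp] at this

lemma whiskerRight {a b c : KLin k BisetHat} {f f' : a ⟶ b} (g : b ⟶ c) {t : f ⟶ f'}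
    (h : IdealGen k gen t) : IdealGen k gen (t ▷ g) := by
  have := h.hcomp_right (𝟙 g)
  rwa [Bicategory.whiskerLeft_id, Category.comp_id] at this

end IdealGen

/-! ### Reduction of 2-cells to orbit spans modulo the cohomological ideal. -/

section

variable {k : Type u} [CommRing k] {H G : FinGpd}

/-- A finite groupoid as an object of the linearized bicategory. -/
abbrev kobj (k : Type u) [CommRing k] (H : FinGpd) : KLin k BisetHat := ⟨⟨H⟩⟩

/-- A biset as a 1-cell of the linearized bicategory. -/
abbrev kcell (k : Type u) [CommRing k] (U : RFBiset H G) : kobj k H ⟶ kobj k G := ⟨U⟩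

/-- A span as a 2-cell of the linearized bicategory. -/
noncomputable def kspan (k : Type u) [CommRing k] {U V : RFBiset H G} (s : SpanCls U V) :
    kcell k U ⟶ kcell k V :=
  KLin.of (f := kcell k U) (g := kcell k V) s

lemma kspan_comp {U V W : RFBiset H G} (s : SpanCls U V) (t : SpanCls V W) :
    kspan k (SpanCls.comp s t) = kspan k s ≫ kspan k t :=
  KLin.of_comp (f := kcell k U) (g := kcell k V) (h := kcell k W) s t

lemma kspan_id (U : RFBiset H G) : kspan k (SpanCls.emb (𝟙 U)) = 𝟙 (kcell k U) := rfl

lemma kspan_sum {U V : RFBiset H G} {ι : Type*} (S : Finset ι) (s : ι → SpanCls U V) :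
    kspan k (∑ i ∈ S, s i) = ∑ i ∈ S, kspan k (s i) :=
  map_sum (kExt.of (k := k)) s S

lemma kspan_whiskerLeft {K : FinGpd} {U V : RFBiset H G} (T : RFBiset K H) (s : SpanCls U V) :
    kcell k T ◁ kspan k s = kspan k (SpanCls.whL T s) :=
  KLin.wL_of (kcell k T) (g := kcell k U) (h := kcell k V) s

lemma kspan_whiskerRight {K : FinGpd} {U V : RFBiset K H} (T : RFBiset H G) (s : SpanCls U V) :
    kspan k s ▷ kcell k T = kspan k (SpanCls.whR T s) :=
  KLin.wR_of (kcell k T) (f := kcell k U) (g := kcell k V) s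

/-- The cohomological 2-cells have the form `s - x • 𝟙`. Whiskering preserves this form, with the
same scalar. -/
lemma whiskerLeft_sub_smul {a b c : KLin k BisetHat} (f : a ⟶ b) {g : b ⟶ c} (s : g ⟶ g)
    (x : k) : f ◁ (s - x • 𝟙 g) = f ◁ s - x • 𝟙 (f ≫ g) := by
  refine (map_sub (KLin.wL f) s (x • 𝟙 g)).trans ?_
  rw [map_smul]
  exact congrArg (fun t => f ◁ s - x • t) (Bicategory.whiskerLeft_id f g)

lemma sub_smul_whiskerRight {a b c : KLin k BisetHat} {f : a ⟶ b} (s : f ⟶ f) (x : k)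
    (g : b ⟶ c) : (s - x • 𝟙 f) ▷ g = s ▷ g - x • 𝟙 (f ≫ g) := by
  refine (map_sub (KLin.wR g) s (x • 𝟙 f)).trans ?_
  rw [map_smul]
  exact congrArg (fun t => s ▷ g - x • t) (Bicategory.id_whiskerRight f g)

/-- Read as a congruence: if `s` is the scalar `x` modulo the ideal, then so is its whiskering by
`T`. With `idealGen_whR` it carries the relation for `E ≤ D` over to `G(x,-) ×_D - ×_D H(-,y)`. -/
lemma idealGen_whL {K : FinGpd} {U : RFBiset H G} (T : RFBiset K H) {s : SpanCls U U} {x : k}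
    (h : IdealGen k (IsCoh k) (kspan k s - x • 𝟙 (kcell k U))) :
    IdealGen k (IsCoh k) (kspan k (SpanCls.whL T s) - x • 𝟙 (kcell k (tens U T))) := by
  have e := whiskerLeft_sub_smul (kcell k T) (kspan k s) x
  rw [kspan_whiskerLeft] at e
  have h1 := h.whiskerLeft (kcell k T)
  exact (congrArg (fun t => IdealGen k (IsCoh k) t) e).mp h1

lemma idealGen_whR {K : FinGpd} {U : RFBiset K H} (T : RFBiset H G) {s : SpanCls U U} {x : k}
    (h : IdealGen k (IsCoh k) (kspan k s - x • 𝟙 (kcell k U))) :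
    IdealGen k (IsCoh k) (kspan k (SpanCls.whR T s) - x • 𝟙 (kcell k (tens T U))) := by
  have e := sub_smul_whiskerRight (kspan k s) x (kcell k T)
  rw [kspan_whiskerRight] at e
  have h1 := h.whiskerRight (kcell k T)
  exact (congrArg (fun t => IdealGen k (IsCoh k) t) e).mp h1

/-- A span with equal legs between transitive bisets is, modulo the cohomological ideal, a scalar
multiple of the identity. -/
lemma exists_idealGen_sub {W R : RFBiset H G} (γ : W ⟶ R) {y : H} {x : G} {w : W.E y x}
    (hW : W.IsTransitive w) (hR : R.IsTransitive (ap γ w)) :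
    ∃ c : k, IdealGen k (IsCoh k) (kspan k (SpanCls.mk γ γ) - c • 𝟙 (kcell k R)) := by
  obtain ⟨D, _, E, e, d, h⟩ := hW.exists_mulB γ hR
  -- The scalar is the index of the stabilizer of `w` in that of `γ(w)`.
  refine ⟨E.index, ?_⟩
  -- The cohomological 2-cell of `E` in `D`, restricted on the right to `H` and induced on the left
  -- to `G`. It is then conjugated by `e`, which leaves the scalar part unchanged and turns the span
  -- part into `[R ⇐ W ⇒ R]` (`h3`).
  have h1 := idealGen_whR (indB (fstF D)) (idealGen_whL (resB (sndF D))
    (IdealGen.of (IsCoh.mk (k := k) E)))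
  have h2 := (h1.comp_right (kspan k (SpanCls.emb e.hom))).comp_left (kspan k (SpanCls.emb e.inv))
  have hR : kspan k (SpanCls.emb e.inv) ≫ kspan k (SpanCls.emb e.hom) = 𝟙 (kcell k R) := by
    rw [← kspan_comp, ← SpanCls.emb_comp, e.inv_hom_id, kspan_id]
  have h3 := SpanCls.conj γ γ (tensMap (𝟙 (indB (fstF D))) (tensMap (mulB (FinGpd.incl E))
    (𝟙 (resB (sndF D))))) (tensMap (𝟙 (indB (fstF D))) (tensMap (mulB (FinGpd.incl E))
    (𝟙 (resB (sndF D))))) e.symm e.symm d.symm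
    ((Iso.inv_comp_eq _).2 (by rw [← Category.assoc, h]; simp))
    ((Iso.inv_comp_eq _).2 (by rw [← Category.assoc, h]; simp))
  rw [Preadditive.sub_comp, Preadditive.comp_sub, Linear.smul_comp, Linear.comp_smul,
    Category.id_comp, hR, ← kspan_comp, ← kspan_comp] at h2
  rw [h3]
  exact h2

/-- A span with transitive apex is, modulo the cohomological ideal, a scalar multiple of the span
given by an orbit of `U × V`. -/
lemma exists_idealGen_sub_orbSpan {U V W : RFBiset H G} (l : W ⟶ U) (r : W ⟶ V) {y : H} {x : G}
    {w : W.E y x} (hW : W.IsTransitive w) :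
    ∃ c : k, IdealGen k (IsCoh k) (kspan k (SpanCls.mk l r) -
      c • kspan k (orbSpan (cls (pair (ap l w) (ap r w))))) := by
  -- A transitive biset has its image in a single orbit of `U × V`, the one of the image of `w`.
  have hγ : ∀ {y' : H} {x' : G} (w' : W.E y' x'),
      cls (ap (pairB l r) w') = cls (pair (ap l w) (ap r w)) := by
    intro y' x' w'
    obtain ⟨h, g, rfl⟩ := hW _ _ w'
    rw [ap_act, cls_act]
    rfl
  obtain ⟨c, hc⟩ := exists_idealGen_sub (k := k) (corestrict (· = _) (pairB l r) hγ) hW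
    (isTransitive_sub _ (hγ w))
  refine ⟨c, ?_⟩
  -- Composing with the two outer factors of `SpanCls.mk_factor` turns the span on the orbit into
  -- the given span, and the identity of the orbit into the orbit span.
  have h := (hc.comp_right (kspan k (SpanCls.emb ((prodB U V).incl (· = _) ≫ sndB U V)))).comp_left
    (kspan k (SpanCls.mk ((prodB U V).incl (· = _) ≫ fstB U V) (𝟙 _)))
  have e := SpanCls.mk_factor (corestrict (· = _) (pairB l r) hγ)
    ((prodB U V).incl (· = _) ≫ fstB U V) ((prodB U V).incl (· = _) ≫ sndB U V)
  have e' : orbSpan (cls (pair (ap l w) (ap r w))) =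
      SpanCls.comp (SpanCls.mk ((prodB U V).incl (· = cls (pair (ap l w) (ap r w))) ≫ fstB U V)
        (𝟙 _)) (SpanCls.emb ((prodB U V).incl (· = _) ≫ sndB U V)) := by
    rw [SpanCls.mk_comp_emb, Category.id_comp]
    rfl
  rw [Preadditive.sub_comp, Preadditive.comp_sub, Linear.smul_comp, Linear.comp_smul,
    Category.id_comp, ← kspan_comp, ← kspan_comp, ← kspan_comp, ← e, ← e'] at h
  exact h

/-- Modulo the cohomological ideal, every 2-cell is a linear combination of the spans given by the
orbits of `U × V`. -/
lemma exists_idealGen_sub_sum {U V : RFBiset H G} [Fintype (prodB U V).Orb]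
    (φ : kcell k U ⟶ kcell k V) : ∃ c : (prodB U V).Orb → k,
      IdealGen k (IsCoh k) (φ - ∑ o, c o • kspan k (orbSpan o)) := by
  -- Being a combination of orbit spans modulo the ideal passes to finite sums by adding the
  -- coefficients. It is used for the sum over the orbits of the apex.
  have hsum : ∀ {ι : Type} (S : Finset ι) (s : ι → (kcell k U ⟶ kcell k V)),
      (∀ i ∈ S, ∃ c : (prodB U V).Orb → k,
        IdealGen k (IsCoh k) (s i - ∑ o, c o • kspan k (orbSpan o))) →
      ∃ c : (prodB U V).Orb → k,
        IdealGen k (IsCoh k) (∑ i ∈ S, s i - ∑ o, c o • kspan k (orbSpan o)) := by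
    intro ι S s h
    choose! c hc using h
    refine ⟨fun o => ∑ i ∈ S, c i o, ?_⟩
    have := IdealGen.sum S _ hc
    simp only [Finset.sum_smul]
    rw [Finset.sum_comm, ← Finset.sum_sub_distrib]
    exact this
  induction φ using KLin.ind with
  | zero => exact ⟨0, by simpa using IdealGen.zero _ _⟩
  | add s t hs ht =>
    obtain ⟨c, hc⟩ := hs
    obtain ⟨d, hd⟩ := ht
    refine ⟨c + d, ?_⟩
    have := hc.add hd
    simp only [Pi.add_apply, add_smul, Finset.sum_add_distrib]
    rwa [add_sub_add_comm]
  | smul a s hs =>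
    obtain ⟨c, hc⟩ := hs
    refine ⟨a • c, ?_⟩
    have := hc.smul a
    simp only [Pi.smul_apply, smul_assoc, ← Finset.smul_sum]
    rwa [← smul_sub]
  | of s =>
    induction s using SpanCls.ind with
    | h W l r =>
      classical
      have := Fintype.ofFinite W.Orb
      change ∃ c : (prodB U V).Orb → k,
        IdealGen k (IsCoh k) (kspan k (SpanCls.mk l r) - ∑ o, c o • kspan k (orbSpan o))
      rw [SpanCls.mk_eq_sum, kspan_sum]
      refine hsum _ _ fun o _ => ?_
      obtain ⟨y, x, w, hw⟩ := cls_surj o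
      obtain ⟨c, hc⟩ := exists_idealGen_sub_orbSpan (k := k) (W.incl (· = o) ≫ l)
        (W.incl (· = o) ≫ r) (isTransitive_sub w hw)
      -- A transitive piece of the apex contributes to a single orbit of `U × V`.
      refine ⟨fun o' => if o' = cls (pair (ap (W.incl (· = o) ≫ l) ⟨w, hw⟩)
        (ap (W.incl (· = o) ≫ r) ⟨w, hw⟩)) then c else 0, ?_⟩
      simp only [ite_smul, zero_smul, Finset.sum_ite_eq', Finset.mem_univ, if_true]
      exact hc

/-! ### The cohomological ideal lies in the kernel. -/

/-- The span of a multiplication map acts as multiplication by the index. -/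
lemma toLin_mulB {D : Type} [Group D] [Finite D] (E : Subgroup D) :
    SpanCls.toLin k _ _ (SpanCls.mk (mulB (FinGpd.incl E)) (mulB (FinGpd.incl E))) =
      (E.index : k) • 𝟙 (Bimod.lin k (idB (FinGpd.ofGroup D))) := by
  -- There is only one object and its morphisms are the elements of `D`, both by definition.
  suffices key : ∀ u : D, Bimod.ap (SpanCls.toLin k _ _ (SpanCls.mk (mulB (FinGpd.incl E))
      (mulB (FinGpd.incl E)))) (pt D) (pt D) (Bimod.bas (idB.of (arr u))) =
      (E.index : k) • Bimod.bas (idB.of (arr u)) from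
    Bimod.lin_hom_ext fun y x u => key u
  intro u
  -- The fiber of `μ` over `u` consists of the classes `[g, g⁻¹ u]`, and such a class depends
  -- exactly on the coset `g E`. Since both legs are `μ`, each of the `[D : E]` points of the fiber
  -- contributes `u` itself.
  rw [Bimod.toLin_mk, Bimod.sumFib_bas, Bimod.fibSum_eq (ι := D ⧸ E)
    (fun q => mulMk E q.out (q.out⁻¹ * u))]
  · have h : ∀ q : D ⧸ E, ap (mulB (FinGpd.incl E)) (mulMk E q.out (q.out⁻¹ * u)) =
        idB.of (arr u) := fun q => by rw [mulB_mulMk, mul_inv_cancel_left]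
    have := Fintype.ofFinite (D ⧸ E)
    refine (finsum_congr fun q => congrArg Bimod.bas (h q)).trans ?_
    rw [finsum_eq_sum_of_fintype, Finset.sum_const, Finset.card_univ, ← Nat.card_eq_fintype_card,
      ← Nat.cast_smul_eq_nsmul k]
    rfl
  · intro q q' e
    obtain ⟨a, ha, e1, -⟩ := (mulMk_eq_iff ..).1 e
    rw [← q.out_eq', ← q'.out_eq', e1]
    exact (QuotientGroup.mk_mul_of_mem _ ha)
  · intro q
    rw [mulB_mulMk, mul_inv_cancel_left]
  · intro w hw
    obtain ⟨g, h, rfl⟩ := exists_mulMk E w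
    have hu : g * h = u := hw
    subst hu
    refine ⟨(g : D ⧸ E), (mulMk_eq_iff ..).2 ?_⟩
    obtain ⟨a, ha⟩ := QuotientGroup.mk_out_eq_mul E g
    exact ⟨a, a.2, ha, by rw [ha]; group⟩

lemma linMap₂_cohCell {D : Type} [Group D] [Finite D] (E : Subgroup D) :
    linMap₂ k _ _ (cohCell k E) = 0 := by
  refine (map_sub (linMap₂ k _ _) _ _).trans ?_
  rw [map_smul, linMap₂_of]
  refine sub_eq_zero.2 ((toLin_mulB E).trans (congrArg _ ?_))
  exact ((P k).map₂_id (𝟙 (kobj k (FinGpd.ofGroup D)))).symm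

/-- The kernel of a linear pseudo-functor is an ideal, so it is enough that the generators go to
zero. -/
lemma linMap₂_eq_zero {X Y : KLin k BisetHat} {U V : X ⟶ Y} {φ : U ⟶ V}
    (h : IdealGen k (IsCoh k) φ) : linMap₂ k U V φ = 0 := by
  induction h with
  | of h =>
    cases h with
    | mk E => exact linMap₂_cohCell E
  | zero f g => exact map_zero (linMap₂ k f g)
  | add _ _ hs ht => exact (map_add (linMap₂ k _ _) _ _).trans (by rw [hs, ht, add_zero])
  | smul c _ hs => exact (map_smul (linMap₂ k _ _) c _).trans (by rw [hs, smul_zero])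
  | comp_left s _ ht => exact (linMap₂_comp _ _).trans (by rw [ht, Limits.comp_zero])
  | comp_right t _ hs => exact (linMap₂_comp _ _).trans (by rw [hs, Limits.zero_comp])
  | @hcomp_left a b c f f' g g' s t _ ht =>
    -- Up to the isomorphisms `linTens`, the image of a whiskering of `t` is the image of `t`
    -- tensored with an identity, hence zero; the isomorphism on the target is cancelled as a
    -- monomorphism. The other factor of the horizontal composite plays no role.
    have h : linMap₂ k _ _ (KLin.wL f' t) = 0 := by
      have := linMap₂_wL (k := k) f' t
      rw [ht, Bimod.zero_tensMap, Limits.comp_zero] at this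
      exact (cancel_mono _).1 (this.trans Limits.zero_comp.symm)
    exact (linMap₂_comp _ _).trans ((congrArg _ h).trans Limits.comp_zero)
  | @hcomp_right a b c f f' g g' s t _ hs =>
    have h : linMap₂ k _ _ (KLin.wR g s) = 0 := by
      have := linMap₂_wR (k := k) g s
      rw [hs, Bimod.tensMap_zero, Limits.comp_zero] at this
      exact (cancel_mono _).1 (this.trans Limits.zero_comp.symm)
    exact (linMap₂_comp _ _).trans ((congrArg (· ≫ _) h).trans Limits.zero_comp)

/-! ### Matrix coefficients, and the basis given by the orbit spans. -/

/-- The coefficient of `v` in the image of `u`. -/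
noncomputable def coeff {U V : RFBiset H G} (f : Bimod.lin k U ⟶ Bimod.lin k V) {y : H} {x : G}
    (u : U.E y x) (v : V.E y x) : k :=
  (show V.E y x →₀ k from Bimod.ap f y x (Bimod.bas u)) v

lemma coeff_zero {U V : RFBiset H G} {y : H} {x : G} (u : U.E y x) (v : V.E y x) :
    coeff (0 : Bimod.lin k U ⟶ Bimod.lin k V) u v = 0 := rfl

lemma coeff_add {U V : RFBiset H G} (f g : Bimod.lin k U ⟶ Bimod.lin k V) {y : H} {x : G}
    (u : U.E y x) (v : V.E y x) : coeff (f + g) u v = coeff f u v + coeff g u v := rfl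

lemma coeff_smul {U V : RFBiset H G} (c : k) (f : Bimod.lin k U ⟶ Bimod.lin k V) {y : H} {x : G}
    (u : U.E y x) (v : V.E y x) : coeff (c • f) u v = c * coeff f u v := rfl

lemma coeff_sum {U V : RFBiset H G} {ι : Type*} (S : Finset ι)
    (f : ι → (Bimod.lin k U ⟶ Bimod.lin k V)) {y : H} {x : G}
    (u : U.E y x) (v : V.E y x) : coeff (∑ i ∈ S, f i) u v = ∑ i ∈ S, coeff (f i) u v :=
  map_sum (⟨⟨fun f => coeff f u v, coeff_zero u v⟩, fun f g => coeff_add f g u v⟩ :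
    (Bimod.lin k U ⟶ Bimod.lin k V) →+ k) f S

lemma coeff_ext {U V : RFBiset H G} {f g : Bimod.lin k U ⟶ Bimod.lin k V}
    (h : ∀ (y : H) (x : G) (u : U.E y x) (v : V.E y x), coeff f u v = coeff g u v) : f = g :=
  Bimod.lin_hom_ext fun y x u => Finsupp.ext (h y x u)

/-- The matrix of an equivariant map is constant on the orbits of `U × V`: the action commutes with
`f` and permutes the basis injectively, so coefficients are moved and never merged. -/
lemma coeff_act {U V : RFBiset H G} (f : Bimod.lin k U ⟶ Bimod.lin k V) {y y' : H} {x x' : G}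
    (h : y' ⟶ y) (g : x ⟶ x') (u : U.E y x) (v : V.E y x) :
    coeff f (U.act h g u) (V.act h g v) = coeff f u v := by
  have hinj : Function.Injective (V.act h g : V.E y x → V.E y' x') := fun a b e => by
    simpa using congrArg (V.act (Groupoid.inv h) (Groupoid.inv g)) e
  unfold coeff
  rw [← Bimod.act_bas, Bimod.ap_act]
  exact Finsupp.mapDomain_apply hinj _ v

-- The fiber over `u` of the projection from the orbit to `U` is the set of `(u, v')` in the orbit.
-- The point `v` thus occurs in the sum at most once, and it occurs precisely when `(u, v)` lies in
-- the orbit.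
open Classical in
lemma coeff_orbSpan {U V : RFBiset H G} (o : (prodB U V).Orb) {y : H} {x : G} (u : U.E y x)
    (v : V.E y x) : coeff (SpanCls.toLin k U V (orbSpan o)) u v =
      if cls (pair u v) = o then 1 else 0 := by
  unfold coeff
  rw [orbSpan, Bimod.toLin_mk, Bimod.sumFib_bas, Bimod.fibSum]
  refine (map_finsum_fiber (Finsupp.lapply v : (V.E y x →₀ k) →ₗ[k] k) _).trans ?_
  have hb : ∀ v' : V.E y x, (Finsupp.lapply v : (V.E y x →₀ k) →ₗ[k] k) (Bimod.bas v') =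
      if v' = v then 1 else 0 := fun v' => Finsupp.single_apply
  refine (finsum_congr fun w => hb _).trans ?_
  split_ifs with h
  · rw [finsum_eq_single _ ⟨⟨pair u v, h⟩, rfl⟩]
    · exact if_pos rfl
    · rintro ⟨⟨⟨u', v'⟩, h1⟩, rfl⟩ hne
      refine if_neg fun e => hne ?_
      have e : v' = v := e
      subst e
      rfl
  · refine (finsum_congr fun w => if_neg ?_).trans finsum_zero
    obtain ⟨⟨⟨u', v'⟩, h1⟩, rfl⟩ := w
    intro e
    have e : v' = v := e
    subst e
    exact h h1

/-- The orbits partition `U × V`, so a single indicator matrix is nonzero at `(u, v)` when `k` is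
nontrivial, and the coefficients of a combination of orbit spans can be read off its image. Both
fullness and the computation of the kernel rest on this formula. -/
lemma coeff_sum_orbSpan {U V : RFBiset H G} [Fintype (prodB U V).Orb] (c : (prodB U V).Orb → k)
    {y : H} {x : G} (u : U.E y x) (v : V.E y x) :
    coeff (linMap₂ k (kcell k U) (kcell k V) (∑ o, c o • kspan k (orbSpan o))) u v =
      c (cls (pair u v)) := by
  classical
  rw [map_sum]
  refine (coeff_sum _ _ u v).trans ?_
  have h : ∀ o, coeff (linMap₂ k (kcell k U) (kcell k V) (c o • kspan k (orbSpan o))) u v =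
      if cls (pair u v) = o then c o else 0 := by
    intro o
    rw [map_smul]
    refine (coeff_smul _ _ u v).trans ?_
    have := coeff_orbSpan (k := k) o u v
    rw [kspan, linMap₂_of]
    refine (congrArg (c o * ·) this).trans ?_
    simp
  refine (Finset.sum_congr rfl fun o _ => h o).trans ?_
  simp

lemma exists_pair {U V : RFBiset H G} (o : (prodB U V).Orb) :
    ∃ (y : H) (x : G) (u : U.E y x) (v : V.E y x), cls (pair u v) = o := by
  obtain ⟨y, x, w, h⟩ := cls_surj o
  exact ⟨y, x, w.1, w.2, h⟩

lemma linMap₂_surjective (U V : RFBiset H G) :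
    Function.Surjective (linMap₂ k (kcell k U) (kcell k V)) := by
  intro f
  have := Fintype.ofFinite (prodB U V).Orb
  -- The coefficient given to an orbit is the entry of `f` at a chosen representative; by
  -- `coeff_act` it is the entry of `f` at every point of the orbit.
  choose y x u v h using exists_pair (U := U) (V := V)
  refine ⟨∑ o, coeff f (u o) (v o) • kspan k (orbSpan o), coeff_ext fun y' x' u' v' => ?_⟩
  refine (coeff_sum_orbSpan _ u' v').trans ?_
  obtain ⟨a, b, e⟩ := cls_eq_iff.1 (h (cls (pair u' v')))
  rw [pair_act] at e
  have e1 : U.act a b (u _) = u' := congrArg Prod.fst e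
  have e2 : V.act a b (v _) = v' := congrArg Prod.snd e
  exact (coeff_act f a b _ _).symm.trans (congrArg₂ (coeff f) e1 e2)

/-- Write `φ` as a combination of orbit spans plus an element of the ideal. The latter is killed, so
the combination is killed as well; its coefficients then vanish, and `φ` is the remaining element of
the ideal. -/
lemma idealGen_of_linMap₂_eq_zero {U V : RFBiset H G} {φ : kcell k U ⟶ kcell k V}
    (hφ : linMap₂ k (kcell k U) (kcell k V) φ = 0) : IdealGen k (IsCoh k) φ := by
  have := Fintype.ofFinite (prodB U V).Orb
  obtain ⟨c, hc⟩ := exists_idealGen_sub_sum φ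
  have h0 := linMap₂_eq_zero hc
  have h1 := (map_sub (linMap₂ k (kcell k U) (kcell k V)) φ _).symm.trans h0
  rw [hφ, zero_sub, neg_eq_zero] at h1
  have hc0 : c = 0 := by
    funext o
    obtain ⟨y, x, u, v, rfl⟩ := exists_pair o
    rw [← coeff_sum_orbSpan c u v]
    exact congrArg (fun f => coeff f u v) h1
  subst hc0
  simpa using hc

end

end Yoshida

/-! ### The main theorem, assembled from the results above. -/

theorem theorem4p7 (k : Type u) [CommRing k] :
    -- on 2-cells, `P` is the unique `k`-linear extension of its restriction to spans
    (∀ (X Y : Yoshida.KLin k Yoshida.BisetHat) (U V : X ⟶ Y),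
      ∃ F : (U ⟶ V) →ₗ[k] ((Yoshida.P k).map U ⟶ (Yoshida.P k).map V),
        (∀ φ : U ⟶ V, F φ = (Yoshida.P k).map₂ φ) ∧
        ∀ F' : (U ⟶ V) →ₗ[k] ((Yoshida.P k).map U ⟶ (Yoshida.P k).map V),
          (∀ s : U.as ⟶ V.as, F' (Yoshida.KLin.of s) = F (Yoshida.KLin.of s)) → F' = F) ∧
    -- `P` is the identity on objects
    (∀ X : Yoshida.KLin k Yoshida.BisetHat, (Yoshida.P k).obj X = ⟨X.as.gpd⟩) ∧
    -- `P` is essentially surjective on 1-cells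
    (∀ (X Y : Yoshida.KLin k Yoshida.BisetHat) (M : (Yoshida.P k).obj X ⟶ (Yoshida.P k).obj Y),
      ∃ U : X ⟶ Y, Nonempty ((Yoshida.P k).map U ≅ M)) ∧
    -- `P` is full on 2-cells
    (∀ (X Y : Yoshida.KLin k Yoshida.BisetHat) (U V : X ⟶ Y),
      Function.Surjective fun φ : U ⟶ V => (Yoshida.P k).map₂ φ) ∧
    -- the kernel of `P` on 2-cells is the ideal generated by the cohomological 2-cells
    (∀ (X Y : Yoshida.KLin k Yoshida.BisetHat) (U V : X ⟶ Y) (φ : U ⟶ V),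
      (Yoshida.P k).map₂ φ = 0 ↔ Yoshida.IdealGen k (Yoshida.IsCoh k) φ) := by
  refine ⟨fun X Y U V => ⟨Yoshida.linMap₂ k U V, fun φ => rfl, fun F' h => ?_⟩, fun X => rfl,
    fun X Y M => ?_, fun X Y U V => ?_, fun X Y U V φ => ⟨fun h => ?_, fun h => ?_⟩⟩
  -- A linear map out of the group completion with extended scalars is determined by its values on
  -- the original monoid, here the isomorphism classes of spans.
  · exact Yoshida.kExt.hom_ext h
  -- The stable basis of `M` is the biset that is sought, and `M` is isomorphic to its
  -- linearization.
  · obtain ⟨S, ⟨e⟩⟩ := Yoshida.Bimod.isPermRF_iff.1 M.perm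
    exact ⟨⟨S⟩, ⟨Yoshida.PermRF.isoMk e⟩⟩
  · exact Yoshida.linMap₂_surjective (k := k) (H := X.as.gpd) (G := Y.as.gpd) U.as V.as
  · exact Yoshida.idealGen_of_linMap₂_eq_zero (k := k) (H := X.as.gpd) (G := Y.as.gpd) h
  · exact Yoshida.linMap₂_eq_zero h
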